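/- **Conventions.** For a complex Banach space $F$ let $\mathscr S'(\mathbb R^d;F)=\mathcal L(\mathscr S(\mathbb R^d),F)$, where $\mathscr S(\mathbb R^d)$ is the space of complex-valued Schwartz functions. Fix $\varphi\in\mathscr S(\mathbb R^d)$ with $0\le\widehat\varphi\le1$, $\widehat\varphi(\xi)=1$ for $|\xi|\le1$ and $\widehat\varphi(\xi)=0$ for $|\xi|\ge\frac32$ (with $\widehat\varphi(\xi)=\int e^{-2\pi i\langle \xi,x\rangle}\varphi(x)\,dx$), and let $\varphi_0=\varphi$, $\widehat\varphi_k=\widehat\varphi(2^{-k}\cdot)-\widehat\varphi(2^{-k+1}\cdot)$ for $k\ge1$. For $\sigma\in\mathbb R$ and $p,q\in(0,\infty)$ set $$\|f\|_{B^\sigma_{p,q}(\mathbb R^d;F)}=\Big(\sum_{k\ge0}2^{k\sigma q}\|\varphi_k*f\|_{L^p(\mathbb R^d;F)}^q\Big)^{1/q},\qquad B^\sigma_{p,q}(\mathbb R^d;F)=\{f\in\mathscr S'(\mathbb R^d;F):\|f\|_{B^\sigma_{p,q}(\mathbb R^d;F)}<\infty\},$$ and $B^\sigma_{p,q}(\mathbb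 R^d)=B^\sigma_{p,q}(\mathbb R^d;\mathbb C)$. Let $H$ be a separable Hilbert space, real or complex, with inner product $\langle\cdot,\cdot\rangle_H$ linear in the first argument. Put $E=B^\sigma_{p,q}(\mathbb R^d)$. If $H$ is real, consider the real-linear operators $R\colon H\to E$, and read $B^\sigma_{p,q}(\mathbb R^d;H)$ as the Besov space with values in the complexification of $H$, into which $H$ is embedded. If $H$ is complex, consider the conjugate-linear operators $R\colon H\to E$. For such $R$ let $$\|R\|_{\gamma}=\sup\Big(\mathbb E\Big\|\sum_{n=1}^N\gamma_nRh_n\Big\|_{E}^2\Big)^{1/2},$$ where the supremum is over all finite orthonormal systems $h_1,\dots,h_N$ in $H$ and $\gamma_1,\gamma_2,\dots$ are independent standard real Gaussian random variables. The finite rank operators are the finite sums $\sum_n h_n\otimes x_n$ with $h_n\in H$, $x_n\in E$, where $(h\otimes x)g=\langle g,h\rangle_Hx$ for real $H$ and $(h\otimes x)g=\langle h,g\rangle_Hx$ for complex $H$. The space $\gamma(H,E)$ is the closure, with respect to $\|\cdot\|_\gamma$, of the finite rank operators in the space of all such operators $R$ with $\|R\|_\gamma<\infty$. **Proposition A.1.**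 For all $p,q\in(0,\infty)$ there is a constant $C$, depending only on $p$ and $q$, such that the following holds for all $d\in\mathbb N$, $\sigma\in\mathbb R$, all $\varphi$ as above and all separable (real or complex) Hilbert spaces $H$. (i) For every finite rank operator $R=\sum_n h_n\otimes x_n$, with $G=\sum_n x_n(\cdot)\,h_n\in\mathscr S'(\mathbb R^d;H)$, $$C^{-1}\|G\|_{B^\sigma_{p,q}(\mathbb R^d;H)}\le\|R\|_\gamma\le C\,\|G\|_{B^\sigma_{p,q}(\mathbb R^d;H)}.$$ (ii) The map $I(G)h=\langle G,h\rangle_H$, i.e. $(I(G)h)(\psi)=\langle G(\psi),h\rangle_H$ for $\psi\in\mathscr S(\mathbb R^d)$, is a $\mathbb C$-linear isomorphism of $B^\sigma_{p,q}(\mathbb R^d;H)$ onto $\gamma(H,B^\sigma_{p,q}(\mathbb R^d))$: it is linear, injective, has range exactly $\gamma(H,B^\sigma_{p,q}(\mathbb R^d))$, and $$C^{-1}\|G\|_{B^\sigma_{p,q}(\mathbb R^d;H)}\le\|I(G)\|_\gamma\le C\,\|G\|_{B^\sigma_{p,q}(\mathbb R^d;H)}\qquad\text{for all }G\in B^\sigma_{p,q}(\mathbb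 R^d;H).$$ -/

import Mathlib

open MeasureTheory ProbabilityTheory SchwartzMap FourierTransform
open scoped ENNReal NNReal

noncomputable section

namespace BesovGamma

/-! ### Operators on tempered distributions -/

section Distributions

variable {d : ℕ} {F : Type*} [NormedAddCommGroup F] [NormedSpace ℂ F]

/-- The dilation `ψ ↦ ψ(a ·)`, `a ≠ 0`, on Schwartz functions. -/
def dilate (a : ℝˣ) :
    𝓢(EuclideanSpace ℝ (Fin d), ℂ) →L[ℂ] 𝓢(EuclideanSpace ℝ (Fin d), ℂ) :=
  compCLMOfContinuousLinearEquiv ℂ (ContinuousLinearEquiv.smulLeft a)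

theorem dilate_apply (a : ℝˣ) (ψ : 𝓢(EuclideanSpace ℝ (Fin d), ℂ))
    (x : EuclideanSpace ℝ (Fin d)) : dilate a ψ x = ψ ((a : ℝ) • x) := rfl

/-- The reflection `ψ ↦ ψ(- ·)` on Schwartz functions. -/
def reflect :
    𝓢(EuclideanSpace ℝ (Fin d), ℂ) →L[ℂ] 𝓢(EuclideanSpace ℝ (Fin d), ℂ) :=
  compCLMOfContinuousLinearEquiv ℂ (ContinuousLinearEquiv.neg ℝ)

theorem reflect_apply (ψ : 𝓢(EuclideanSpace ℝ (Fin d), ℂ)) (x : EuclideanSpace ℝ (Fin d)) :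
    reflect ψ x = ψ (-x) := rfl

/-- The convolution `ψ * f` of a Schwartz function and a tempered distribution,
`(ψ * f)(g) = f(ψ(- ·) * g)`. -/
def conv (ψ : 𝓢(EuclideanSpace ℝ (Fin d), ℂ)) :
    𝓢'(EuclideanSpace ℝ (Fin d), F) →L[ℂ] 𝓢'(EuclideanSpace ℝ (Fin d), F) :=
  PointwiseConvergenceCLM.precomp F
    (SchwartzMap.convolution (ContinuousLinearMap.mul ℂ ℂ) (reflect ψ))

theorem conv_apply (ψ : 𝓢(EuclideanSpace ℝ (Fin d), ℂ))
    (f : 𝓢'(EuclideanSpace ℝ (Fin d), F)) (g : 𝓢(EuclideanSpace ℝ (Fin d), ℂ)) :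
    conv ψ f g =
      f (SchwartzMap.convolution (ContinuousLinearMap.mul ℂ ℂ) (reflect ψ) g) := rfl

/-- The convolution of Schwartz functions used above is
`(ψ(- ·) * g)(ξ) = ∫ ψ(y - ξ) g(y) dy`. -/
theorem reflect_convolution_apply (ψ g : 𝓢(EuclideanSpace ℝ (Fin d), ℂ))
    (ξ : EuclideanSpace ℝ (Fin d)) :
    SchwartzMap.convolution (ContinuousLinearMap.mul ℂ ℂ) (reflect ψ) g ξ =
      ∫ y, ψ (y - ξ) * g y := by
  rw [SchwartzMap.convolution_apply, ← MeasureTheory.convolution_flip]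
  simp [MeasureTheory.convolution, reflect_apply, mul_comm]

/-- The distribution `u` is (integration against) the function `g`. -/
def IsRepresentedBy (u : 𝓢'(EuclideanSpace ℝ (Fin d), F))
    (g : EuclideanSpace ℝ (Fin d) → F) : Prop :=
  AEStronglyMeasurable g volume ∧
    ∀ ψ : 𝓢(EuclideanSpace ℝ (Fin d), ℂ),
      Integrable (fun x => ψ x • g x) volume ∧ u ψ = ∫ x, ψ x • g x

/-- The `L^p(ℝ^d; F)`-norm of a distribution: the norm of the function representing it (this
function is unique up to null sets), and `∞` if it is not represented by a function. -/
def distLpNorm (p : ℝ) (u : 𝓢'(EuclideanSpace ℝ (Fin d), F)) : ℝ≥0∞ :=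
  ⨅ (g : EuclideanSpace ℝ (Fin d) → F) (_ : IsRepresentedBy u g),
    eLpNorm g (ENNReal.ofReal p) volume

/-- The distribution `x ⊗ h`, i.e. `ψ ↦ x(ψ) h`. -/
def tensor (x : 𝓢'(EuclideanSpace ℝ (Fin d), ℂ)) (h : F) : 𝓢'(EuclideanSpace ℝ (Fin d), F) :=
  PointwiseConvergenceCLM.postcomp 𝓢(EuclideanSpace ℝ (Fin d), ℂ)
    (ContinuousLinearMap.toSpanSingleton ℂ h) x

theorem tensor_apply (x : 𝓢'(EuclideanSpace ℝ (Fin d), ℂ)) (h : F)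
    (ψ : 𝓢(EuclideanSpace ℝ (Fin d), ℂ)) : tensor x h ψ = x ψ • h := rfl

end Distributions

/-- The distribution `⟨G, h⟩`, i.e. `ψ ↦ ⟨G(ψ), h⟩`, where `⟨·, ·⟩` is linear in the first
argument (Mathlib's `inner ℂ` is linear in the second one). -/
def pair {d : ℕ} {K : Type*} [NormedAddCommGroup K] [InnerProductSpace ℂ K]
    (h : K) (G : 𝓢'(EuclideanSpace ℝ (Fin d), K)) : 𝓢'(EuclideanSpace ℝ (Fin d), ℂ) :=
  PointwiseConvergenceCLM.postcomp 𝓢(EuclideanSpace ℝ (Fin d), ℂ) (innerSL ℂ h) G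

theorem pair_apply {d : ℕ} {K : Type*} [NormedAddCommGroup K] [InnerProductSpace ℂ K]
    (h : K) (G : 𝓢'(EuclideanSpace ℝ (Fin d), K)) (ψ : 𝓢(EuclideanSpace ℝ (Fin d), ℂ)) :
    pair h G ψ = inner ℂ h (G ψ) := rfl

/-! ### Besov spaces -/

section Besov

variable {d : ℕ} {F : Type*} [NormedAddCommGroup F] [NormedSpace ℂ F]

/-- The Schwartz functions `φ` that generate a Littlewood-Paley decomposition:
`0 ≤ φ̂ ≤ 1`, `φ̂(ξ) = 1` for `|ξ| ≤ 1` and `φ̂(ξ) = 0` for `|ξ| ≥ 3/2`. -/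
structure IsGenerator (φ : 𝓢(EuclideanSpace ℝ (Fin d), ℂ)) : Prop where
  mem_Icc : ∀ ξ, ∃ t ∈ Set.Icc (0 : ℝ) 1, 𝓕 φ ξ = (t : ℂ)
  eq_one : ∀ ξ, ‖ξ‖ ≤ 1 → 𝓕 φ ξ = 1
  eq_zero : ∀ ξ, 3 / 2 ≤ ‖ξ‖ → 𝓕 φ ξ = 0

/-- The real unit `2⁻ᵏ`. -/
def twoInv (k : ℕ) : ℝˣ := Units.mk0 ((2 : ℝ)⁻¹ ^ k) (by positivity)

/-- The functions `φ_k`: `φ_0 = φ`, and `φ̂_k = φ̂(2⁻ᵏ ·) - φ̂(2⁻ᵏ⁺¹ ·)` for `k ≥ 1`. -/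
def block (φ : 𝓢(EuclideanSpace ℝ (Fin d), ℂ)) : ℕ → 𝓢(EuclideanSpace ℝ (Fin d), ℂ)
  | 0 => φ
  | k + 1 => 𝓕⁻ (dilate (twoInv (k + 1)) (𝓕 φ) - dilate (twoInv k) (𝓕 φ))

theorem fourier_block_succ (φ : 𝓢(EuclideanSpace ℝ (Fin d), ℂ)) (k : ℕ)
    (ξ : EuclideanSpace ℝ (Fin d)) :
    𝓕 (block φ (k + 1)) ξ =
      𝓕 φ (((2 : ℝ)⁻¹ ^ (k + 1)) • ξ) - 𝓕 φ (((2 : ℝ)⁻¹ ^ k) • ξ) := by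
  simp [block, dilate_apply, twoInv]

/-- The Besov quasi-norm
`‖f‖ = (∑_{k ≥ 0} (2^{kσ} ‖φ_k * f‖_{L^p(ℝ^d; F)})^q)^{1/q}` in `[0, ∞]`. -/
def besovNorm (φ : 𝓢(EuclideanSpace ℝ (Fin d), ℂ)) (σ p q : ℝ)
    (f : 𝓢'(EuclideanSpace ℝ (Fin d), F)) : ℝ≥0∞ :=
  (∑' k : ℕ, (ENNReal.ofReal ((2 : ℝ) ^ ((k : ℝ) * σ)) *
    distLpNorm p (conv (block φ k) f)) ^ q) ^ (1 / q)

theorem IsRepresentedBy.add {u v : 𝓢'(EuclideanSpace ℝ (Fin d), F)}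
    {g h : EuclideanSpace ℝ (Fin d) → F} (hu : IsRepresentedBy u g) (hv : IsRepresentedBy v h) :
    IsRepresentedBy (u + v) (g + h) := by
  refine ⟨hu.1.add hv.1, fun ψ => ?_⟩
  have e : (fun x => ψ x • (g + h) x) = fun x => ψ x • g x + ψ x • h x := by
    funext x; simp [smul_add]
  rw [e]
  refine ⟨(hu.2 ψ).1.add (hv.2 ψ).1, ?_⟩
  rw [integral_add (hu.2 ψ).1 (hv.2 ψ).1, ← (hu.2 ψ).2, ← (hv.2 ψ).2]
  rfl

theorem IsRepresentedBy.map {F' : Type*} [NormedAddCommGroup F'] [NormedSpace ℂ F']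
    [CompleteSpace F] [CompleteSpace F']
    {u : 𝓢'(EuclideanSpace ℝ (Fin d), F)} {g : EuclideanSpace ℝ (Fin d) → F}
    (hu : IsRepresentedBy u g) (L : F →L[ℂ] F') :
    IsRepresentedBy (PointwiseConvergenceCLM.postcomp 𝓢(EuclideanSpace ℝ (Fin d), ℂ) L u)
      (fun x => L (g x)) := by
  refine ⟨L.continuous.comp_aestronglyMeasurable hu.1, fun ψ => ?_⟩
  have e : (fun x => ψ x • L (g x)) = fun x => L (ψ x • g x) := by
    funext x; simp
  rw [e]
  refine ⟨L.integrable_comp (hu.2 ψ).1, ?_⟩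
  rw [L.integral_comp_comm (hu.2 ψ).1, ← (hu.2 ψ).2]
  rfl

theorem IsRepresentedBy.smul {u : 𝓢'(EuclideanSpace ℝ (Fin d), F)}
    {g : EuclideanSpace ℝ (Fin d) → F} (hu : IsRepresentedBy u g) (c : ℂ) :
    IsRepresentedBy (c • u) (c • g) := by
  refine ⟨hu.1.const_smul c, fun ψ => ?_⟩
  have e : (fun x => ψ x • (c • g) x) = fun x => c • (ψ x • g x) := by
    funext x; exact smul_comm (ψ x) c (g x)
  rw [e]
  refine ⟨(hu.2 ψ).1.smul c, ?_⟩
  rw [integral_smul, ← (hu.2 ψ).2]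
  rfl

theorem distLpNorm_add_le (p : ℝ) (u v : 𝓢'(EuclideanSpace ℝ (Fin d), F)) :
    distLpNorm p (u + v) ≤
      ENNReal.LpAddConst (ENNReal.ofReal p) * (distLpNorm p u + distLpNorm p v) := by
  have hC := (ENNReal.LpAddConst_lt_top (ENNReal.ofReal p)).ne
  have hC0 : ENNReal.LpAddConst (ENNReal.ofReal p) ≠ 0 := by
    unfold ENNReal.LpAddConst
    split_ifs <;> simp
  rw [← ENNReal.inv_mul_le_iff hC0 hC]
  refine ENNReal.le_iInf_add_iInf fun g h => ENNReal.le_iInf_add_iInf fun hg hh => ?_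
  rw [ENNReal.inv_mul_le_iff hC0 hC]
  exact (iInf₂_le (g + h) (hg.add hh)).trans (eLpNorm_add_le' hg.1 hh.1 _)

theorem distLpNorm_zero (p : ℝ) :
    distLpNorm p (0 : 𝓢'(EuclideanSpace ℝ (Fin d), F)) = 0 := by
  refine le_antisymm ((iInf₂_le 0 ⟨aestronglyMeasurable_zero, fun ψ => ?_⟩).trans ?_) bot_le
  · simp
  · simp

theorem distLpNorm_smul_le (p : ℝ) (c : ℂ) (u : 𝓢'(EuclideanSpace ℝ (Fin d), F)) :
    distLpNorm p (c • u) ≤ ENNReal.ofReal (1 + ‖c‖) * distLpNorm p u := by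
  have h0 : ENNReal.ofReal (1 + ‖c‖) ≠ 0 := by
    have : 0 < 1 + ‖c‖ := by positivity
    simpa using this
  rw [← ENNReal.inv_mul_le_iff h0 ENNReal.ofReal_ne_top]
  refine le_iInf₂ fun g hg => ?_
  rw [ENNReal.inv_mul_le_iff h0 ENNReal.ofReal_ne_top]
  refine (iInf₂_le (c • g) (hg.smul c)).trans (eLpNorm_const_smul_le.trans ?_)
  gcongr
  rw [← ofReal_norm]
  exact ENNReal.ofReal_le_ofReal (by linarith)

theorem distLpNorm_postcomp_le {F' : Type*} [NormedAddCommGroup F'] [NormedSpace ℂ F']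
    [CompleteSpace F] [CompleteSpace F'] (p : ℝ) (L : F →L[ℂ] F')
    (u : 𝓢'(EuclideanSpace ℝ (Fin d), F)) :
    distLpNorm p (PointwiseConvergenceCLM.postcomp 𝓢(EuclideanSpace ℝ (Fin d), ℂ) L u) ≤
      ENNReal.ofReal (1 + ‖L‖) * distLpNorm p u := by
  have h0 : ENNReal.ofReal (1 + ‖L‖) ≠ 0 := by
    have : 0 < 1 + ‖L‖ := by positivity
    simpa using this
  rw [← ENNReal.inv_mul_le_iff h0 ENNReal.ofReal_ne_top]
  refine le_iInf₂ fun g hg => ?_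
  rw [ENNReal.inv_mul_le_iff h0 ENNReal.ofReal_ne_top]
  refine (iInf₂_le _ (hg.map L)).trans ?_
  refine eLpNorm_le_mul_eLpNorm_of_ae_le_mul (Filter.Eventually.of_forall fun x => ?_) _
  exact (L.le_opNorm _).trans (by gcongr; linarith)

theorem besovNorm_lt_top_of_le {F₁ F₂ : Type*} [NormedAddCommGroup F₁] [NormedSpace ℂ F₁]
    [NormedAddCommGroup F₂] [NormedSpace ℂ F₂]
    (φ : 𝓢(EuclideanSpace ℝ (Fin d), ℂ)) (σ p : ℝ) {q : ℝ} (hq : 0 < q)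
    {f : 𝓢'(EuclideanSpace ℝ (Fin d), F)} {f₁ : 𝓢'(EuclideanSpace ℝ (Fin d), F₁)}
    {f₂ : 𝓢'(EuclideanSpace ℝ (Fin d), F₂)} {C : ℝ≥0∞} (hC : C ≠ ⊤)
    (h : ∀ k, distLpNorm p (conv (block φ k) f) ≤
      C * (distLpNorm p (conv (block φ k) f₁) + distLpNorm p (conv (block φ k) f₂)))
    (h₁ : besovNorm φ σ p q f₁ < ⊤) (h₂ : besovNorm φ σ p q f₂ < ⊤) :
    besovNorm φ σ p q f < ⊤ := by
  unfold besovNorm at h₁ h₂ ⊢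
  rw [ENNReal.rpow_lt_top_iff_of_pos (by positivity)] at h₁ h₂ ⊢
  set w : ℕ → ℝ≥0∞ := fun k => ENNReal.ofReal ((2 : ℝ) ^ ((k : ℝ) * σ))
  set a : ℕ → ℝ≥0∞ := fun k => distLpNorm p (conv (block φ k) f₁)
  set b : ℕ → ℝ≥0∞ := fun k => distLpNorm p (conv (block φ k) f₂)
  have key : ∀ k, (w k * distLpNorm p (conv (block φ k) f)) ^ q ≤
      (2 * C) ^ q * ((w k * a k) ^ q + (w k * b k) ^ q) := by
    intro k
    have h3 : w k * distLpNorm p (conv (block φ k) f) ≤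
        2 * C * max (w k * a k) (w k * b k) := by
      calc w k * distLpNorm p (conv (block φ k) f) ≤ w k * (C * (a k + b k)) := by
            gcongr; exact h k
        _ = C * (w k * a k + w k * b k) := by ring
        _ ≤ C * (max (w k * a k) (w k * b k) + max (w k * a k) (w k * b k)) := by
            gcongr
            · exact le_max_left _ _
            · exact le_max_right _ _
        _ = 2 * C * max (w k * a k) (w k * b k) := by ring
    refine (ENNReal.rpow_le_rpow h3 hq.le).trans ?_
    rw [ENNReal.mul_rpow_of_nonneg _ _ hq.le]
    gcongr
    rcases le_total (w k * a k) (w k * b k) with h4 | h4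
    · rw [max_eq_right h4]; exact le_add_self
    · rw [max_eq_left h4]; exact le_self_add
  refine (ENNReal.tsum_le_tsum key).trans_lt ?_
  rw [ENNReal.tsum_mul_left, ENNReal.tsum_add]
  exact ENNReal.mul_lt_top
    (ENNReal.rpow_lt_top_of_nonneg hq.le (ENNReal.mul_ne_top (by simp) hC))
    (ENNReal.add_lt_top.2 ⟨h₁, h₂⟩)

variable (F) in
/-- The Besov space `B^σ_{p,q}(ℝ^d; F)`, as a space of tempered distributions. -/
def besovSpace (φ : 𝓢(EuclideanSpace ℝ (Fin d), ℂ)) (σ p : ℝ) {q : ℝ} (hq : 0 < q) :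
    Submodule ℂ (𝓢'(EuclideanSpace ℝ (Fin d), F)) where
  carrier := {f | besovNorm φ σ p q f < ⊤}
  zero_mem' := by
    simp [besovNorm, distLpNorm_zero, hq]
  add_mem' := fun {f g} hf hg =>
    besovNorm_lt_top_of_le φ σ p hq (ENNReal.LpAddConst_lt_top (ENNReal.ofReal p)).ne
      (fun k => by rw [map_add]; exact distLpNorm_add_le p _ _) hf hg
  smul_mem' := fun c f hf =>
    besovNorm_lt_top_of_le φ σ p hq (ENNReal.ofReal_ne_top (r := 1 + ‖c‖))
      (fun k => by
        rw [map_smul]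
        refine (distLpNorm_smul_le p c _).trans ?_
        gcongr
        exact le_self_add) hf hf

theorem mem_besovSpace (φ : 𝓢(EuclideanSpace ℝ (Fin d), ℂ)) (σ p : ℝ) {q : ℝ} (hq : 0 < q)
    (f : 𝓢'(EuclideanSpace ℝ (Fin d), F)) :
    f ∈ besovSpace F φ σ p hq ↔ besovNorm φ σ p q f < ⊤ := Iff.rfl

theorem pair_mem_besovSpace {K : Type*} [NormedAddCommGroup K] [InnerProductSpace ℂ K]
    [CompleteSpace K] (φ : 𝓢(EuclideanSpace ℝ (Fin d), ℂ)) (σ p : ℝ) {q : ℝ} (hq : 0 < q)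
    (h : K) {G : 𝓢'(EuclideanSpace ℝ (Fin d), K)} (hG : G ∈ besovSpace K φ σ p hq) :
    pair h G ∈ besovSpace ℂ φ σ p hq :=
  besovNorm_lt_top_of_le φ σ p hq (ENNReal.ofReal_ne_top (r := 1 + ‖innerSL ℂ h‖))
    (fun k => by
      have e : conv (block φ k) (pair h G) =
        PointwiseConvergenceCLM.postcomp 𝓢(EuclideanSpace ℝ (Fin d), ℂ) (innerSL ℂ h)
          (conv (block φ k) G) := rfl
      rw [e]
      refine (distLpNorm_postcomp_le p (innerSL ℂ h) _).trans ?_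
      gcongr
      exact le_self_add) hG hG

end Besov

/-! ### `γ`-radonifying operators

Here `H` is a Hilbert space over `𝕜`, `E` is a vector space over `𝕂` with quasi-norm `N`, and the
operators `H → E` are semilinear with respect to a homomorphism `τ : 𝕜 → 𝕂`. For linear operators
on a real Hilbert space `τ` is the identity of `ℝ`; for conjugate-linear operators on a complex
Hilbert space it is the complex conjugation. -/

section Gamma

variable {𝕜 𝕂 H E : Type*} [RCLike 𝕜] [RCLike 𝕂] {τ : 𝕜 →+* 𝕂}
  [NormedAddCommGroup H] [InnerProductSpace 𝕜 H] [AddCommGroup E] [Module 𝕂 E]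

/-- The `γ`-norm: the supremum of `(𝔼 N(∑ᵢ γᵢ R hᵢ)²)^{1/2}` over all finite orthonormal systems
`h` in `H`, where `γᵢ` are independent standard real Gaussian random variables. -/
def gammaNorm (N : E → ℝ≥0∞) (R : H →ₛₗ[τ] E) : ℝ≥0∞ :=
  ⨆ (n : ℕ) (h : Fin n → H) (_ : Orthonormal 𝕜 h),
    (∫⁻ ω : Fin n → ℝ, N (∑ i, ((ω i : ℝ) : 𝕂) • R (h i)) ^ 2
      ∂(Measure.pi fun _ => gaussianReal 0 1)) ^ (1 / 2 : ℝ)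

variable (τ) in
/-- The rank one operator `h ⊗ x`, that is `g ↦ τ⟨g, h⟩ x`, where `⟨·, ·⟩` is linear in the first
argument (Mathlib's `inner 𝕜` is linear in the second one). -/
def rankOne (h : H) (x : E) : H →ₛₗ[τ] E where
  toFun g := τ (inner 𝕜 h g) • x
  map_add' a b := by simp [inner_add_right, add_smul]
  map_smul' c a := by simp [inner_smul_right, mul_smul]

/-- The finite rank operators: linear combinations of the operators `h ⊗ x`. -/
def IsFiniteRank (R : H →ₛₗ[τ] E) : Prop :=
  R ∈ Submodule.span 𝕂 (Set.range fun a : H × E => rankOne τ a.1 a.2)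

variable (τ H) in
/-- The space `γ(H, E)`: the closure of the finite rank operators in the space of `γ`-summing
operators, i.e. of the operators with finite `γ`-norm. -/
def gammaSpace (N : E → ℝ≥0∞) : Set (H →ₛₗ[τ] E) :=
  {R | gammaNorm N R < ⊤ ∧
    ∀ ε : ℝ≥0∞, 0 < ε → ∃ S : H →ₛₗ[τ] E, IsFiniteRank S ∧ gammaNorm N (R - S) < ε}

end Gamma

/-! ### The complexification of a real Hilbert space -/

section Complexification

/-- The complexification `H ⊕ iH` of a real Hilbert space `H`. -/
def Complexification (H : Type*) : Type _ := WithLp 2 (H × H)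

namespace Complexification

variable {H : Type*}

/-- The element `x + iy`. -/
def mk (x y : H) : Complexification H := WithLp.toLp 2 (x, y)

/-- The real part of `x + iy`. -/
def re (z : Complexification H) : H := WithLp.fst z

/-- The imaginary part of `x + iy`. -/
def im (z : Complexification H) : H := WithLp.snd z

@[simp] theorem re_mk (x y : H) : (mk x y).re = x := rfl

@[simp] theorem im_mk (x y : H) : (mk x y).im = y := rfl

theorem eq_of_re_im {z w : Complexification H} (h : z.re = w.re) (h' : z.im = w.im) : z = w :=
  WithLp.ofLp_injective 2 (Prod.ext h h')

variable [NormedAddCommGroup H]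

instance : NormedAddCommGroup (Complexification H) :=
  inferInstanceAs (NormedAddCommGroup (WithLp 2 (H × H)))

instance [CompleteSpace H] : CompleteSpace (Complexification H) :=
  inferInstanceAs (CompleteSpace (WithLp 2 (H × H)))

@[simp] theorem re_add (z w : Complexification H) : (z + w).re = z.re + w.re := rfl

@[simp] theorem im_add (z w : Complexification H) : (z + w).im = z.im + w.im := rfl

@[simp] theorem re_zero : (0 : Complexification H).re = 0 := rfl

@[simp] theorem im_zero : (0 : Complexification H).im = 0 := rfl

theorem norm_sq (z : Complexification H) : ‖z‖ ^ 2 = ‖z.re‖ ^ 2 + ‖z.im‖ ^ 2 :=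
  WithLp.prod_norm_sq_eq_of_L2 (α := H) (β := H) z

variable [InnerProductSpace ℝ H]

instance : SMul ℂ (Complexification H) :=
  ⟨fun c z => mk (c.re • z.re - c.im • z.im) (c.re • z.im + c.im • z.re)⟩

@[simp] theorem re_smul (c : ℂ) (z : Complexification H) :
    (c • z).re = c.re • z.re - c.im • z.im := rfl

@[simp] theorem im_smul (c : ℂ) (z : Complexification H) :
    (c • z).im = c.re • z.im + c.im • z.re := rfl

instance : Module ℂ (Complexification H) where
  one_smul z := eq_of_re_im (by simp) (by simp)
  mul_smul a b z := eq_of_re_im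
    (by simp only [re_smul, im_smul, Complex.mul_re, Complex.mul_im]; module)
    (by simp only [re_smul, im_smul, Complex.mul_re, Complex.mul_im]; module)
  smul_zero a := eq_of_re_im (by simp) (by simp)
  smul_add a z w := eq_of_re_im
    (by simp only [re_smul, re_add, im_add]; module)
    (by simp only [im_smul, re_add, im_add]; module)
  add_smul a b z := eq_of_re_im
    (by simp only [re_smul, re_add, Complex.add_re, Complex.add_im]; module)
    (by simp only [im_smul, im_add, Complex.add_re, Complex.add_im]; module)
  zero_smul z := eq_of_re_im (by simp) (by simp)

/-- The inner product of the complexification; as always in Mathlib it is linear in the second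
argument. -/
instance : Inner ℂ (Complexification H) :=
  ⟨fun z w => ⟨inner ℝ z.re w.re + inner ℝ z.im w.im, inner ℝ z.re w.im - inner ℝ z.im w.re⟩⟩

theorem inner_def (z w : Complexification H) : inner ℂ z w =
    (⟨inner ℝ z.re w.re + inner ℝ z.im w.im, inner ℝ z.re w.im - inner ℝ z.im w.re⟩ : ℂ) := rfl

theorem norm_smul_le' (c : ℂ) (z : Complexification H) : ‖c • z‖ ≤ ‖c‖ * ‖z‖ := by
  refine le_of_eq ((sq_eq_sq₀ (by positivity) (by positivity)).1 ?_)
  rw [norm_sq, mul_pow, norm_sq z, Complex.sq_norm, Complex.normSq_apply, re_smul, im_smul,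
    norm_sub_sq_real, norm_add_sq_real]
  simp only [norm_smul, mul_pow, inner_smul_left, inner_smul_right, Real.norm_eq_abs, sq_abs,
    conj_trivial, real_inner_comm z.re z.im]
  ring

instance : NormedSpace ℂ (Complexification H) where
  norm_smul_le := norm_smul_le'

instance : InnerProductSpace ℂ (Complexification H) where
  norm_sq_eq_re_inner z := by
    simp [inner_def, norm_sq]
  conj_inner_symm z w := by
    apply Complex.ext
    · simp [inner_def, real_inner_comm]
    · simp [inner_def, real_inner_comm]
  add_left z w v := by
    apply Complex.ext
    · simp [inner_def, inner_add_left]; ring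
    · simp [inner_def, inner_add_left]; ring
  smul_left z w c := by
    apply Complex.ext
    · simp [inner_def, inner_add_left, inner_sub_left, inner_smul_left]; ring
    · simp [inner_def, inner_add_left, inner_sub_left, inner_smul_left]; ring

/-- The inclusion `H → H ⊕ iH`. -/
def ofReal (h : H) : Complexification H := mk h 0

theorem inner_ofReal (h k : H) : inner ℂ (ofReal h) (ofReal k) = ((inner ℝ h k : ℝ) : ℂ) := by
  apply Complex.ext <;> simp [inner_def, ofReal]

end Complexification

end Complexification

/-! ### The map `I(G)h = ⟨G, h⟩` -/

section Pairing

variable {d : ℕ} (φ : 𝓢(EuclideanSpace ℝ (Fin d), ℂ)) (σ p : ℝ) {q : ℝ} (hq : 0 < q)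

/-- `I(G)h = ⟨G, h⟩` for a complex Hilbert space `H`; `I(G)` is conjugate-linear. -/
def besovPairing (H : Type*) [NormedAddCommGroup H] [InnerProductSpace ℂ H] [CompleteSpace H] :
    besovSpace H φ σ p hq →ₗ[ℂ] (H →ₛₗ[starRingEnd ℂ] besovSpace ℂ φ σ p hq) where
  toFun G :=
    { toFun := fun h => ⟨pair h G.1, pair_mem_besovSpace φ σ p hq h G.2⟩
      map_add' := fun a b => by
        apply Subtype.ext; ext ψ; exact inner_add_left _ _ _
      map_smul' := fun c a => by
        apply Subtype.ext; ext ψ; exact inner_smul_left _ _ _ }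
  map_add' A B := by
    ext h : 1; apply Subtype.ext; ext ψ; exact inner_add_right _ _ _
  map_smul' c A := by
    ext h : 1; apply Subtype.ext; ext ψ; exact inner_smul_right _ _ _

/-- `I(G)h = ⟨G, h⟩` for a real Hilbert space `H`. As the Besov spaces consist of complex valued
distributions, `G` takes values in the complexification of `H`. -/
def besovPairingReal (H : Type*) [NormedAddCommGroup H] [InnerProductSpace ℝ H]
    [CompleteSpace H] :
    besovSpace (Complexification H) φ σ p hq →ₗ[ℂ] (H →ₗ[ℝ] besovSpace ℂ φ σ p hq) where
  toFun G :=
    { toFun := fun h => ⟨pair (Complexification.ofReal h) G.1,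
        pair_mem_besovSpace φ σ p hq (Complexification.ofReal h) G.2⟩
      map_add' := fun a b => by
        apply Subtype.ext; ext ψ
        apply Complex.ext <;>
          simp [pair_apply, Complexification.inner_def, Complexification.ofReal, inner_add_left]
      map_smul' := fun c a => by
        apply Subtype.ext; ext ψ
        apply Complex.ext <;>
          simp [pair_apply, Complexification.inner_def, Complexification.ofReal,
            inner_smul_left] }
  map_add' A B := by
    ext h : 1; apply Subtype.ext; ext ψ
    exact inner_add_right (𝕜 := ℂ) (Complexification.ofReal h) (A.1 ψ) (B.1 ψ)
  map_smul' c A := by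
    ext h : 1; apply Subtype.ext; ext ψ
    exact inner_smul_right (𝕜 := ℂ) (Complexification.ofReal h) (A.1 ψ) c

end Pairing

end BesovGamma

end

/-! The `γ`-norm is the norm of a Gaussian sum in `L²(Ω; ℓ^q(L^p))`, and the Besov norm of `G` is
the `ℓ^q(L^p)`-norm of the pointwise length `‖g k x‖` of the functions `g k` representing its
blocks. For fixed `k` and `x` and an orthonormal system `e`, the sum `∑ γᵢ ⟨g k x, eᵢ⟩` is a scalar
Gaussian sum. All its `L^r`-norms, `0 < r < ∞`, are comparable to the `ℓ²`-norm of the coefficients,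
with constants depending on `r` only; that `ℓ²`-norm is at most `‖g k x‖` by Bessel and exhausts it
along an orthonormal basis by Parseval.

The expectation has to be exchanged with the `ℓ^q(L^p)`-norm, and Minkowski's inequality does this
without the Kahane-Khintchine inequality. For the upper bound the second moment is raised to the
exponent `r = max 2 (max p q)`, after which `L^r(Ω)` may be moved inside; for the lower bound it is
lowered to `s = min 2 (min p q)`, and `L^s(Ω)` is moved inside. Hence the constants depend on `p`
and `q` only. The scalar facts are `exists_gaussian_sum_le` and `exists_le_gaussian_sum`; the
exchange is `gaussian_mixedNorm_le` and `mixedNorm_le_gaussian`.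

The range of `I` lies in the closure of the finite rank operators because basis expansions of `G`
converge in the Besov norm, by dominated convergence. Conversely, finite rank operators are images
of finite sums of tensors, so an operator in the closure is approximated by images of a sequence
that is Cauchy by the lower bound, and completeness of the Besov space
(`IsGenerator.exists_tendsto_of_cauchy`) provides a preimage.

Completeness rests on the embedding into tempered distributions
(`IsGenerator.exists_enorm_apply_le`). Nikolskii's inequality bounds the supremum of the `k`-th
block by its `L^p`-norm up to a factor exponential in `k`, including `p < 1`. The `k`-th block only
sees the high frequencies of a test function, which decay faster than any such exponential. The same
embedding shows that an operator of `γ`-norm zero vanishes.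

The real and the complex case run in parallel through `IsPairing`: an orthonormal basis of a real
`H` is also one of its complexification. -/

namespace BesovGamma

/-! ### Mixed norms of nonnegative functions -/

section MixedNorm

variable {α β : Type*} [MeasurableSpace α] [MeasurableSpace β] {μ : Measure α} {ν : Measure β}

/-- The `L^r`-quasi-norm of a nonnegative function. -/
noncomputable def lpnn (r : ℝ) (μ : Measure α) (f : α → ℝ≥0∞) : ℝ≥0∞ :=
  (∫⁻ x, f x ^ r ∂μ) ^ (1 / r)

theorem lpnn_mono {r : ℝ} (hr : 0 < r) {f g : α → ℝ≥0∞} (h : ∀ᵐ x ∂μ, f x ≤ g x) :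
    lpnn r μ f ≤ lpnn r μ g := by
  unfold lpnn
  refine ENNReal.rpow_le_rpow (lintegral_mono_ae ?_) (by positivity)
  filter_upwards [h] with x hx
  exact ENNReal.rpow_le_rpow hx hr.le

theorem lpnn_const_mul {r : ℝ} (hr : 0 < r) (c : ℝ≥0∞) {f : α → ℝ≥0∞} (hf : Measurable f) :
    lpnn r μ (fun x => c * f x) = c * lpnn r μ f := by
  unfold lpnn
  simp_rw [ENNReal.mul_rpow_of_nonneg _ _ hr.le]
  rw [lintegral_const_mul _ (hf.pow_const r), ENNReal.mul_rpow_of_nonneg _ _ (by positivity),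
    ← ENNReal.rpow_mul, mul_one_div_cancel hr.ne', ENNReal.rpow_one]

theorem lpnn_rpow {r : ℝ} (hr : 0 < r) (f : α → ℝ≥0∞) :
    lpnn r μ f ^ r = ∫⁻ x, f x ^ r ∂μ := by
  rw [lpnn, ← ENNReal.rpow_mul, one_div_mul_cancel hr.ne', ENNReal.rpow_one]

theorem measurable_lpnn_right [SFinite ν] (r : ℝ) {f : α → β → ℝ≥0∞}
    (hf : Measurable (Function.uncurry f)) : Measurable fun x => lpnn r ν (f x) :=
  ((hf.pow_const r).lintegral_prod_right).pow_const _

theorem lpnn_mono_exponent [IsProbabilityMeasure μ] {r s : ℝ} (hr : 0 < r) (hrs : r ≤ s)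
    {f : α → ℝ≥0∞} (hf : Measurable f) : lpnn r μ f ≤ lpnn s μ f := by
  have := eLpNorm'_le_eLpNorm'_of_exponent_le hr hrs μ hf.aestronglyMeasurable
  simpa [eLpNorm', lpnn] using this

/-- Minkowski's integral inequality. -/
theorem lintegral_rpow_lintegral_le [SFinite μ] [SigmaFinite ν] {r : ℝ} (hr : 1 ≤ r)
    {f : α → β → ℝ≥0∞} (hf : Measurable (Function.uncurry f)) :
    (∫⁻ y, (∫⁻ x, f x y ∂μ) ^ r ∂ν) ^ (1 / r) ≤ ∫⁻ x, (∫⁻ y, f x y ^ r ∂ν) ^ (1 / r) ∂μ := by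
  have hr0 : 0 < r := by linarith
  rcases eq_or_lt_of_le hr with rfl | hr1
  · simp only [ENNReal.rpow_one, div_one]
    exact (lintegral_lintegral_swap hf.aemeasurable).ge
  have hc : r.HolderConjugate (r / (r - 1)) := Real.HolderConjugate.conjExponent hr1
  set A := ∫⁻ x, (∫⁻ y, f x y ^ r ∂ν) ^ (1 / r) ∂μ with hA
  set Φ : β → ℝ≥0∞ := fun y => ∫⁻ x, f x y ∂μ with hΦ
  have hΦm : Measurable Φ := hf.lintegral_prod_left'
  -- Truncation in height and to sets of finite measure makes `∫ g n ^ r` finite, so that the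
  -- inequality `h1` can be divided by a power of it.
  let g : ℕ → β → ℝ≥0∞ := fun n => (spanningSets ν n).indicator fun y => min (Φ y) n
  have hgm : ∀ n, Measurable (g n) := fun n =>
    (hΦm.min measurable_const).indicator (measurableSet_spanningSets ν n)
  have hgΦ : ∀ n y, g n y ≤ Φ y := fun n y =>
    Set.indicator_apply_le' (fun _ => min_le_left _ _) fun _ => zero_le
  have hgmono : Monotone g := by
    intro m n hmn y
    refine Set.indicator_apply_le' (fun h => ?_) fun _ => zero_le
    rw [show g n y = min (Φ y) n from
      Set.indicator_of_mem (monotone_spanningSets ν hmn h) _]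
    gcongr
  have key : ∀ n, ∫⁻ y, g n y ^ r ∂ν ≤ A ^ r := by
    intro n
    set J := ∫⁻ y, g n y ^ r ∂ν with hJ
    have hJtop : J ≠ ⊤ := by
      refine ne_of_lt (lt_of_le_of_lt (b := ∫⁻ y, (spanningSets ν n).indicator
        (fun _ => (n : ℝ≥0∞) ^ r) y ∂ν) (lintegral_mono fun y => ?_) ?_)
      · by_cases h : y ∈ spanningSets ν n
        · simp only [g, Set.indicator_of_mem h]
          exact ENNReal.rpow_le_rpow (min_le_right _ _) hr0.le
        · simp [g, Set.indicator_of_notMem h, hr0]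
      · rw [lintegral_indicator_const (measurableSet_spanningSets ν n)]
        exact ENNReal.mul_lt_top (ENNReal.rpow_lt_top_of_nonneg hr0.le (by simp))
          (measure_spanningSets_lt_top ν n)
    -- Duality: replace one factor `g` of `g ^ r` by `Φ`, exchange the integrals, and apply Hölder
    -- in `y` for fixed `x`. The conjugate exponent `r / (r - 1)` turns `g ^ (r - 1)` back into `g ^
    -- r`.
    have h1 : J ≤ A * J ^ (1 / (r / (r - 1))) := by
      calc J ≤ ∫⁻ y, Φ y * g n y ^ (r - 1) ∂ν := by
            refine lintegral_mono fun y => ?_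
            calc g n y ^ r = g n y ^ (1 + (r - 1)) := by ring_nf
              _ = g n y * g n y ^ (r - 1) := by
                rw [ENNReal.rpow_add_of_nonneg _ _ zero_le_one (by linarith), ENNReal.rpow_one]
              _ ≤ _ := by gcongr; exact hgΦ n y
        _ = ∫⁻ y, ∫⁻ x, f x y * g n y ^ (r - 1) ∂μ ∂ν := by
            refine lintegral_congr fun y => ?_
            exact (lintegral_mul_const _ (hf.comp measurable_prodMk_right)).symm
        _ = ∫⁻ x, ∫⁻ y, f x y * g n y ^ (r - 1) ∂ν ∂μ := by
            refine (lintegral_lintegral_swap (Measurable.aemeasurable ?_)).symm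
            exact hf.mul (((hgm n).comp measurable_snd).pow_const _)
        _ ≤ ∫⁻ x, (∫⁻ y, f x y ^ r ∂ν) ^ (1 / r) * J ^ (1 / (r / (r - 1))) ∂μ := by
            refine lintegral_mono fun x => ?_
            refine (ENNReal.lintegral_mul_le_Lp_mul_Lq ν hc
              (hf.comp measurable_prodMk_left).aemeasurable
              ((hgm n).pow_const _).aemeasurable).trans (le_of_eq ?_)
            simp_rw [← ENNReal.rpow_mul, mul_div_cancel₀ r (by linarith : r - 1 ≠ 0)]
            rfl
        _ = A * J ^ (1 / (r / (r - 1))) := by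
            exact lintegral_mul_const _ (measurable_lpnn_right (ν := ν) r hf)
    rcases eq_or_ne J 0 with h0 | h0
    · rw [h0]; exact zero_le
    have h2 : J ^ (1 / r) ≤ A := by
      have h3 : J = J ^ (1 / r) * J ^ (1 / (r / (r - 1))) := by
        rw [← ENNReal.rpow_add _ _ h0 hJtop]
        have : 1 / r + 1 / (r / (r - 1)) = 1 := by field_simp; ring
        rw [this, ENNReal.rpow_one]
      have h4 : J ^ (1 / (r / (r - 1))) ≠ 0 := by
        simp [ENNReal.rpow_eq_zero_iff, h0, hJtop]
      have h5 : J ^ (1 / (r / (r - 1))) ≠ ⊤ := by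
        simp [ENNReal.rpow_eq_top_iff, h0, hJtop]
      rw [h3] at h1
      exact (ENNReal.mul_le_mul_iff_left h4 h5).1 (by rwa [← h3] at h1 ⊢)
    calc J = (J ^ (1 / r)) ^ r := by
          rw [← ENNReal.rpow_mul, one_div_mul_cancel hr0.ne', ENNReal.rpow_one]
      _ ≤ A ^ r := ENNReal.rpow_le_rpow h2 hr0.le
  -- The truncations exhaust `Φ`. Testing with arbitrary `c < Φ y ^ r` also covers the points where
  -- `Φ y = ∞`.
  have hsup : ∀ y, Φ y ^ r ≤ ⨆ n, g n y ^ r := by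
    intro y
    refine le_of_forall_lt fun c hc => ?_
    have hc' : c ^ (1 / r) < Φ y := by
      have := ENNReal.rpow_lt_rpow hc (by positivity : 0 < 1 / r)
      rwa [← ENNReal.rpow_mul, mul_one_div_cancel hr0.ne', ENNReal.rpow_one] at this
    obtain ⟨m, hm⟩ := ENNReal.exists_nat_gt (ne_top_of_lt hc')
    obtain ⟨k, hk⟩ : ∃ k, y ∈ spanningSets ν k := ⟨_, mem_spanningSetsIndex ν y⟩
    refine lt_of_lt_of_le ?_ (le_iSup _ (max m k))
    have hy : y ∈ spanningSets ν (max m k) := monotone_spanningSets ν (le_max_right m k) hk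
    rw [show g (max m k) y = min (Φ y) ((max m k : ℕ) : ℝ≥0∞) from Set.indicator_of_mem hy _]
    have : c ^ (1 / r) < min (Φ y) ((max m k : ℕ) : ℝ≥0∞) :=
      lt_min hc' (hm.trans_le (by exact_mod_cast le_max_left m k))
    have := ENNReal.rpow_lt_rpow this hr0
    rwa [← ENNReal.rpow_mul, one_div_mul_cancel hr0.ne', ENNReal.rpow_one] at this
  have hfin : ∫⁻ y, Φ y ^ r ∂ν ≤ A ^ r := by
    refine (lintegral_mono hsup).trans ?_
    rw [lintegral_iSup (fun n => (hgm n).pow_const r)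
      (fun m n h y => ENNReal.rpow_le_rpow (hgmono h y) hr0.le)]
    exact iSup_le key
  calc (∫⁻ y, Φ y ^ r ∂ν) ^ (1 / r) ≤ (A ^ r) ^ (1 / r) :=
        ENNReal.rpow_le_rpow hfin (by positivity)
    _ = A := by rw [← ENNReal.rpow_mul, mul_one_div_cancel hr0.ne', ENNReal.rpow_one]

/-- Minkowski's inequality for mixed norms. -/
theorem lpnn_lpnn_le [SFinite μ] [SigmaFinite ν] {s r : ℝ} (hs : 0 < s) (hsr : s ≤ r)
    {f : α → β → ℝ≥0∞} (hf : Measurable (Function.uncurry f)) :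
    lpnn r ν (fun y => lpnn s μ fun x => f x y) ≤ lpnn s μ (fun x => lpnn r ν (f x)) := by
  have hr : 0 < r := hs.trans_le hsr
  have h := lintegral_rpow_lintegral_le (μ := μ) (ν := ν) (r := r / s)
    ((one_le_div hs).2 hsr) (f := fun x y => f x y ^ s) (hf.pow_const s)
  have h' := ENNReal.rpow_le_rpow h (by positivity : 0 ≤ 1 / s)
  simp_rw [← ENNReal.rpow_mul, mul_div_cancel₀ r hs.ne'] at h'
  unfold lpnn
  simp_rw [← ENNReal.rpow_mul]
  have e1 : 1 / (r / s) * (1 / s) = 1 / r := by field_simp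
  have e2 : 1 / s * r = r / s := by ring
  have e3 : 1 / r * s = 1 / (r / s) := by field_simp
  rw [e1] at h'
  rw [e2, e3]
  exact h'

/-- Fatou's lemma; positive powers are order isomorphisms of `[0, ∞]` and so commute with the limes
inferior. No restriction `r ≥ 1` is needed. -/
theorem lpnn_le_liminf {r : ℝ} (hr : 0 < r) {f : ℕ → α → ℝ≥0∞} (hf : ∀ n, Measurable (f n)) :
    lpnn r μ (fun x => Filter.liminf (fun n => f n x) Filter.atTop) ≤
      Filter.liminf (fun n => lpnn r μ (f n)) Filter.atTop := by
  have hlim : ∀ {u : ℕ → ℝ≥0∞} {t : ℝ}, 0 < t → Filter.liminf u Filter.atTop ^ t =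
      Filter.liminf (fun n => u n ^ t) Filter.atTop := fun {u t} ht =>
    (ENNReal.orderIsoRpow t ht).liminf_apply
  unfold lpnn
  rw [← hlim (by positivity)]
  refine ENNReal.rpow_le_rpow ?_ (by positivity)
  simp_rw [hlim hr]
  exact lintegral_liminf_le fun n => (hf n).pow_const r

theorem tendsto_lpnn_zero {r : ℝ} (hr : 0 < r) {f : ℕ → α → ℝ≥0∞} {b : α → ℝ≥0∞}
    (hf : ∀ n, Measurable (f n)) (hfb : ∀ n, ∀ᵐ x ∂μ, f n x ≤ b x) (hb : lpnn r μ b ≠ ⊤)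
    (hlim : ∀ᵐ x ∂μ, Filter.Tendsto (fun n => f n x) Filter.atTop (nhds 0)) :
    Filter.Tendsto (fun n => lpnn r μ (f n)) Filter.atTop (nhds 0) := by
  have h := tendsto_lintegral_of_dominated_convergence (μ := μ) (F := fun n x => f n x ^ r)
    (f := fun _ => 0) (fun x => b x ^ r) (fun n => (hf n).pow_const r)
    (fun n => by filter_upwards [hfb n] with x hx using ENNReal.rpow_le_rpow hx hr.le)
    (by rw [← lpnn_rpow hr]; exact (ENNReal.rpow_lt_top_of_nonneg hr.le hb).ne)
    (by
      filter_upwards [hlim] with x hx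
      have := ((ENNReal.continuous_rpow_const (y := r)).tendsto 0).comp hx
      simpa [hr, Function.comp_def] using this)
  have := ((ENNReal.continuous_rpow_const (y := 1 / r)).tendsto _).comp h
  simpa [hr, Function.comp_def, lpnn] using this

end MixedNorm

/-- A crude quasi-triangle inequality valid for all `r > 0`. One factor 2 comes from `a + b ≤ 2 max
a b`, the factor `2 ^ (1 / r)` from bounding each of the two `r`-th powers by that of the sum of the
norms. -/
theorem lpnn_add_le {α : Type*} [MeasurableSpace α] {μ : Measure α} {r : ℝ} (hr : 0 < r)
    {f g : α → ℝ≥0∞} (hf : Measurable f) :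
    lpnn r μ (fun x => f x + g x) ≤ 2 ^ (1 + 1 / r) * (lpnn r μ f + lpnn r μ g) := by
  have hpt : ∀ a b : ℝ≥0∞, (a + b) ^ r ≤ 2 ^ r * (a ^ r + b ^ r) := by
    intro a b
    calc (a + b) ^ r ≤ (2 * max a b) ^ r := by
          refine ENNReal.rpow_le_rpow ?_ hr.le
          rw [two_mul]
          exact add_le_add (le_max_left _ _) (le_max_right _ _)
      _ = 2 ^ r * max a b ^ r := ENNReal.mul_rpow_of_nonneg _ _ hr.le
      _ ≤ 2 ^ r * (a ^ r + b ^ r) := by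
          gcongr
          rcases le_total a b with h | h
          · rw [max_eq_right h]; exact le_add_self
          · rw [max_eq_left h]; exact le_self_add
  set F := lpnn r μ f
  set G := lpnn r μ g
  have h1 : ∫⁻ x, (f x + g x) ^ r ∂μ ≤ 2 ^ r * (2 * (F + G) ^ r) := by
    calc ∫⁻ x, (f x + g x) ^ r ∂μ ≤ ∫⁻ x, 2 ^ r * (f x ^ r + g x ^ r) ∂μ :=
          lintegral_mono fun x => hpt _ _
      _ = 2 ^ r * (F ^ r + G ^ r) := by
          rw [lintegral_const_mul' _ _ (ENNReal.rpow_ne_top_of_nonneg hr.le (by simp)),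
            lintegral_add_left (hf.pow_const r), lpnn_rpow hr, lpnn_rpow hr]
      _ ≤ 2 ^ r * ((F + G) ^ r + (F + G) ^ r) := by
          gcongr
          · exact le_self_add
          · exact le_add_self
      _ = _ := by rw [two_mul]
  calc lpnn r μ (fun x => f x + g x) ≤ (2 ^ r * (2 * (F + G) ^ r)) ^ (1 / r) :=
        ENNReal.rpow_le_rpow h1 (by positivity)
    _ = _ := by
        rw [ENNReal.mul_rpow_of_nonneg _ _ (by positivity),
          ENNReal.mul_rpow_of_nonneg _ _ (by positivity), ← ENNReal.rpow_mul,
          ← ENNReal.rpow_mul, mul_one_div_cancel hr.ne', ENNReal.rpow_one, ENNReal.rpow_one,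
          ENNReal.rpow_add _ _ (by simp) (by simp), ENNReal.rpow_one, mul_assoc]

/-! ### Gaussian sums -/

section Gaussian

/-- The standard Gaussian measure on `ℝ^n`. -/
noncomputable abbrev gaussianPi (n : ℕ) : Measure (Fin n → ℝ) :=
  Measure.pi fun _ => gaussianReal 0 1

/-- A linear functional of a standard Gaussian vector is a centred Gaussian whose variance is the
squared Euclidean norm of its coefficients; every moment of the sum is thereby reduced to a
one-dimensional one. -/
theorem map_gaussianPi_sum {n : ℕ} (a : Fin n → ℝ) :
    (gaussianPi n).map (fun ω => ∑ i, ω i * a i) =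
      (gaussianReal 0 1).map (fun x => ‖WithLp.toLp 2 a‖ * x) := by
  let v : EuclideanSpace ℝ (Fin n) := WithLp.toLp 2 a
  have h := (isGaussian_stdGaussian (E := EuclideanSpace ℝ (Fin n))).map_eq_gaussianReal
    (innerSL ℝ v)
  rw [integral_strongDual_stdGaussian, variance_dual_stdGaussian, ← map_pi_eq_stdGaussian,
    Measure.map_map (by fun_prop) (by fun_prop)] at h
  rw [gaussianReal_map_const_mul]
  convert h using 2
  · ext ω
    simp [v, PiLp.inner_apply]
  · simp
  · apply NNReal.eq
    simp [v]

/-- The `L^r`-norm of a standard Gaussian random variable. -/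
noncomputable def gaussianMoment (r : ℝ) : ℝ≥0∞ := lpnn r (gaussianReal 0 1) fun x => ‖x‖ₑ

theorem gaussianMoment_ne_top {r : ℝ} (hr : 0 < r) : gaussianMoment r ≠ ⊤ := by
  have h := (memLp_id_gaussianReal (μ := 0) (v := 1) r.toNNReal).2
  rw [eLpNorm_eq_lintegral_rpow_enorm_toReal (by simpa using hr) (by simp)] at h
  simp only [ENNReal.coe_toReal, Real.coe_toNNReal r hr.le] at h
  exact h.ne

theorem gaussianMoment_ne_zero {r : ℝ} (hr : 0 < r) : gaussianMoment r ≠ 0 := by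
  unfold gaussianMoment lpnn
  have : NullSingletonClass (gaussianReal 0 1) := nullSingletonClass_gaussianReal one_ne_zero
  intro h
  rw [ENNReal.rpow_eq_zero_iff_of_pos (by positivity), lintegral_eq_zero_iff (by fun_prop)] at h
  have h1 : ∀ᵐ x ∂(gaussianReal 0 1), x = 0 := by
    filter_upwards [h] with x hx
    simpa [hr, hr.le, ENNReal.rpow_eq_zero_iff] using hx
  have h2 : ∀ᵐ x ∂(gaussianReal 0 1), x ≠ 0 := by
    rw [ae_iff]
    simp
  have h3 : ∀ᵐ _x ∂(gaussianReal 0 1), False := by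
    filter_upwards [h1, h2] with x hx hx' using hx' hx
  have h4 : gaussianReal 0 1 = 0 := by simpa using h3
  exact IsProbabilityMeasure.ne_zero (gaussianReal 0 1) h4

theorem lpnn_real_gaussian_sum {r : ℝ} (hr : 0 < r) {n : ℕ} (a : Fin n → ℝ) :
    lpnn r (gaussianPi n) (fun ω => ‖∑ i, ω i * a i‖ₑ) =
      ‖WithLp.toLp 2 a‖ₑ * gaussianMoment r := by
  unfold gaussianMoment
  rw [← lpnn_const_mul hr _ (by fun_prop)]
  unfold lpnn
  congr 1
  have e1 : ∫⁻ ω, ‖∑ i, ω i * a i‖ₑ ^ r ∂(gaussianPi n) =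
      ∫⁻ x, ‖x‖ₑ ^ r ∂((gaussianPi n).map (fun ω => ∑ i, ω i * a i)) :=
    (lintegral_map (f := fun x : ℝ => ‖x‖ₑ ^ r) (by fun_prop) (by fun_prop)).symm
  rw [e1, map_gaussianPi_sum, lintegral_map (by fun_prop) (by fun_prop)]
  simp [enorm_mul]

variable {n : ℕ}

theorem enorm_toLp_re_le (c : Fin n → ℂ) :
    ‖WithLp.toLp 2 fun i => (c i).re‖ₑ ≤ ‖WithLp.toLp 2 c‖ₑ := by
  rw [enorm_le_iff_norm_le, EuclideanSpace.norm_eq, EuclideanSpace.norm_eq]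
  refine Real.sqrt_le_sqrt (Finset.sum_le_sum fun i _ => ?_)
  exact pow_le_pow_left₀ (norm_nonneg _) (Complex.abs_re_le_norm _) 2

theorem enorm_toLp_im_le (c : Fin n → ℂ) :
    ‖WithLp.toLp 2 fun i => (c i).im‖ₑ ≤ ‖WithLp.toLp 2 c‖ₑ := by
  rw [enorm_le_iff_norm_le, EuclideanSpace.norm_eq, EuclideanSpace.norm_eq]
  refine Real.sqrt_le_sqrt (Finset.sum_le_sum fun i _ => ?_)
  exact pow_le_pow_left₀ (norm_nonneg _) (Complex.abs_im_le_norm _) 2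

theorem enorm_toLp_le_re_add_im (c : Fin n → ℂ) :
    ‖WithLp.toLp 2 c‖ₑ ≤
      ‖WithLp.toLp 2 fun i => (c i).re‖ₑ + ‖WithLp.toLp 2 fun i => (c i).im‖ₑ := by
  have h : ‖WithLp.toLp 2 c‖ ≤
      ‖WithLp.toLp 2 fun i => (c i).re‖ + ‖WithLp.toLp 2 fun i => (c i).im‖ := by
    refine le_of_sq_le_sq ?_ (by positivity)
    have e : ‖WithLp.toLp 2 c‖ ^ 2 = ‖WithLp.toLp 2 fun i => (c i).re‖ ^ 2 +
        ‖WithLp.toLp 2 fun i => (c i).im‖ ^ 2 := by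
      simp only [EuclideanSpace.norm_sq_eq, ← Finset.sum_add_distrib]
      refine Finset.sum_congr rfl fun i _ => ?_
      rw [Complex.sq_norm, Complex.normSq_apply]
      simp [sq]
    rw [e]
    nlinarith [norm_nonneg (WithLp.toLp 2 fun i => (c i).re),
      norm_nonneg (WithLp.toLp 2 fun i => (c i).im)]
  rw [← ofReal_norm, ← ofReal_norm, ← ofReal_norm, ← ENNReal.ofReal_add (by positivity)
    (by positivity)]
  exact ENNReal.ofReal_le_ofReal h

theorem re_gaussian_sum (c : Fin n → ℂ) (ω : Fin n → ℝ) :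
    (∑ i, (ω i : ℂ) * c i).re = ∑ i, ω i * (c i).re := by
  simp

theorem im_gaussian_sum (c : Fin n → ℂ) (ω : Fin n → ℝ) :
    (∑ i, (ω i : ℂ) * c i).im = ∑ i, ω i * (c i).im := by
  simp

/-- Real and imaginary parts are real Gaussian sums, whose moments are known exactly. The constant
is independent of `n`, which is what allows the supremum over all finite systems. -/
theorem exists_gaussian_sum_le {r : ℝ} (hr : 0 < r) :
    ∃ C : ℝ≥0, ∀ (n : ℕ) (c : Fin n → ℂ),
      lpnn r (gaussianPi n) (fun ω => ‖∑ i, (ω i : ℂ) * c i‖ₑ) ≤ C * ‖WithLp.toLp 2 c‖ₑ := by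
  have hC : (2 : ℝ≥0∞) ^ (1 + 1 / r) * (gaussianMoment r + gaussianMoment r) ≠ ⊤ :=
    ENNReal.mul_ne_top (ENNReal.rpow_ne_top_of_nonneg (by positivity) (by simp))
      (ENNReal.add_ne_top.2 ⟨gaussianMoment_ne_top hr, gaussianMoment_ne_top hr⟩)
  refine ⟨(2 ^ (1 + 1 / r) * (gaussianMoment r + gaussianMoment r)).toNNReal, fun n c => ?_⟩
  rw [ENNReal.coe_toNNReal hC]
  calc lpnn r (gaussianPi n) (fun ω => ‖∑ i, (ω i : ℂ) * c i‖ₑ)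
      ≤ lpnn r (gaussianPi n) (fun ω => ‖∑ i, ω i * (c i).re‖ₑ + ‖∑ i, ω i * (c i).im‖ₑ) := by
        refine lpnn_mono hr (Filter.Eventually.of_forall fun ω => ?_)
        rw [← re_gaussian_sum, ← im_gaussian_sum]
        simp only [← ofReal_norm]
        rw [← ENNReal.ofReal_add (by positivity) (by positivity)]
        exact ENNReal.ofReal_le_ofReal (Complex.norm_le_abs_re_add_abs_im _)
    _ ≤ 2 ^ (1 + 1 / r) * (‖WithLp.toLp 2 fun i => (c i).re‖ₑ * gaussianMoment r +
          ‖WithLp.toLp 2 fun i => (c i).im‖ₑ * gaussianMoment r) := by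
        refine (lpnn_add_le hr (by fun_prop)).trans (le_of_eq ?_)
        rw [lpnn_real_gaussian_sum hr, lpnn_real_gaussian_sum hr]
    _ ≤ 2 ^ (1 + 1 / r) * (‖WithLp.toLp 2 c‖ₑ * gaussianMoment r +
          ‖WithLp.toLp 2 c‖ₑ * gaussianMoment r) := by
        gcongr
        · exact enorm_toLp_re_le c
        · exact enorm_toLp_im_le c
    _ = _ := by ring

/-- Real and imaginary parts of the sum are dominated by its modulus, and a Gaussian moment is
nonzero, so it can be divided out. -/
theorem exists_le_gaussian_sum {r : ℝ} (hr : 0 < r) :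
    ∃ C : ℝ≥0, ∀ (n : ℕ) (c : Fin n → ℂ),
      ‖WithLp.toLp 2 c‖ₑ ≤ C * lpnn r (gaussianPi n) (fun ω => ‖∑ i, (ω i : ℂ) * c i‖ₑ) := by
  have h0 := gaussianMoment_ne_zero hr
  have ht := gaussianMoment_ne_top hr
  have hC : 2 * (gaussianMoment r)⁻¹ ≠ ⊤ := ENNReal.mul_ne_top (by simp) (by simpa using h0)
  refine ⟨(2 * (gaussianMoment r)⁻¹).toNNReal, fun n c => ?_⟩
  rw [ENNReal.coe_toNNReal hC]
  set Y := lpnn r (gaussianPi n) (fun ω => ‖∑ i, (ω i : ℂ) * c i‖ₑ) with hY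
  have h1 : ‖WithLp.toLp 2 fun i => (c i).re‖ₑ ≤ (gaussianMoment r)⁻¹ * Y := by
    rw [mul_comm, ← div_eq_mul_inv, ENNReal.le_div_iff_mul_le (.inl h0) (.inl ht),
      ← lpnn_real_gaussian_sum hr]
    refine lpnn_mono hr (Filter.Eventually.of_forall fun ω => ?_)
    rw [← re_gaussian_sum, enorm_le_iff_norm_le]
    exact Complex.abs_re_le_norm _
  have h2 : ‖WithLp.toLp 2 fun i => (c i).im‖ₑ ≤ (gaussianMoment r)⁻¹ * Y := by
    rw [mul_comm, ← div_eq_mul_inv, ENNReal.le_div_iff_mul_le (.inl h0) (.inl ht),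
      ← lpnn_real_gaussian_sum hr]
    refine lpnn_mono hr (Filter.Eventually.of_forall fun ω => ?_)
    rw [← im_gaussian_sum, enorm_le_iff_norm_le]
    exact Complex.abs_im_le_norm _
  calc ‖WithLp.toLp 2 c‖ₑ ≤ _ := enorm_toLp_le_re_add_im c
    _ ≤ (gaussianMoment r)⁻¹ * Y + (gaussianMoment r)⁻¹ * Y := add_le_add h1 h2
    _ = _ := by ring

end Gaussian

/-! ### Square function estimate -/

section SquareFunction

variable {X : Type*} [MeasurableSpace X] {μ : Measure X}

/-- The weighted mixed `ℓ^q(L^p)`-quasi-norm of a sequence of nonnegative functions. -/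
noncomputable def mixedNorm (w : ℕ → ℝ≥0∞) (p q : ℝ) (μ : Measure X) (v : ℕ → X → ℝ≥0∞) :
    ℝ≥0∞ :=
  lpnn q Measure.count fun k => w k * lpnn p μ (v k)

theorem mixedNorm_mono (w : ℕ → ℝ≥0∞) {p q : ℝ} (hp : 0 < p) (hq : 0 < q)
    {u v : ℕ → X → ℝ≥0∞} (h : ∀ k, ∀ᵐ x ∂μ, u k x ≤ v k x) :
    mixedNorm w p q μ u ≤ mixedNorm w p q μ v :=
  lpnn_mono hq (Filter.Eventually.of_forall fun k => by gcongr; exact lpnn_mono hp (h k))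

theorem mixedNorm_const_mul (w : ℕ → ℝ≥0∞) {p q : ℝ} (hp : 0 < p) (hq : 0 < q) (c : ℝ≥0∞)
    {v : ℕ → X → ℝ≥0∞} (hv : ∀ k, Measurable (v k)) :
    mixedNorm w p q μ (fun k x => c * v k x) = c * mixedNorm w p q μ v := by
  unfold mixedNorm
  rw [← lpnn_const_mul hq _ (measurable_of_countable _)]
  congr 1; ext k
  rw [lpnn_const_mul hp _ (hv k)]
  ring

variable [SigmaFinite μ]

theorem measurable_mixedNorm {Ω : Type*} [MeasurableSpace Ω] (w : ℕ → ℝ≥0∞) (p q : ℝ)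
    {v : ℕ → Ω → X → ℝ≥0∞} (hv : ∀ k, Measurable (Function.uncurry (v k))) :
    Measurable fun ω => mixedNorm w p q μ fun k => v k ω := by
  unfold mixedNorm lpnn
  simp_rw [lintegral_count]
  refine Measurable.pow_const (Measurable.tsum fun k => ?_) _
  exact ((measurable_lpnn_right p (hv k)).const_mul _).pow_const _

/-- Minkowski's inequality twice, first against the sum over `k` and then against the integral over
`X`: moving the larger exponent `r` inside can only increase the norm. -/
theorem lpnn_mixedNorm_le {Ω : Type*} [MeasurableSpace Ω] {P : Measure Ω} [SigmaFinite P]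
    (w : ℕ → ℝ≥0∞) {p q r : ℝ} (hp : 0 < p) (hq : 0 < q) (hpr : p ≤ r) (hqr : q ≤ r)
    {v : ℕ → X → Ω → ℝ≥0∞} (hv : ∀ k, Measurable (Function.uncurry (v k))) :
    lpnn r P (fun ω => mixedNorm w p q μ fun k x => v k x ω) ≤
      mixedNorm w p q μ fun k x => lpnn r P (v k x) := by
  have hr := hp.trans_le hpr
  have hm : ∀ k, Measurable fun ω => lpnn p μ fun x => v k x ω := fun k =>
    measurable_lpnn_right (ν := μ) p (f := fun ω x => v k x ω) ((hv k).comp measurable_swap)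
  refine (lpnn_lpnn_le (μ := Measure.count) (ν := P) hq hqr
    (f := fun k ω => w k * lpnn p μ fun x => v k x ω) ?_).trans ?_
  · exact measurable_from_prod_countable_right fun k => (hm k).const_mul (w k)
  · refine lpnn_mono hq (Filter.Eventually.of_forall fun k => ?_)
    dsimp only
    rw [lpnn_const_mul hr _ (hm k)]
    gcongr
    exact lpnn_lpnn_le hp hpr (hv k)

/-- The mirror image of `lpnn_mixedNorm_le`: here the exponent on `Ω` is the smallest one, so moving
it outside increases the norm. -/
theorem mixedNorm_lpnn_le {Ω : Type*} [MeasurableSpace Ω] {P : Measure Ω} [SigmaFinite P]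
    (w : ℕ → ℝ≥0∞) {p q s : ℝ} (hs : 0 < s) (hsp : s ≤ p) (hsq : s ≤ q)
    {v : ℕ → X → Ω → ℝ≥0∞} (hv : ∀ k, Measurable (Function.uncurry (v k))) :
    (mixedNorm w p q μ fun k x => lpnn s P (v k x)) ≤
      lpnn s P (fun ω => mixedNorm w p q μ fun k x => v k x ω) := by
  have hp := hs.trans_le hsp
  have hq := hs.trans_le hsq
  have hm : ∀ k, Measurable fun ω => lpnn p μ fun x => v k x ω := fun k =>
    measurable_lpnn_right (ν := μ) p (f := fun ω x => v k x ω) ((hv k).comp measurable_swap)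
  refine le_trans ?_ (lpnn_lpnn_le (μ := P) (ν := Measure.count) hs hsq
    (f := fun ω k => w k * lpnn p μ fun x => v k x ω) ?_)
  · refine lpnn_mono hq (Filter.Eventually.of_forall fun k => ?_)
    dsimp only
    rw [lpnn_const_mul hs _ (hm k)]
    gcongr
    exact lpnn_lpnn_le (ν := μ) hs hsp (f := fun ω x => v k x ω) ((hv k).comp measurable_swap)
  · exact measurable_from_prod_countable_left fun k => (hm k).const_mul (w k)

theorem measurable_gaussian_sum {n : ℕ} {g : Fin n → X → ℂ} (hg : ∀ i, Measurable (g i)) :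
    Measurable (Function.uncurry fun (x : X) (ω : Fin n → ℝ) =>
      ‖∑ i, (ω i : ℂ) * g i x‖ₑ) := by
  unfold Function.uncurry
  refine Measurable.enorm (Finset.measurable_fun_sum _ fun i _ => ?_)
  exact (by fun_prop : Measurable fun a : X × (Fin n → ℝ) => ((a.2 i : ℝ) : ℂ)).mul
    ((hg i).comp measurable_fst)

theorem measurable_gaussian_mixedNorm (w : ℕ → ℝ≥0∞) (p q : ℝ) {n : ℕ} {g : Fin n → ℕ → X → ℂ}
    (hg : ∀ i k, Measurable (g i k)) :
    Measurable fun ω : Fin n → ℝ =>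
      mixedNorm w p q μ fun k x => ‖∑ i, (ω i : ℂ) * g i k x‖ₑ := by
  refine measurable_mixedNorm (v := fun k (ω : Fin n → ℝ) x => ‖∑ i, (ω i : ℂ) * g i k x‖ₑ)
    w p q fun k => ?_
  unfold Function.uncurry
  refine Measurable.enorm (Finset.measurable_fun_sum _ fun i _ => ?_)
  exact (by fun_prop : Measurable fun a : (Fin n → ℝ) × X => ((a.1 i : ℝ) : ℂ)).mul
    ((hg i k).comp measurable_snd)

theorem measurable_enorm_toLp {n : ℕ} {g : Fin n → X → ℂ} (hg : ∀ i, Measurable (g i)) :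
    Measurable fun x => ‖WithLp.toLp 2 fun i => g i x‖ₑ := by
  have : Measurable fun x => (fun i => g i x) := measurable_pi_lambda _ hg
  exact ((WithLp.measurable_toLp 2 (Fin n → ℂ)).comp this).enorm

/-- The second moment of the `ℓ^q(L^p)`-norm of a Gaussian sum is at most a multiple of the norm
of the square function. -/
theorem gaussian_mixedNorm_le {p q r : ℝ} (hp : 0 < p) (hq : 0 < q) (hpr : p ≤ r) (hqr : q ≤ r)
    (h2r : 2 ≤ r) {C : ℝ≥0∞}
    (hC : ∀ (n : ℕ) (c : Fin n → ℂ),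
      lpnn r (gaussianPi n) (fun ω => ‖∑ i, (ω i : ℂ) * c i‖ₑ) ≤ C * ‖WithLp.toLp 2 c‖ₑ)
    (w : ℕ → ℝ≥0∞) {n : ℕ} {g : Fin n → ℕ → X → ℂ} (hg : ∀ i k, Measurable (g i k)) :
    lpnn 2 (gaussianPi n)
        (fun ω => mixedNorm w p q μ fun k x => ‖∑ i, (ω i : ℂ) * g i k x‖ₑ) ≤
      C * mixedNorm w p q μ fun k x => ‖WithLp.toLp 2 fun i => g i k x‖ₑ := by
  have hv := fun k => measurable_gaussian_sum (fun i => hg i k)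
  calc _ ≤ lpnn r (gaussianPi n)
        (fun ω => mixedNorm w p q μ fun k x => ‖∑ i, (ω i : ℂ) * g i k x‖ₑ) :=
        lpnn_mono_exponent two_pos h2r (measurable_gaussian_mixedNorm w p q hg)
    _ ≤ mixedNorm w p q μ fun k x => lpnn r (gaussianPi n)
          (fun ω => ‖∑ i, (ω i : ℂ) * g i k x‖ₑ) := lpnn_mixedNorm_le w hp hq hpr hqr hv
    _ ≤ mixedNorm w p q μ fun k x => C * ‖WithLp.toLp 2 fun i => g i k x‖ₑ :=
        mixedNorm_mono w hp hq fun k => Filter.Eventually.of_forall fun x => hC n _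
    _ = _ := mixedNorm_const_mul w hp hq _ fun k => measurable_enorm_toLp fun i => hg i k

/-- The norm of the square function is at most a multiple of the second moment of the
`ℓ^q(L^p)`-norm of the Gaussian sum. -/
theorem mixedNorm_le_gaussian {p q s : ℝ} (hs : 0 < s) (hsp : s ≤ p) (hsq : s ≤ q)
    (hs2 : s ≤ 2) {C : ℝ≥0∞}
    (hC : ∀ (n : ℕ) (c : Fin n → ℂ),
      ‖WithLp.toLp 2 c‖ₑ ≤ C * lpnn s (gaussianPi n) (fun ω => ‖∑ i, (ω i : ℂ) * c i‖ₑ))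
    (w : ℕ → ℝ≥0∞) {n : ℕ} {g : Fin n → ℕ → X → ℂ} (hg : ∀ i k, Measurable (g i k)) :
    (mixedNorm w p q μ fun k x => ‖WithLp.toLp 2 fun i => g i k x‖ₑ) ≤
      C * lpnn 2 (gaussianPi n)
        (fun ω => mixedNorm w p q μ fun k x => ‖∑ i, (ω i : ℂ) * g i k x‖ₑ) := by
  have hv := fun k => measurable_gaussian_sum (fun i => hg i k)
  have hp := hs.trans_le hsp
  have hq := hs.trans_le hsq
  calc (mixedNorm w p q μ fun k x => ‖WithLp.toLp 2 fun i => g i k x‖ₑ)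
      ≤ mixedNorm w p q μ fun k x => C * lpnn s (gaussianPi n)
          (fun ω => ‖∑ i, (ω i : ℂ) * g i k x‖ₑ) :=
        mixedNorm_mono w hp hq fun k => Filter.Eventually.of_forall fun x => hC n _
    _ = C * mixedNorm w p q μ fun k x => lpnn s (gaussianPi n)
          (fun ω => ‖∑ i, (ω i : ℂ) * g i k x‖ₑ) :=
        mixedNorm_const_mul w hp hq _ fun k => measurable_lpnn_right s (hv k)
    _ ≤ C * lpnn s (gaussianPi n)
          (fun ω => mixedNorm w p q μ fun k x => ‖∑ i, (ω i : ℂ) * g i k x‖ₑ) := by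
        gcongr
        exact mixedNorm_lpnn_le w hs hsp hsq hv
    _ ≤ _ := by
        gcongr
        exact lpnn_mono_exponent hs hs2 (measurable_gaussian_mixedNorm w p q hg)

end SquareFunction

/-! ### Representing functions -/

section Representation

variable {d : ℕ} {F : Type*} [NormedAddCommGroup F] [NormedSpace ℂ F]
  {u v : 𝓢'(EuclideanSpace ℝ (Fin d), F)} {g h : EuclideanSpace ℝ (Fin d) → F}

theorem IsRepresentedBy.congr (hu : IsRepresentedBy u g) (hgh : g =ᵐ[volume] h) :
    IsRepresentedBy u h := by
  refine ⟨hu.1.congr hgh, fun ψ => ?_⟩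
  have e : (fun x => ψ x • g x) =ᵐ[volume] fun x => ψ x • h x := by
    filter_upwards [hgh] with x hx
    rw [hx]
  exact ⟨(hu.2 ψ).1.congr e, by rw [(hu.2 ψ).2, integral_congr_ae e]⟩

theorem IsRepresentedBy.neg (hu : IsRepresentedBy u g) : IsRepresentedBy (-u) (-g) := by
  simpa using hu.smul (-1)

theorem IsRepresentedBy.sub (hu : IsRepresentedBy u g) (hv : IsRepresentedBy v h) :
    IsRepresentedBy (u - v) (g - h) := by
  rw [sub_eq_add_neg, sub_eq_add_neg]
  exact hu.add hv.neg

theorem isRepresentedBy_zero : IsRepresentedBy (0 : 𝓢'(EuclideanSpace ℝ (Fin d), F)) 0 :=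
  ⟨aestronglyMeasurable_zero, fun ψ => by simp⟩

theorem IsRepresentedBy.sum {ι : Type*} (s : Finset ι) {u : ι → 𝓢'(EuclideanSpace ℝ (Fin d), F)}
    {g : ι → EuclideanSpace ℝ (Fin d) → F} (h : ∀ i ∈ s, IsRepresentedBy (u i) (g i)) :
    IsRepresentedBy (∑ i ∈ s, u i) (∑ i ∈ s, g i) := by
  classical
  induction s using Finset.induction_on with
  | empty => simpa using isRepresentedBy_zero
  | insert a s ha ih =>
    rw [Finset.sum_insert ha, Finset.sum_insert ha]
    exact (h a (Finset.mem_insert_self a s)).add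
      (ih fun i hi => h i (Finset.mem_insert_of_mem hi))

/-- Integrability is only known after multiplication by a test function; a bump that exceeds `1 / 2`
near the given point recovers it for `g` itself. -/
theorem IsRepresentedBy.locallyIntegrable (hu : IsRepresentedBy u g) :
    LocallyIntegrable g volume := by
  intro x
  obtain ⟨f, -, hf2, hf3, -, hf5⟩ :=
    exists_contDiff_tsupport_subset (n := ⊤) (Filter.univ_mem (f := nhds x))
  have hc : HasCompactSupport (Complex.ofRealCLM ∘ f) := hf2.comp_left rfl
  have hs : ContDiff ℝ ((⊤ : ℕ∞) : WithTop ℕ∞) (Complex.ofRealCLM ∘ f) := by fun_prop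
  have hi := (hu.2 (hc.toSchwartzMap hs)).1
  have hU : {y | 1 / 2 < f y} ∈ nhds x :=
    (isOpen_lt continuous_const hf3.continuous).mem_nhds (by simp [hf5]; norm_num)
  refine ⟨{y | 1 / 2 < f y}, hU, ?_⟩
  refine Integrable.mono' (g := fun y => 2 * ‖(hc.toSchwartzMap hs) y • g y‖)
    ((hi.norm.const_mul 2).integrableOn) hu.1.restrict ?_
  refine (ae_restrict_iff' (measurableSet_lt measurable_const hf3.continuous.measurable)).2
    (Filter.Eventually.of_forall fun y hy => ?_)
  have hy' : 1 / 2 < f y := hy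
  have : ‖(hc.toSchwartzMap hs) y‖ = f y := by
    simp [abs_of_pos (show 0 < f y by linarith)]
  rw [norm_smul, this]
  nlinarith [norm_nonneg (g y)]

/-- The fundamental lemma of the calculus of variations. Uniqueness of the representing function
turns the infimum in `distLpNorm` into an honest `L^p`-norm. -/
theorem IsRepresentedBy.ae_eq [CompleteSpace F] (hg : IsRepresentedBy u g)
    (hh : IsRepresentedBy u h) : g =ᵐ[volume] h := by
  refine ae_eq_of_integral_contDiff_smul_eq hg.locallyIntegrable hh.locallyIntegrable
    fun f hf hf' => ?_
  have hc : HasCompactSupport (Complex.ofRealCLM ∘ f) := hf'.comp_left rfl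
  have hs : ContDiff ℝ ((⊤ : ℕ∞) : WithTop ℕ∞) (Complex.ofRealCLM ∘ f) := by fun_prop
  have h1 := (hg.2 (hc.toSchwartzMap hs)).2
  rw [(hh.2 (hc.toSchwartzMap hs)).2] at h1
  simpa using h1.symm

theorem IsRepresentedBy.distLpNorm_eq [CompleteSpace F] {p : ℝ} (hp : 0 < p)
    (hg : IsRepresentedBy u g) : distLpNorm p u = lpnn p volume fun x => ‖g x‖ₑ := by
  have e : ∀ f : EuclideanSpace ℝ (Fin d) → F,
      eLpNorm f (ENNReal.ofReal p) volume = lpnn p volume fun x => ‖f x‖ₑ := fun f => by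
    rw [eLpNorm_eq_lintegral_rpow_enorm_toReal (by simpa using hp) (by simp),
      ENNReal.toReal_ofReal hp.le, lpnn]
  refine le_antisymm ((iInf₂_le g hg).trans (e g).le) (le_iInf₂ fun f hf => ?_)
  rw [← e, eLpNorm_congr_ae (hg.ae_eq hf)]

theorem exists_isRepresentedBy {p : ℝ} (hu : distLpNorm p u ≠ ⊤) :
    ∃ g, StronglyMeasurable g ∧ IsRepresentedBy u g := by
  have : ∃ g, IsRepresentedBy u g := by
    by_contra! hcon
    exact hu (by simp [distLpNorm, hcon])
  obtain ⟨g, hg⟩ := this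
  exact ⟨hg.1.mk g, hg.1.stronglyMeasurable_mk, hg.congr hg.1.ae_eq_mk⟩

end Representation

section BesovRepresentation

variable {d : ℕ} {F : Type*} [NormedAddCommGroup F] [NormedSpace ℂ F]
  {φ : 𝓢(EuclideanSpace ℝ (Fin d), ℂ)} {σ p q : ℝ}

/-- The strongly measurable functions `g k` represent the Littlewood-Paley blocks of `f`. -/
structure BlocksRepresentedBy (φ : 𝓢(EuclideanSpace ℝ (Fin d), ℂ))
    (f : 𝓢'(EuclideanSpace ℝ (Fin d), F)) (g : ℕ → EuclideanSpace ℝ (Fin d) → F) : Prop where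
  stronglyMeasurable : ∀ k, StronglyMeasurable (g k)
  isRepresentedBy : ∀ k, IsRepresentedBy (conv (block φ k) f) (g k)

/-- The weights `2^{kσ}`. -/
noncomputable def weight (σ : ℝ) (k : ℕ) : ℝ≥0∞ := ENNReal.ofReal ((2 : ℝ) ^ ((k : ℝ) * σ))

theorem weight_ne_zero (σ : ℝ) (k : ℕ) : weight σ k ≠ 0 := by
  simp only [weight, ne_eq, ENNReal.ofReal_eq_zero, not_le]
  positivity

theorem weight_ne_top (σ : ℝ) (k : ℕ) : weight σ k ≠ ⊤ := ENNReal.ofReal_ne_top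

theorem besovNorm_eq_lpnn (f : 𝓢'(EuclideanSpace ℝ (Fin d), F)) :
    besovNorm φ σ p q f =
      lpnn q Measure.count fun k => weight σ k * distLpNorm p (conv (block φ k) f) := by
  rw [lpnn, lintegral_count]
  rfl

theorem weight_mul_distLpNorm_le (hq : 0 < q) (f : 𝓢'(EuclideanSpace ℝ (Fin d), F)) (k : ℕ) :
    weight σ k * distLpNorm p (conv (block φ k) f) ≤ besovNorm φ σ p q f := by
  have h := ENNReal.le_tsum (f := fun k : ℕ => (ENNReal.ofReal ((2 : ℝ) ^ ((k : ℝ) * σ)) *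
    distLpNorm p (conv (block φ k) f)) ^ q) k
  have h' := ENNReal.rpow_le_rpow h (by positivity : 0 ≤ 1 / q)
  rwa [← ENNReal.rpow_mul, mul_one_div_cancel hq.ne', ENNReal.rpow_one] at h'

theorem exists_blocksRepresentedBy (hq : 0 < q) {f : 𝓢'(EuclideanSpace ℝ (Fin d), F)}
    (hf : f ∈ besovSpace F φ σ p hq) : ∃ g, BlocksRepresentedBy φ f g := by
  have h : ∀ k, distLpNorm p (conv (block φ k) f) ≠ ⊤ := fun k htop => by
    have h1 := weight_mul_distLpNorm_le (φ := φ) (σ := σ) (p := p) hq f k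
    rw [htop, ENNReal.mul_top (weight_ne_zero σ k)] at h1
    exact (ne_of_lt hf) (top_le_iff.1 h1)
  choose g hg using fun k => exists_isRepresentedBy (h k)
  exact ⟨g, fun k => (hg k).1, fun k => (hg k).2⟩

theorem BlocksRepresentedBy.measurable_enorm {f : 𝓢'(EuclideanSpace ℝ (Fin d), F)}
    {g : ℕ → EuclideanSpace ℝ (Fin d) → F} (hg : BlocksRepresentedBy φ f g) (k : ℕ) :
    Measurable fun x => ‖g k x‖ₑ :=
  (hg.stronglyMeasurable k).enorm

theorem BlocksRepresentedBy.besovNorm_eq [CompleteSpace F] (hp : 0 < p)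
    {f : 𝓢'(EuclideanSpace ℝ (Fin d), F)} {g : ℕ → EuclideanSpace ℝ (Fin d) → F}
    (hg : BlocksRepresentedBy φ f g) :
    besovNorm φ σ p q f = mixedNorm (weight σ) p q volume fun k x => ‖g k x‖ₑ := by
  rw [besovNorm_eq_lpnn, mixedNorm]
  simp_rw [(hg.isRepresentedBy _).distLpNorm_eq hp]

theorem BlocksRepresentedBy.sub {f f' : 𝓢'(EuclideanSpace ℝ (Fin d), F)}
    {g g' : ℕ → EuclideanSpace ℝ (Fin d) → F} (hg : BlocksRepresentedBy φ f g)
    (hg' : BlocksRepresentedBy φ f' g') : BlocksRepresentedBy φ (f - f') (g - g') :=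
  ⟨fun k => (hg.stronglyMeasurable k).sub (hg'.stronglyMeasurable k), fun k => by
    rw [map_sub]
    exact (hg.isRepresentedBy k).sub (hg'.isRepresentedBy k)⟩

theorem BlocksRepresentedBy.smul {f : 𝓢'(EuclideanSpace ℝ (Fin d), F)}
    {g : ℕ → EuclideanSpace ℝ (Fin d) → F} (hg : BlocksRepresentedBy φ f g) (c : ℂ) :
    BlocksRepresentedBy φ (c • f) (c • g) :=
  ⟨fun k => (hg.stronglyMeasurable k).const_smul c, fun k => by
    rw [map_smul]
    exact (hg.isRepresentedBy k).smul c⟩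

theorem BlocksRepresentedBy.sum {ι : Type*} (s : Finset ι)
    {f : ι → 𝓢'(EuclideanSpace ℝ (Fin d), F)} {g : ι → ℕ → EuclideanSpace ℝ (Fin d) → F}
    (hg : ∀ i, BlocksRepresentedBy φ (f i) (g i)) :
    BlocksRepresentedBy φ (∑ i ∈ s, f i) (fun k x => ∑ i ∈ s, g i k x) := by
  refine ⟨fun k => Finset.stronglyMeasurable_fun_sum s fun i _ => (hg i).stronglyMeasurable k,
    fun k => ?_⟩
  rw [map_sum]
  convert IsRepresentedBy.sum s fun i _ => (hg i).isRepresentedBy k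
  simp

theorem BlocksRepresentedBy.map [CompleteSpace F] {F' : Type*} [NormedAddCommGroup F']
    [NormedSpace ℂ F'] [CompleteSpace F'] {f : 𝓢'(EuclideanSpace ℝ (Fin d), F)}
    {g : ℕ → EuclideanSpace ℝ (Fin d) → F} (hg : BlocksRepresentedBy φ f g) (L : F →L[ℂ] F') :
    BlocksRepresentedBy φ
      (PointwiseConvergenceCLM.postcomp 𝓢(EuclideanSpace ℝ (Fin d), ℂ) L f)
      (fun k x => L (g k x)) :=
  ⟨fun k => L.continuous.comp_stronglyMeasurable (hg.stronglyMeasurable k),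
    fun k => (hg.isRepresentedBy k).map L⟩

theorem besovNorm_add_le [CompleteSpace F] (hp : 0 < p) (hq : 0 < q)
    {f₁ f₂ : 𝓢'(EuclideanSpace ℝ (Fin d), F)} (h₁ : f₁ ∈ besovSpace F φ σ p hq)
    (h₂ : f₂ ∈ besovSpace F φ σ p hq) :
    besovNorm φ σ p q (f₁ + f₂) ≤ 2 ^ (1 + 1 / p) * 2 ^ (1 + 1 / q) *
      (besovNorm φ σ p q f₁ + besovNorm φ σ p q f₂) := by
  obtain ⟨g₁, hg₁⟩ := exists_blocksRepresentedBy hq h₁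
  obtain ⟨g₂, hg₂⟩ := exists_blocksRepresentedBy hq h₂
  have h : ∀ k, distLpNorm p (conv (block φ k) (f₁ + f₂)) ≤ 2 ^ (1 + 1 / p) *
      (distLpNorm p (conv (block φ k) f₁) + distLpNorm p (conv (block φ k) f₂)) := fun k => by
    rw [map_add, ((hg₁.isRepresentedBy k).add (hg₂.isRepresentedBy k)).distLpNorm_eq hp,
      (hg₁.isRepresentedBy k).distLpNorm_eq hp, (hg₂.isRepresentedBy k).distLpNorm_eq hp]
    exact (lpnn_mono hp (Filter.Eventually.of_forall fun x => enorm_add_le _ _)).trans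
      (lpnn_add_le hp (hg₁.measurable_enorm k))
  simp_rw [besovNorm_eq_lpnn]
  rw [mul_assoc]
  refine le_trans ?_ (mul_le_mul_right (lpnn_add_le hq (measurable_of_countable _)) _)
  rw [← lpnn_const_mul hq _ (measurable_of_countable _)]
  refine lpnn_mono hq (Filter.Eventually.of_forall fun k => ?_)
  refine (mul_le_mul_right (h k) _).trans (le_of_eq ?_)
  ring

end BesovRepresentation

/-! ### Gaussian sums of pairings -/

section Pair

variable {d : ℕ} {φ : 𝓢(EuclideanSpace ℝ (Fin d), ℂ)} {σ p q : ℝ}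
  {K : Type*} [NormedAddCommGroup K] [InnerProductSpace ℂ K]

theorem enorm_toLp_inner_le {n : ℕ} {e : Fin n → K} (he : Orthonormal ℂ e) (v : K) :
    ‖WithLp.toLp 2 fun i => (inner ℂ (e i) v : ℂ)‖ₑ ≤ ‖v‖ₑ := by
  rw [enorm_le_iff_norm_le]
  refine le_of_sq_le_sq ?_ (norm_nonneg v)
  rw [EuclideanSpace.norm_sq_eq]
  exact he.sum_inner_products_le v

theorem enorm_toLp_equivFin_sq {ι : Type*} (c : ι → ℂ) (s : Finset ι) :
    ‖WithLp.toLp 2 fun i : Fin s.card => c (s.equivFin.symm i)‖ ^ 2 = ∑ i ∈ s, ‖c i‖ ^ 2 := by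
  rw [EuclideanSpace.norm_sq_eq, ← Finset.sum_coe_sort s,
    ← Equiv.sum_comp s.equivFin.symm fun i : s => ‖c i‖ ^ 2]

/-- Parseval's identity. The finite sets of indices are enumerated by `Fin s.card` because the
Gaussian sums are indexed by `Fin n`. -/
theorem tendsto_enorm_toLp_hilbertBasis {ι : Type*} (b : HilbertBasis ι ℂ K) (v : K) :
    Filter.Tendsto (fun s : Finset ι => ‖WithLp.toLp 2 fun i : Fin s.card =>
      (inner ℂ (b (s.equivFin.symm i)) v : ℂ)‖ₑ) Filter.atTop (nhds ‖v‖ₑ) := by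
  have h1 : HasSum (fun i => ‖(inner ℂ (b i) v : ℂ)‖ ^ 2) (‖v‖ ^ 2) := by
    have h := (b.hasSum_inner_mul_inner v v).mapL Complex.reCLM
    convert h using 1
    · ext i
      rw [← inner_conj_symm v (b i), Complex.conj_mul']
      simp [← Complex.ofReal_pow]
    · exact (inner_self_eq_norm_sq (𝕜 := ℂ) v).symm
  have h2 : Filter.Tendsto (fun s : Finset ι => ‖WithLp.toLp 2 fun i : Fin s.card =>
      (inner ℂ (b (s.equivFin.symm i)) v : ℂ)‖) Filter.atTop (nhds ‖v‖) := by
    have h3 := (Real.continuous_sqrt.tendsto _).comp (h1 : Filter.Tendsto _ _ _)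
    rw [Real.sqrt_sq (norm_nonneg v)] at h3
    refine h3.congr fun s => ?_
    simp only [Function.comp_apply]
    rw [← enorm_toLp_equivFin_sq (fun i => (inner ℂ (b i) v : ℂ)), Real.sqrt_sq (norm_nonneg _)]
  simp_rw [← ofReal_norm]
  exact (ENNReal.continuous_ofReal.tendsto _).comp h2

variable [CompleteSpace K]

theorem BlocksRepresentedBy.pair {G : 𝓢'(EuclideanSpace ℝ (Fin d), K)}
    {g : ℕ → EuclideanSpace ℝ (Fin d) → K} (hg : BlocksRepresentedBy φ G g) (h : K) :
    BlocksRepresentedBy φ (pair h G) (fun k x => inner ℂ h (g k x)) :=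
  hg.map (innerSL ℂ h)

theorem besovNorm_gaussian_sum (hp : 0 < p) {n : ℕ} {x : Fin n → 𝓢'(EuclideanSpace ℝ (Fin d), ℂ)}
    {g : Fin n → ℕ → EuclideanSpace ℝ (Fin d) → ℂ}
    (hg : ∀ i, BlocksRepresentedBy φ (x i) (g i)) (ω : Fin n → ℝ) :
    besovNorm φ σ p q (∑ i, (ω i : ℂ) • x i) =
      mixedNorm (weight σ) p q volume fun k y => ‖∑ i, (ω i : ℂ) * g i k y‖ₑ :=
  (BlocksRepresentedBy.sum Finset.univ fun i => (hg i).smul (ω i : ℂ)).besovNorm_eq hp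

theorem measurable_besovNorm_gaussian_sum (hp : 0 < p) (hq : 0 < q) {n : ℕ}
    {x : Fin n → 𝓢'(EuclideanSpace ℝ (Fin d), ℂ)} (hx : ∀ i, x i ∈ besovSpace ℂ φ σ p hq) :
    Measurable fun ω : Fin n → ℝ => besovNorm φ σ p q (∑ i, (ω i : ℂ) • x i) := by
  choose g hg using fun i => exists_blocksRepresentedBy hq (hx i)
  simp_rw [besovNorm_gaussian_sum hp hg]
  exact measurable_gaussian_mixedNorm _ p q fun i k => ((hg i).stronglyMeasurable k).measurable

/-- The upper half of the equivalence: by Bessel's inequality the square function of the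
coefficients is pointwise at most `‖g k x‖`. -/
theorem lpnn_besovNorm_pair_le (hp : 0 < p) (hq : 0 < q) {r : ℝ} (hpr : p ≤ r) (hqr : q ≤ r)
    (h2r : 2 ≤ r) {C : ℝ≥0∞}
    (hC : ∀ (n : ℕ) (c : Fin n → ℂ),
      lpnn r (gaussianPi n) (fun ω => ‖∑ i, (ω i : ℂ) * c i‖ₑ) ≤ C * ‖WithLp.toLp 2 c‖ₑ)
    {G : 𝓢'(EuclideanSpace ℝ (Fin d), K)} (hG : G ∈ besovSpace K φ σ p hq)
    {n : ℕ} {e : Fin n → K} (he : Orthonormal ℂ e) :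
    lpnn 2 (gaussianPi n) (fun ω => besovNorm φ σ p q (∑ i, (ω i : ℂ) • pair (e i) G)) ≤
      C * besovNorm φ σ p q G := by
  obtain ⟨g, hg⟩ := exists_blocksRepresentedBy hq hG
  simp_rw [besovNorm_gaussian_sum hp fun i => hg.pair (e i)]
  refine (gaussian_mixedNorm_le hp hq hpr hqr h2r hC (weight σ) fun i k =>
    ((hg.pair (e i)).stronglyMeasurable k).measurable).trans ?_
  rw [hg.besovNorm_eq hp]
  gcongr
  exact mixedNorm_mono _ hp hq fun k => Filter.Eventually.of_forall fun x =>
    enorm_toLp_inner_le he _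

/-- Fatou's lemma for mixed norms. -/
theorem mixedNorm_le_of_tendsto {X : Type*} [MeasurableSpace X] {μ : Measure X} (w : ℕ → ℝ≥0∞)
    (hw : ∀ k, w k ≠ ⊤) (hp : 0 < p) (hq : 0 < q) {v : ℕ → ℕ → X → ℝ≥0∞} {u : ℕ → X → ℝ≥0∞}
    (hv : ∀ m k, Measurable (v m k))
    (hlim : ∀ k, ∀ᵐ x ∂μ, Filter.Tendsto (fun m => v m k x) Filter.atTop (nhds (u k x)))
    {A : ℝ≥0∞} (hA : ∀ᶠ m in Filter.atTop, mixedNorm w p q μ (v m) ≤ A) :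
    mixedNorm w p q μ u ≤ A := by
  calc mixedNorm w p q μ u
      ≤ lpnn q Measure.count fun k =>
          Filter.liminf (fun m => w k * lpnn p μ (v m k)) Filter.atTop := by
        refine lpnn_mono hq (Filter.Eventually.of_forall fun k => ?_)
        have h1 : lpnn p μ (u k) ≤ Filter.liminf (fun m => lpnn p μ (v m k)) Filter.atTop := by
          refine le_trans (lpnn_mono hp ?_) (lpnn_le_liminf hp fun m => hv m k)
          filter_upwards [hlim k] with x hx
          exact hx.liminf_eq.ge
        have h2 : w k * Filter.liminf (fun m => lpnn p μ (v m k)) Filter.atTop =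
            Filter.liminf (fun m => w k * lpnn p μ (v m k)) Filter.atTop :=
          (ENNReal.liminf_const_mul_of_ne_top (hw k)).symm
        rw [← h2]
        gcongr
    _ ≤ Filter.liminf (fun m => mixedNorm w p q μ (v m)) Filter.atTop :=
        lpnn_le_liminf hq fun m => measurable_of_countable _
    _ ≤ A := Filter.liminf_le_of_frequently_le' hA.frequently

/-- The lower half: the square functions over an exhausting sequence of finite subsets of the basis
tend pointwise to `‖g k x‖`, and Fatou's lemma passes the uniform bound to the limit. Only
subsystems of one basis are tested, so in the real case complex orthonormal systems never enter. -/
theorem besovNorm_le_lpnn_pair (hp : 0 < p) (hq : 0 < q) {s : ℝ} (hs : 0 < s) (hsp : s ≤ p)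
    (hsq : s ≤ q) (hs2 : s ≤ 2) {C : ℝ≥0∞}
    (hC : ∀ (n : ℕ) (c : Fin n → ℂ),
      ‖WithLp.toLp 2 c‖ₑ ≤ C * lpnn s (gaussianPi n) (fun ω => ‖∑ i, (ω i : ℂ) * c i‖ₑ))
    {G : 𝓢'(EuclideanSpace ℝ (Fin d), K)} (hG : G ∈ besovSpace K φ σ p hq)
    {ι : Type*} [Countable ι] (b : HilbertBasis ι ℂ K) {A : ℝ≥0∞}
    (hA : ∀ (n : ℕ) (e : Fin n → ι), Function.Injective e →
      lpnn 2 (gaussianPi n) (fun ω => besovNorm φ σ p q (∑ i, (ω i : ℂ) • pair (b (e i)) G)) ≤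
        A) :
    besovNorm φ σ p q G ≤ C * A := by
  obtain ⟨g, hg⟩ := exists_blocksRepresentedBy hq hG
  obtain ⟨t, -, ht⟩ := Filter.exists_seq_monotone_tendsto_atTop_atTop (Finset ι)
  rw [hg.besovNorm_eq hp]
  refine mixedNorm_le_of_tendsto (v := fun m k x => ‖WithLp.toLp 2 fun i : Fin (t m).card =>
    (inner ℂ (b ((t m).equivFin.symm i)) (g k x) : ℂ)‖ₑ) (weight σ) (weight_ne_top σ) hp hq
    (fun m k => measurable_enorm_toLp fun i => ((hg.pair _).stronglyMeasurable k).measurable)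
    (fun k => Filter.Eventually.of_forall fun x =>
      (tendsto_enorm_toLp_hilbertBasis b (g k x)).comp ht)
    (Filter.Eventually.of_forall fun m => ?_)
  refine (mixedNorm_le_gaussian hs hsp hsq hs2 hC (weight σ)
    (g := fun i k x => (inner ℂ (b ((t m).equivFin.symm i)) (g k x) : ℂ)) fun i k =>
    ((hg.pair _).stronglyMeasurable k).measurable).trans ?_
  gcongr
  have h := hA _ (fun i => ((t m).equivFin.symm i : ι))
    (Subtype.val_injective.comp (t m).equivFin.symm.injective)
  simp_rw [besovNorm_gaussian_sum hp fun i => hg.pair (b ((t m).equivFin.symm i))] at h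
  exact h

theorem BlocksRepresentedBy.tensor {x : 𝓢'(EuclideanSpace ℝ (Fin d), ℂ)}
    {g : ℕ → EuclideanSpace ℝ (Fin d) → ℂ} (hg : BlocksRepresentedBy φ x g) (h : K) :
    BlocksRepresentedBy φ (tensor x h) (fun k y => g k y • h) :=
  hg.map (ContinuousLinearMap.toSpanSingleton ℂ h)

theorem tensor_mem_besovSpace (hq : 0 < q) {x : 𝓢'(EuclideanSpace ℝ (Fin d), ℂ)}
    (hx : x ∈ besovSpace ℂ φ σ p hq) (h : K) : tensor x h ∈ besovSpace K φ σ p hq :=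
  besovNorm_lt_top_of_le φ σ p hq
    (ENNReal.ofReal_ne_top (r := 1 + ‖ContinuousLinearMap.toSpanSingleton ℂ h‖))
    (fun k => by
      have e : conv (block φ k) (BesovGamma.tensor x h) =
        PointwiseConvergenceCLM.postcomp 𝓢(EuclideanSpace ℝ (Fin d), ℂ)
          (ContinuousLinearMap.toSpanSingleton ℂ h) (conv (block φ k) x) := rfl
      rw [e]
      refine (distLpNorm_postcomp_le p _ _).trans ?_
      gcongr
      exact le_self_add) hx hx

/-- The expansions of `G` in an orthonormal basis of `K` converge to `G`. -/
theorem tendsto_besovNorm_sub_sum_tensor (hp : 0 < p) (hq : 0 < q)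
    {G : 𝓢'(EuclideanSpace ℝ (Fin d), K)} (hG : G ∈ besovSpace K φ σ p hq)
    {ι : Type*} (b : HilbertBasis ι ℂ K) {t : ℕ → Finset ι}
    (ht : Filter.Tendsto t Filter.atTop Filter.atTop) :
    Filter.Tendsto (fun m => besovNorm φ σ p q
      (G - ∑ i ∈ t m, tensor (pair (b i) G) (b i))) Filter.atTop (nhds 0) := by
  obtain ⟨g, hg⟩ := exists_blocksRepresentedBy hq hG
  have hr : ∀ m, BlocksRepresentedBy φ (G - ∑ i ∈ t m, tensor (BesovGamma.pair (b i) G) (b i))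
      (g - fun k x => ∑ i ∈ t m, (inner ℂ (b i) (g k x) : ℂ) • b i) := fun m =>
    hg.sub (BlocksRepresentedBy.sum (t m) fun i => (hg.pair (b i)).tensor (b i))
  simp_rw [(hr _).besovNorm_eq hp]
  have hbound : ∀ m v, ‖v - ∑ i ∈ t m, (inner ℂ (b i) v : ℂ) • b i‖ₑ ≤ 2 * ‖v‖ₑ := by
    intro m v
    have h1 : ‖∑ i ∈ t m, (inner ℂ (b i) v : ℂ) • b i‖ ≤ ‖v‖ := by
      refine le_of_sq_le_sq ?_ (norm_nonneg v)
      refine le_trans (le_of_eq ?_) (b.orthonormal.sum_inner_products_le v (s := t m))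
      have h2 := b.orthonormal.inner_sum (fun i => (inner ℂ (b i) v : ℂ))
        (fun i => (inner ℂ (b i) v : ℂ)) (t m)
      rw [← inner_self_eq_norm_sq (𝕜 := ℂ), h2]
      simp_rw [Complex.conj_mul']
      simp [← Complex.ofReal_pow]
    have h3 : ‖v - ∑ i ∈ t m, (inner ℂ (b i) v : ℂ) • b i‖ ≤ 2 * ‖v‖ := by
      linarith [norm_sub_le v (∑ i ∈ t m, (inner ℂ (b i) v : ℂ) • b i)]
    rw [← ofReal_norm, ← ofReal_norm, show (2 : ℝ≥0∞) = ENNReal.ofReal 2 by simp,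
      ← ENNReal.ofReal_mul two_pos.le]
    exact ENNReal.ofReal_le_ofReal h3
  have hlim : ∀ v, Filter.Tendsto (fun m => ‖v - ∑ i ∈ t m, (inner ℂ (b i) v : ℂ) • b i‖ₑ)
      Filter.atTop (nhds 0) := by
    intro v
    have h1 : HasSum (fun i => (inner ℂ (b i) v : ℂ) • b i) v := by
      simpa [b.repr_apply_apply] using b.hasSum_repr v
    have h2 := ((tendsto_const_nhds (x := v)).sub
      ((h1 : Filter.Tendsto _ _ _).comp ht)).enorm
    simpa using h2
  have hmeas : ∀ m k, Measurable fun x =>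
      ‖(g - fun k x => ∑ i ∈ t m, (inner ℂ (b i) (g k x) : ℂ) • b i) k x‖ₑ :=
    fun m k => (hr m).measurable_enorm k
  have hfin : (mixedNorm (weight σ) p q volume fun k x => 2 * ‖g k x‖ₑ) < ⊤ := by
    rw [mixedNorm_const_mul _ hp hq _ hg.measurable_enorm, ← hg.besovNorm_eq hp]
    exact ENNReal.mul_lt_top (by simp) hG
  unfold mixedNorm
  -- Dominated convergence is used twice: over `k` with the sequence of norms of `2 * ‖g k x‖` as
  -- majorant, and for each `k` over `x`.
  refine tendsto_lpnn_zero hq (b := fun k => weight σ k * lpnn p volume fun x => 2 * ‖g k x‖ₑ)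
    (fun m => measurable_of_countable _) (fun m => Filter.Eventually.of_forall fun k => ?_)
    hfin.ne (Filter.Eventually.of_forall fun k => ?_)
  · dsimp only
    gcongr
    exact lpnn_mono hp (Filter.Eventually.of_forall fun x => hbound m (g k x))
  · rw [← mul_zero (weight σ k)]
    refine ENNReal.Tendsto.const_mul ?_ (.inr (weight_ne_top σ k))
    refine tendsto_lpnn_zero hp (b := fun x => 2 * ‖g k x‖ₑ) (fun m => hmeas m k)
      (fun m => Filter.Eventually.of_forall fun x => hbound m (g k x)) ?_
      (Filter.Eventually.of_forall fun x => hlim (g k x))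
    have h1 : lpnn p volume (fun x => ‖g k x‖ₑ) ≠ ⊤ := by
      rw [← (hg.isRepresentedBy k).distLpNorm_eq hp]
      intro htop
      have h1 := weight_mul_distLpNorm_le (φ := φ) (σ := σ) (p := p) hq G k
      rw [htop, ENNReal.mul_top (weight_ne_zero σ k)] at h1
      exact (ne_of_lt hG) (top_le_iff.1 h1)
    rw [lpnn_const_mul hp _ (hg.measurable_enorm k)]
    exact ENNReal.mul_ne_top (by simp) h1

end Pair

/-! ### Convolution operators on test functions -/

section TestFunctions

variable {d : ℕ}

theorem fourier_reflect (a : 𝓢(EuclideanSpace ℝ (Fin d), ℂ)) : 𝓕 (reflect a) = reflect (𝓕 a) := by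
  ext ξ
  rw [reflect_apply, fourier_coe, fourier_coe]
  exact Real.fourier_comp_linearIsometry (LinearIsometryEquiv.neg ℝ) a ξ

theorem fourierInv_eq_reflect (a : 𝓢(EuclideanSpace ℝ (Fin d), ℂ)) :
    𝓕⁻ a = reflect (𝓕 a) := rfl

/-- The operator `ψ ↦ a(- ·) * ψ` on test functions, the transpose of the convolution with `a`. -/
noncomputable def convTest (a : 𝓢(EuclideanSpace ℝ (Fin d), ℂ)) :
    𝓢(EuclideanSpace ℝ (Fin d), ℂ) →L[ℂ] 𝓢(EuclideanSpace ℝ (Fin d), ℂ) :=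
  SchwartzMap.convolution (ContinuousLinearMap.mul ℂ ℂ) (reflect a)

theorem conv_apply_eq {F : Type*} [NormedAddCommGroup F] [NormedSpace ℂ F]
    (a : 𝓢(EuclideanSpace ℝ (Fin d), ℂ)) (f : 𝓢'(EuclideanSpace ℝ (Fin d), F))
    (ψ : 𝓢(EuclideanSpace ℝ (Fin d), ℂ)) : conv a f ψ = f (convTest a ψ) := rfl

theorem convTest_apply (a ψ : 𝓢(EuclideanSpace ℝ (Fin d), ℂ)) (y : EuclideanSpace ℝ (Fin d)) :
    convTest a ψ y = ∫ x, a (x - y) * ψ x :=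
  reflect_convolution_apply a ψ y

theorem convTest_sub (a b ψ : 𝓢(EuclideanSpace ℝ (Fin d), ℂ)) :
    convTest (a - b) ψ = convTest a ψ - convTest b ψ := by
  simp [convTest]

theorem fourier_convTest (a ψ : 𝓢(EuclideanSpace ℝ (Fin d), ℂ)) :
    𝓕 (convTest a ψ) = pairing (ContinuousLinearMap.mul ℂ ℂ) (reflect (𝓕 a)) (𝓕 ψ) := by
  rw [convTest, fourier_convolution, fourier_reflect]

/-- The sign in `𝓕 a (-ξ)` reflects that `convTest a` is the transpose of the convolution; it is
harmless, as only pointwise relations between two multipliers at the same point are used. -/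
theorem fourier_convTest_apply (a ψ : 𝓢(EuclideanSpace ℝ (Fin d), ℂ))
    (ξ : EuclideanSpace ℝ (Fin d)) : 𝓕 (convTest a ψ) ξ = 𝓕 a (-ξ) * 𝓕 ψ ξ := by
  rw [fourier_convTest]
  rfl

theorem eq_of_fourier_eq {a b : 𝓢(EuclideanSpace ℝ (Fin d), ℂ)} (h : 𝓕 a = 𝓕 b) : a = b := by
  have h' := congrArg (fun f : 𝓢(EuclideanSpace ℝ (Fin d), ℂ) => 𝓕⁻ f) h
  simpa using h'

theorem fourier_sub (a b : 𝓢(EuclideanSpace ℝ (Fin d), ℂ)) : 𝓕 (a - b) = 𝓕 a - 𝓕 b :=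
  (fourierCLM ℂ 𝓢(EuclideanSpace ℝ (Fin d), ℂ)).map_sub a b

theorem convTest_convTest_of_eq_one {a b : 𝓢(EuclideanSpace ℝ (Fin d), ℂ)}
    (h : ∀ ξ, 𝓕 a ξ ≠ 0 → 𝓕 b ξ = 1) (ψ : 𝓢(EuclideanSpace ℝ (Fin d), ℂ)) :
    convTest a (convTest b ψ) = convTest a ψ := by
  refine eq_of_fourier_eq ?_
  ext ξ
  simp only [fourier_convTest_apply]
  by_cases h0 : 𝓕 a (-ξ) = 0
  · simp [h0]
  · rw [h _ h0, one_mul]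

theorem convTest_convTest_of_mul_eq_zero {a b : 𝓢(EuclideanSpace ℝ (Fin d), ℂ)}
    (h : ∀ ξ, 𝓕 a ξ * 𝓕 b ξ = 0) (ψ : 𝓢(EuclideanSpace ℝ (Fin d), ℂ)) :
    convTest a (convTest b ψ) = 0 := by
  refine eq_of_fourier_eq ?_
  ext ξ
  simp only [fourier_convTest_apply]
  rw [← mul_assoc, h, zero_mul]
  simp

/-! ### Low-pass functions and the decay of high-frequency parts -/

variable {φ : 𝓢(EuclideanSpace ℝ (Fin d), ℂ)}

/-- The low-pass function with Fourier transform `φ̂(2⁻ʲ ·)`. -/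
noncomputable def lowPass (φ : 𝓢(EuclideanSpace ℝ (Fin d), ℂ)) (j : ℕ) :
    𝓢(EuclideanSpace ℝ (Fin d), ℂ) :=
  𝓕⁻ (dilate (twoInv j) (𝓕 φ))

theorem fourier_lowPass (φ : 𝓢(EuclideanSpace ℝ (Fin d), ℂ)) (j : ℕ) :
    𝓕 (lowPass φ j) = dilate (twoInv j) (𝓕 φ) := by
  simp [lowPass]

theorem fourier_lowPass_apply (φ : 𝓢(EuclideanSpace ℝ (Fin d), ℂ)) (j : ℕ)
    (ξ : EuclideanSpace ℝ (Fin d)) : 𝓕 (lowPass φ j) ξ = 𝓕 φ (((2 : ℝ)⁻¹ ^ j) • ξ) := by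
  rw [fourier_lowPass]
  rfl

theorem lowPass_zero (φ : 𝓢(EuclideanSpace ℝ (Fin d), ℂ)) : lowPass φ 0 = φ := by
  refine eq_of_fourier_eq ?_
  ext ξ
  simp [fourier_lowPass_apply]

theorem block_zero (φ : 𝓢(EuclideanSpace ℝ (Fin d), ℂ)) : block φ 0 = φ := rfl

theorem block_succ (φ : 𝓢(EuclideanSpace ℝ (Fin d), ℂ)) (k : ℕ) :
    block φ (k + 1) = lowPass φ (k + 1) - lowPass φ k := by
  simp only [block, lowPass]
  exact (fourierInvCLM ℂ 𝓢(EuclideanSpace ℝ (Fin d), ℂ)).map_sub _ _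

theorem sum_convTest_block (φ ψ : 𝓢(EuclideanSpace ℝ (Fin d), ℂ)) (m : ℕ) :
    ∑ k ∈ Finset.range (m + 1), convTest (block φ k) ψ = convTest (lowPass φ m) ψ := by
  induction m with
  | zero => simp [block_zero, lowPass_zero]
  | succ m ih => rw [Finset.sum_range_succ, ih, block_succ, convTest_sub]; abel

theorem norm_inv_two_pow_smul (j : ℕ) (ξ : EuclideanSpace ℝ (Fin d)) :
    ‖((2 : ℝ)⁻¹ ^ j) • ξ‖ = ‖ξ‖ / 2 ^ j := by
  rw [norm_smul, norm_pow, norm_inv, Real.norm_two, inv_pow]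
  ring

theorem IsGenerator.fourier_lowPass_eq_one (hφ : IsGenerator φ) {j : ℕ}
    {ξ : EuclideanSpace ℝ (Fin d)} (h : ‖ξ‖ ≤ 2 ^ j) : 𝓕 (lowPass φ j) ξ = 1 := by
  rw [fourier_lowPass_apply]
  refine hφ.eq_one _ ?_
  rw [norm_inv_two_pow_smul]
  exact (div_le_one (by positivity)).2 h

theorem IsGenerator.fourier_lowPass_eq_zero (hφ : IsGenerator φ) {j : ℕ}
    {ξ : EuclideanSpace ℝ (Fin d)} (h : 3 / 2 * 2 ^ j ≤ ‖ξ‖) : 𝓕 (lowPass φ j) ξ = 0 := by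
  rw [fourier_lowPass_apply]
  refine hφ.eq_zero _ ?_
  rw [norm_inv_two_pow_smul]
  exact (le_div_iff₀ (by positivity)).2 h

theorem IsGenerator.fourier_block_eq_zero (hφ : IsGenerator φ) {k : ℕ}
    {ξ : EuclideanSpace ℝ (Fin d)} (h : 3 / 2 * 2 ^ k ≤ ‖ξ‖) : 𝓕 (block φ k) ξ = 0 := by
  rcases k with _ | k
  · rw [block_zero, ← lowPass_zero φ]
    exact hφ.fourier_lowPass_eq_zero h
  · rw [block_succ, fourier_sub, sub_apply, hφ.fourier_lowPass_eq_zero h,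
      hφ.fourier_lowPass_eq_zero (h.trans' ?_), sub_zero]
    rw [pow_succ]
    nlinarith [pow_pos (two_pos (α := ℝ)) k]

theorem IsGenerator.fourier_block_mul_lowPass (hφ : IsGenerator φ) (k : ℕ)
    (ξ : EuclideanSpace ℝ (Fin d)) : 𝓕 (block φ (k + 2)) ξ * 𝓕 (lowPass φ k) ξ = 0 := by
  have hk := pow_pos (two_pos (α := ℝ)) k
  rcases le_total ‖ξ‖ (2 ^ (k + 1)) with h | h
  · rw [block_succ, fourier_sub, sub_apply, hφ.fourier_lowPass_eq_one h,
      hφ.fourier_lowPass_eq_one (h.trans ?_), sub_self, zero_mul]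
    exact pow_le_pow_right₀ one_le_two (by omega)
  · rw [hφ.fourier_lowPass_eq_zero (h.trans' ?_), mul_zero]
    rw [pow_succ]
    linarith

/-- The difference vanishes for `‖ξ‖ < 2 ^ j`, and elsewhere `2 ^ (j * N) ≤ ‖ξ‖ ^ N`, which is paid
for by raising the polynomial weight of the seminorm from `k` to `k + N`. By Leibniz the cut-off
only contributes its derivatives, and dilation by `2⁻ʲ ≤ 1` does not increase these. -/
theorem seminorm_sub_dilate_mul_le {χ : 𝓢(EuclideanSpace ℝ (Fin d), ℂ)}
    (hχ : ∀ ξ, ‖ξ‖ ≤ 1 → χ ξ = 1) (N k n : ℕ) (j : ℕ) (η : 𝓢(EuclideanSpace ℝ (Fin d), ℂ)) :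
    2 ^ (j * N) * SchwartzMap.seminorm ℂ k n
        (η - pairing (ContinuousLinearMap.mul ℂ ℂ) (dilate (twoInv j) χ) η) ≤
      SchwartzMap.seminorm ℂ (k + N) n η + ∑ i ∈ Finset.range (n + 1),
        (n.choose i : ℝ) * SchwartzMap.seminorm ℂ 0 i χ * SchwartzMap.seminorm ℂ (k + N) (n - i) η
        := by
  set B := SchwartzMap.seminorm ℂ (k + N) n η + ∑ i ∈ Finset.range (n + 1),
        (n.choose i : ℝ) * SchwartzMap.seminorm ℂ 0 i χ *
          SchwartzMap.seminorm ℂ (k + N) (n - i) η with hB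
  have hB0 : 0 ≤ B := by positivity
  set χj := dilate (twoInv j) χ with hχj
  rw [← le_div_iff₀' (by positivity)]
  refine SchwartzMap.seminorm_le_bound ℂ k n _ (by positivity) fun ξ => ?_
  rw [le_div_iff₀' (by positivity)]
  rcases lt_or_ge ‖ξ‖ (2 ^ j) with h | h
  · have hz : (⇑(η - pairing (ContinuousLinearMap.mul ℂ ℂ) χj η)) =ᶠ[nhds ξ] fun _ => 0 := by
      filter_upwards [(isOpen_lt continuous_norm continuous_const).mem_nhds h] with ζ hζ
      have h1 : χj ζ = 1 := by
        rw [hχj, dilate_apply]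
        refine hχ _ ?_
        simp only [twoInv, Units.val_mk0]
        rw [norm_inv_two_pow_smul]
        exact (div_le_one (by positivity)).2 (le_of_lt hζ)
      simp [h1]
    rw [(hz.iteratedFDeriv ℝ n).eq_of_nhds]
    simp only [iteratedFDeriv_fun_zero, Pi.zero_apply, norm_zero, mul_zero]
    exact hB0
  · have hξ : (2 : ℝ) ^ (j * N) * ‖ξ‖ ^ k ≤ ‖ξ‖ ^ (k + N) := by
      rw [pow_mul, pow_add, mul_comm]
      gcongr
    have hχi : ∀ i, ‖iteratedFDeriv ℝ i χj ξ‖ ≤ SchwartzMap.seminorm ℂ 0 i χ := fun i => by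
      have e : (χj : EuclideanSpace ℝ (Fin d) → ℂ) = fun z => χ (((2 : ℝ)⁻¹ ^ j) • z) := by
        ext z
        rw [hχj, dilate_apply]
        rfl
      rw [e, iteratedFDeriv_comp_const_smul _ (χ.smooth i), norm_smul]
      refine (mul_le_of_le_one_left (norm_nonneg _) ?_).trans
        (norm_iteratedFDeriv_le_seminorm ℂ χ i _)
      rw [norm_pow, norm_pow, norm_inv, Real.norm_two]
      exact pow_le_one₀ (by positivity) (pow_le_one₀ (by norm_num) (by norm_num))
    have hD : ‖iteratedFDeriv ℝ n (η - pairing (ContinuousLinearMap.mul ℂ ℂ) χj η) ξ‖ ≤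
        ‖iteratedFDeriv ℝ n η ξ‖ + ∑ i ∈ Finset.range (n + 1), (n.choose i : ℝ) *
          SchwartzMap.seminorm ℂ 0 i χ * ‖iteratedFDeriv ℝ (n - i) η ξ‖ := by
      have e : (⇑(η - pairing (ContinuousLinearMap.mul ℂ ℂ) χj η)) =
          ⇑η - fun y => χj y * η y := rfl
      rw [e, iteratedFDeriv_sub_apply (η.contDiffAt n)
        ((χj.contDiffAt n).mul (η.contDiffAt n))]
      refine (norm_sub_le _ _).trans (add_le_add le_rfl ?_)
      refine (norm_iteratedFDeriv_mul_le (χj.smooth n) (η.smooth n) ξ le_rfl).trans ?_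
      gcongr with i hi
      exact hχi i
    calc (2 : ℝ) ^ (j * N) * (‖ξ‖ ^ k * ‖iteratedFDeriv ℝ n
          (η - pairing (ContinuousLinearMap.mul ℂ ℂ) χj η) ξ‖)
        = 2 ^ (j * N) * ‖ξ‖ ^ k * ‖iteratedFDeriv ℝ n
          (η - pairing (ContinuousLinearMap.mul ℂ ℂ) χj η) ξ‖ := by ring
      _ ≤ ‖ξ‖ ^ (k + N) * (‖iteratedFDeriv ℝ n η ξ‖ + ∑ i ∈ Finset.range (n + 1),
          (n.choose i : ℝ) * SchwartzMap.seminorm ℂ 0 i χ * ‖iteratedFDeriv ℝ (n - i) η ξ‖) := by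
          gcongr
      _ = ‖ξ‖ ^ (k + N) * ‖iteratedFDeriv ℝ n η ξ‖ + ∑ i ∈ Finset.range (n + 1),
          (n.choose i : ℝ) * SchwartzMap.seminorm ℂ 0 i χ *
            (‖ξ‖ ^ (k + N) * ‖iteratedFDeriv ℝ (n - i) η ξ‖) := by
          rw [mul_add, Finset.mul_sum]
          congr 1
          exact Finset.sum_congr rfl fun i _ => by ring
      _ ≤ B := by
          rw [hB]
          gcongr with i hi
          · exact SchwartzMap.le_seminorm ℂ _ _ η ξ
          · exact SchwartzMap.le_seminorm ℂ _ _ η ξ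

theorem continuous_seminorm (k n : ℕ) :
    Continuous (SchwartzMap.seminorm ℂ k n : Seminorm ℂ 𝓢(EuclideanSpace ℝ (Fin d), ℂ)) :=
  (schwartz_withSeminorms ℂ (EuclideanSpace ℝ (Fin d)) ℂ).continuous_seminorm (k, n)

/-- The high-frequency parts of a test function decay rapidly, in all continuous seminorms. -/
theorem IsGenerator.exists_seminorm_sub_convTest_le (hφ : IsGenerator φ)
    (P : Seminorm ℂ 𝓢(EuclideanSpace ℝ (Fin d), ℂ)) (hP : Continuous P) (N : ℕ) :
    ∃ Q : 𝓢(EuclideanSpace ℝ (Fin d), ℂ) → ℝ, Continuous Q ∧ Q 0 = 0 ∧ (∀ ψ, 0 ≤ Q ψ) ∧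
      ∀ j ψ, 2 ^ (j * N) * P (ψ - convTest (lowPass φ j) ψ) ≤ Q ψ := by
  have hP' : Continuous (P.comp (fourierInvCLM ℂ 𝓢(EuclideanSpace ℝ (Fin d), ℂ)).toLinearMap) :=
    hP.comp (fourierInvCLM ℂ 𝓢(EuclideanSpace ℝ (Fin d), ℂ)).continuous
  obtain ⟨s, C, -, hC⟩ := Seminorm.bound_of_continuous
    (schwartz_withSeminorms ℂ (EuclideanSpace ℝ (Fin d)) ℂ) _ hP'
  -- The operator `convTest` multiplies the Fourier transform by a reflected symbol, so the cut-off
  -- is the reflection of `φ̂`. The inverse Fourier transform is continuous, hence it suffices to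
  -- bound Schwartz seminorms on the frequency side.
  set χ := reflect (𝓕 φ) with hχdef
  have hχ : ∀ ξ, ‖ξ‖ ≤ 1 → χ ξ = 1 := fun ξ hξ => by
    rw [hχdef, reflect_apply]
    exact hφ.eq_one _ (by rwa [norm_neg])
  let Q₀ : ℕ × ℕ → 𝓢(EuclideanSpace ℝ (Fin d), ℂ) → ℝ := fun m η =>
    SchwartzMap.seminorm ℂ (m.1 + N) m.2 η + ∑ i ∈ Finset.range (m.2 + 1),
      (m.2.choose i : ℝ) * SchwartzMap.seminorm ℂ 0 i χ *
        SchwartzMap.seminorm ℂ (m.1 + N) (m.2 - i) η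
  have hQ₀ : ∀ m, Continuous (Q₀ m) := fun m => by
    refine (continuous_seminorm _ _).add (continuous_finsetSum _ fun i _ => ?_)
    exact (continuous_seminorm _ _).const_mul _
  have hQ₀' : ∀ m η, 0 ≤ Q₀ m η := fun m η => by positivity
  refine ⟨fun ψ => C * ∑ m ∈ s, Q₀ m (𝓕 ψ), ?_, ?_, ?_, ?_⟩
  · exact continuous_const.mul (continuous_finsetSum _ fun m _ =>
      (hQ₀ m).comp (fourierCLM ℂ 𝓢(EuclideanSpace ℝ (Fin d), ℂ)).continuous)
  · have h0 : 𝓕 (0 : 𝓢(EuclideanSpace ℝ (Fin d), ℂ)) = 0 :=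
      (fourierCLM ℂ 𝓢(EuclideanSpace ℝ (Fin d), ℂ)).map_zero
    simp [h0, Q₀]
  · exact fun ψ => mul_nonneg C.2 (Finset.sum_nonneg fun m _ => hQ₀' m _)
  · intro j ψ
    have e : ψ - convTest (lowPass φ j) ψ = 𝓕⁻ (𝓕 ψ -
        pairing (ContinuousLinearMap.mul ℂ ℂ) (dilate (twoInv j) χ) (𝓕 ψ)) := by
      refine eq_of_fourier_eq ?_
      rw [FourierTransform.fourier_fourierInv_eq, fourier_sub,
        fourier_convTest, fourier_lowPass]
      congr 3
      ext ξ
      simp [hχdef, reflect_apply, dilate_apply]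
    rw [e]
    have h1 := hC (𝓕 ψ - pairing (ContinuousLinearMap.mul ℂ ℂ) (dilate (twoInv j) χ) (𝓕 ψ))
    have h2 : (s.sup (schwartzSeminormFamily ℂ (EuclideanSpace ℝ (Fin d)) ℂ))
        (𝓕 ψ - pairing (ContinuousLinearMap.mul ℂ ℂ) (dilate (twoInv j) χ) (𝓕 ψ)) ≤
        (∑ m ∈ s, Q₀ m (𝓕 ψ)) / 2 ^ (j * N) := by
      refine Seminorm.finset_sup_apply_le
        (div_nonneg (Finset.sum_nonneg fun m _ => hQ₀' m _) (by positivity)) fun m hm => ?_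
      rw [le_div_iff₀' (by positivity)]
      refine (seminorm_sub_dilate_mul_le hχ N m.1 m.2 j (𝓕 ψ)).trans ?_
      exact Finset.single_le_sum (f := fun m => Q₀ m (𝓕 ψ)) (fun m _ => hQ₀' m _) hm
    calc _ ≤ (2 : ℝ) ^ (j * N) * (C * ((∑ m ∈ s, Q₀ m (𝓕 ψ)) / 2 ^ (j * N))) := by
          gcongr
          exact h1.trans (mul_le_mul_of_nonneg_left h2 C.2)
      _ = _ := by field_simp

end TestFunctions

/-! ### Reproducing kernels -/

section Kernel

variable {d : ℕ} {φ : 𝓢(EuclideanSpace ℝ (Fin d), ℂ)}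

/-- The supremum is at most the `L¹`-norm of the Fourier transform, and undoing the dilation by
`2⁻ʲ` in dimension `d` costs `2 ^ (d * j)`. -/
theorem norm_lowPass_apply_le (φ : 𝓢(EuclideanSpace ℝ (Fin d), ℂ)) (j : ℕ)
    (x : EuclideanSpace ℝ (Fin d)) : ‖lowPass φ j x‖ ≤ (2 ^ d) ^ j * ∫ ξ, ‖𝓕 φ ξ‖ := by
  have h1 : ‖lowPass φ j x‖ ≤ ∫ ξ, ‖𝓕 φ (((2 : ℝ)⁻¹ ^ j) • ξ)‖ := by
    have h := norm_fourier_apply_le_toLp_one (dilate (twoInv j) (𝓕 φ)) (-x)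
    rw [norm_toLp_one] at h
    exact h
  refine h1.trans (le_of_eq ?_)
  have h2 := Measure.integral_comp_smul (volume : Measure (EuclideanSpace ℝ (Fin d)))
    (fun ξ => ‖𝓕 φ ξ‖) ((2 : ℝ)⁻¹ ^ j)
  rw [h2, finrank_euclideanSpace_fin, smul_eq_mul, abs_of_nonneg (by positivity)]
  congr 1
  rw [inv_pow, inv_pow, inv_inv, ← pow_mul, ← pow_mul, mul_comm]

theorem reflect_reflect (a : 𝓢(EuclideanSpace ℝ (Fin d), ℂ)) : reflect (reflect a) = a := by
  ext x
  simp [reflect_apply]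

theorem fourier_fourier (a : 𝓢(EuclideanSpace ℝ (Fin d), ℂ)) : 𝓕 (𝓕 a) = reflect a := by
  have h : reflect (𝓕 (𝓕 a)) = a := by
    rw [← fourierInv_eq_reflect]
    simp
  rw [← reflect_reflect (𝓕 (𝓕 a)), h]

theorem fourier_mul_apply (a b : 𝓢(EuclideanSpace ℝ (Fin d), ℂ))
    (ξ : EuclideanSpace ℝ (Fin d)) :
    𝓕 (pairing (ContinuousLinearMap.mul ℂ ℂ) a b) ξ = ∫ t, 𝓕 a t * 𝓕 b (ξ - t) := by
  have h : 𝓕 (pairing (ContinuousLinearMap.mul ℂ ℂ) a b) =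
      SchwartzMap.convolution (ContinuousLinearMap.mul ℂ ℂ) (𝓕 a) (𝓕 b) := by
    refine eq_of_fourier_eq ?_
    rw [fourier_convolution, fourier_fourier, fourier_fourier, fourier_fourier]
    rfl
  rw [h, SchwartzMap.convolution_apply]
  rfl

theorem apply_zero_eq_integral_fourier (φ : 𝓢(EuclideanSpace ℝ (Fin d), ℂ)) :
    φ 0 = ∫ ξ, 𝓕 φ ξ := by
  have h : 𝓕⁻ (𝓕 φ) = φ := by simp
  rw [← h, fourierInv_coe, Real.fourierInv_eq]
  simp

/-- The value is the integral of `φ̂`, a nonnegative continuous function equal to 1 at the origin.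
-/
theorem IsGenerator.apply_zero_ne_zero (hφ : IsGenerator φ) : φ 0 ≠ 0 := by
  intro h0
  rw [apply_zero_eq_integral_fourier] at h0
  have h1 : ∀ ξ, 𝓕 φ ξ = ((𝓕 φ ξ).re : ℂ) := fun ξ => by
    obtain ⟨t, -, ht⟩ := hφ.mem_Icc ξ
    rw [ht, Complex.ofReal_re]
  have h2 : ∫ ξ, (𝓕 φ ξ).re = 0 := by
    have h3 : ((∫ ξ, (𝓕 φ ξ).re : ℝ) : ℂ) = 0 := by
      rw [← h0, ← integral_complex_ofReal]
      exact integral_congr_ae (Filter.Eventually.of_forall fun ξ => (h1 ξ).symm)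
    exact_mod_cast h3
  have hnn : 0 ≤ fun ξ => (𝓕 φ ξ).re := fun ξ => by
    obtain ⟨t, ht, ht'⟩ := hφ.mem_Icc ξ
    simp [ht', ht.1]
  have hc : Continuous fun ξ => (𝓕 φ ξ).re := Complex.continuous_re.comp (𝓕 φ).continuous
  have hi : Integrable (fun ξ => (𝓕 φ ξ).re) :=
    (𝓕 φ).integrable.re
  have h4 := (integral_eq_zero_iff_of_nonneg hnn hi).1 h2
  have h5 := (Continuous.ae_eq_iff_eq volume hc continuous_zero).1 h4
  have h6 := congrFun h5 0
  simp [hφ.eq_one 0 (by simp)] at h6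

/-- A Schwartz function that reproduces the `k`-th Littlewood-Paley block and factors as a product
of two Schwartz functions. -/
noncomputable def kernel (φ : 𝓢(EuclideanSpace ℝ (Fin d), ℂ)) (k : ℕ) :
    𝓢(EuclideanSpace ℝ (Fin d), ℂ) :=
  pairing (ContinuousLinearMap.mul ℂ ℂ) ((φ 0)⁻¹ • φ) (lowPass φ (k + 2))

theorem kernel_apply (φ : 𝓢(EuclideanSpace ℝ (Fin d), ℂ)) (k : ℕ)
    (x : EuclideanSpace ℝ (Fin d)) :
    kernel φ k x = ((φ 0)⁻¹ • φ) x * lowPass φ (k + 2) x := rfl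

theorem IsGenerator.fourier_kernel_eq_one (hφ : IsGenerator φ) {k : ℕ}
    {ξ : EuclideanSpace ℝ (Fin d)} (h : 𝓕 (block φ k) ξ ≠ 0) : 𝓕 (kernel φ k) ξ = 1 := by
  have hξ : ‖ξ‖ < 3 / 2 * 2 ^ k := by
    by_contra! hcon
    exact h (hφ.fourier_block_eq_zero hcon)
  rw [kernel, fourier_mul_apply]
  have h1 : ∀ t, 𝓕 ((φ 0)⁻¹ • φ) t * 𝓕 (lowPass φ (k + 2)) (ξ - t) = (φ 0)⁻¹ * 𝓕 φ t := by
    intro t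
    rw [FourierTransform.fourier_smul, smul_apply, smul_eq_mul, mul_assoc]
    rcases lt_or_ge ‖t‖ (3 / 2) with ht | ht
    · rw [hφ.fourier_lowPass_eq_one, mul_one]
      -- Source of the index `k + 2`: both `ξ` and `t` are controlled by `3 / 2 * 2 ^ k`, and `3 * 2
      -- ^ k ≤ 2 ^ (k + 2)`. The low-pass factor is therefore 1 on the whole range of integration,
      -- leaving the integral of `φ̂`, which the factor `(φ 0)⁻¹` normalises.
      have h2 : (1 : ℝ) ≤ 2 ^ k := one_le_pow₀ one_le_two
      calc ‖ξ - t‖ ≤ ‖ξ‖ + ‖t‖ := norm_sub_le _ _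
        _ ≤ 3 / 2 * 2 ^ k + 3 / 2 := by gcongr
        _ ≤ 2 ^ (k + 2) := by rw [pow_add]; linarith
    · rw [hφ.eq_zero t ht, zero_mul]
  simp_rw [h1]
  rw [integral_const_mul, ← apply_zero_eq_integral_fourier,
    inv_mul_cancel₀ hφ.apply_zero_ne_zero]

theorem exists_kernel_bound (φ : 𝓢(EuclideanSpace ℝ (Fin d), ℂ)) :
    ∃ A : ℝ, 0 ≤ A ∧ ∀ k, (∀ x, ‖kernel φ k x‖ ≤ A * (2 ^ d) ^ k) ∧
      ∫ x, ‖kernel φ k x‖ ≤ A * (2 ^ d) ^ k := by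
  set b := (φ 0)⁻¹ • φ
  set L := ∫ ξ, ‖𝓕 φ ξ‖
  set S := SchwartzMap.seminorm ℂ 0 0 b + ∫ x, ‖b x‖
  have hL : 0 ≤ L := integral_nonneg fun _ => norm_nonneg _
  have hI : 0 ≤ ∫ x, ‖b x‖ := integral_nonneg fun _ => norm_nonneg _
  have hS0 : 0 ≤ SchwartzMap.seminorm ℂ 0 0 b := by positivity
  have h1 : ∀ k x, ‖kernel φ k x‖ ≤ ‖b x‖ * ((2 ^ d) ^ (k + 2) * L) := fun k x => by
    rw [kernel_apply, norm_mul]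
    gcongr
    exact norm_lowPass_apply_le φ _ x
  refine ⟨S * ((2 ^ d) ^ 2 * L), by positivity, fun k => ⟨fun x => ?_, ?_⟩⟩
  · calc _ ≤ _ := h1 k x
      _ ≤ S * ((2 ^ d) ^ (k + 2) * L) := by
        gcongr
        exact (SchwartzMap.norm_le_seminorm ℂ b x).trans (le_add_of_nonneg_right hI)
      _ = _ := by ring
  · calc _ ≤ ∫ x, ‖b x‖ * ((2 ^ d) ^ (k + 2) * L) :=
        integral_mono (kernel φ k).integrable.norm (b.integrable.norm.mul_const _) (h1 k)
      _ = (∫ x, ‖b x‖) * ((2 ^ d) ^ (k + 2) * L) := integral_mul_const _ _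
      _ ≤ S * ((2 ^ d) ^ (k + 2) * L) := by
        gcongr
        exact le_add_of_nonneg_left hS0
      _ = _ := by ring

/-- The product of two Schwartz functions is dominated by a nonnegative Schwartz function. -/
theorem exists_norm_mul_norm_le (a b : 𝓢(EuclideanSpace ℝ (Fin d), ℂ)) :
    ∃ Θ : 𝓢(EuclideanSpace ℝ (Fin d), ℂ), ∀ x, Θ x = ((‖Θ x‖ : ℝ) : ℂ) ∧
      ‖a x‖ * ‖b x‖ ≤ ‖Θ x‖ := by
  let cj : 𝓢(EuclideanSpace ℝ (Fin d), ℂ) → 𝓢(EuclideanSpace ℝ (Fin d), ℂ) :=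
    fun f => postcompCLM (𝕜 := ℝ) Complex.conjCLE.toContinuousLinearMap f
  have hcj : ∀ f : 𝓢(EuclideanSpace ℝ (Fin d), ℂ), ∀ x,
      pairing (ContinuousLinearMap.mul ℂ ℂ) f (cj f) x = ((‖f x‖ ^ 2 : ℝ) : ℂ) := fun f x => by
    have : pairing (ContinuousLinearMap.mul ℂ ℂ) f (cj f) x = f x * (starRingEnd ℂ) (f x) := rfl
    rw [this, Complex.mul_conj']
    push_cast
    rfl
  -- The product `‖a‖ * ‖b‖` need not be smooth, whereas `‖a‖ ^ 2 + ‖b‖ ^ 2` is a Schwartz function.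
  -- This is why the kernel is built as a product.
  let Θ : 𝓢(EuclideanSpace ℝ (Fin d), ℂ) := pairing (ContinuousLinearMap.mul ℂ ℂ) a (cj a) +
    pairing (ContinuousLinearMap.mul ℂ ℂ) b (cj b)
  have h : ∀ x, Θ x = ((‖a x‖ ^ 2 + ‖b x‖ ^ 2 : ℝ) : ℂ) := fun x => by
    have : Θ x = pairing (ContinuousLinearMap.mul ℂ ℂ) a (cj a) x +
      pairing (ContinuousLinearMap.mul ℂ ℂ) b (cj b) x := rfl
    rw [this, hcj, hcj]
    push_cast
    rfl
  have hn : ∀ x, ‖Θ x‖ = ‖a x‖ ^ 2 + ‖b x‖ ^ 2 := fun x => by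
    rw [h, Complex.norm_of_nonneg (by positivity)]
  refine ⟨Θ, fun x => ⟨by rw [hn, h], ?_⟩⟩
  rw [hn]
  nlinarith [sq_nonneg (‖a x‖ - ‖b x‖), norm_nonneg (a x), norm_nonneg (b x)]

/-- A compactly supported test function is dominated by a nonnegative Schwartz function. -/
theorem exists_norm_le_of_hasCompactSupport (ψ : 𝓢(EuclideanSpace ℝ (Fin d), ℂ))
    (hψ : HasCompactSupport ψ) :
    ∃ Ψ : 𝓢(EuclideanSpace ℝ (Fin d), ℂ), ∀ x, Ψ x = ((‖Ψ x‖ : ℝ) : ℂ) ∧ ‖ψ x‖ ≤ ‖Ψ x‖ := by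
  obtain ⟨R, hR0, hR⟩ := hψ.isCompact.isBounded.subset_closedBall_lt 0 0
  let f : ContDiffBump (0 : EuclideanSpace ℝ (Fin d)) := ⟨R, R + 1, hR0, by linarith⟩
  have hc : HasCompactSupport (Complex.ofRealCLM ∘ f) := f.hasCompactSupport.comp_left rfl
  have hs : ContDiff ℝ ((⊤ : ℕ∞) : WithTop ℕ∞) (Complex.ofRealCLM ∘ f) := by
    exact Complex.ofRealCLM.contDiff.comp (f.contDiff (n := ⊤))
  obtain ⟨Θ, hΘ⟩ := exists_norm_mul_norm_le ψ (hc.toSchwartzMap hs)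
  refine ⟨Θ, fun x => ⟨(hΘ x).1, ?_⟩⟩
  by_cases hx : x ∈ tsupport ψ
  · have h1 : (hc.toSchwartzMap hs) x = 1 := by
      simp [f.one_of_mem_closedBall (hR hx)]
    simpa [h1] using (hΘ x).2
  · rw [image_eq_zero_of_notMem_tsupport hx, norm_zero]
    exact norm_nonneg _

end Kernel

/-! ### The reproducing formula -/

section Reproducing

variable {d : ℕ} {F : Type*} [NormedAddCommGroup F] [NormedSpace ℂ F]
  {u : 𝓢'(EuclideanSpace ℝ (Fin d), F)} {g : EuclideanSpace ℝ (Fin d) → F}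
  {θ : 𝓢(EuclideanSpace ℝ (Fin d), ℂ)}

/-- Convolutions of tempered distributions with Schwartz functions grow at most polynomially. -/
theorem exists_norm_compSubConst_le (u : 𝓢'(EuclideanSpace ℝ (Fin d), F))
    (θ : 𝓢(EuclideanSpace ℝ (Fin d), ℂ)) :
    ∃ (N : ℕ) (A : ℝ), 0 ≤ A ∧ ∀ x, ‖u (compSubConstCLM ℂ x θ)‖ ≤ A * (1 + ‖x‖) ^ N := by
  have hP : Continuous ((normSeminorm ℂ F).comp
      (u : 𝓢(EuclideanSpace ℝ (Fin d), ℂ) →L[ℂ] F).toLinearMap) :=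
    continuous_norm.comp (u : 𝓢(EuclideanSpace ℝ (Fin d), ℂ) →L[ℂ] F).continuous
  obtain ⟨s, C, -, hC⟩ := Seminorm.bound_of_continuous
    (schwartz_withSeminorms ℂ (EuclideanSpace ℝ (Fin d)) ℂ) _ hP
  let N := s.sup Prod.fst
  let B : ℕ × ℕ → ℝ := fun m =>
    2 ^ m.1 * (Finset.Iic m).sup (fun m => SchwartzMap.seminorm ℂ m.1 m.2) θ
  have hB : ∀ m, 0 ≤ B m := fun m => by positivity
  refine ⟨N, C * ∑ m ∈ s, B m, mul_nonneg C.2 (Finset.sum_nonneg fun m _ => hB m), fun x => ?_⟩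
  refine (hC (compSubConstCLM ℂ x θ)).trans ?_
  rw [mul_assoc]
  refine mul_le_mul_of_nonneg_left ?_ C.2
  refine Seminorm.finset_sup_apply_le
    (mul_nonneg (Finset.sum_nonneg fun m _ => hB m) (by positivity)) fun m hm => ?_
  refine SchwartzMap.seminorm_le_bound ℂ _ _ _
    (mul_nonneg (Finset.sum_nonneg fun m _ => hB m) (by positivity)) fun y => ?_
  have e : ((compSubConstCLM ℂ x θ : 𝓢(EuclideanSpace ℝ (Fin d), ℂ)) :
      EuclideanSpace ℝ (Fin d) → ℂ) = fun z => θ (z + -x) := by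
    ext z
    rw [compSubConstCLM_apply, sub_eq_add_neg]
  rw [e, iteratedFDeriv_comp_add_right, ← sub_eq_add_neg]
  have h1 := SchwartzMap.one_add_le_sup_seminorm_apply (𝕜 := ℂ) (m := m) le_rfl le_rfl θ (y - x)
  -- Translation by `x` costs only powers of `1 + ‖x‖`, because this weight is submultiplicative.
  have h2 : ‖y‖ ≤ (1 + ‖x‖) * (1 + ‖y - x‖) := by
    have : ‖y‖ ≤ ‖x‖ + ‖y - x‖ := by simpa using norm_add_le x (y - x)
    nlinarith [norm_nonneg x, norm_nonneg (y - x)]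
  have h3 : (1 + ‖x‖) ^ m.1 ≤ (1 + ‖x‖) ^ N :=
    pow_le_pow_right₀ (by linarith [norm_nonneg x]) (Finset.le_sup (f := Prod.fst) hm)
  calc ‖y‖ ^ m.1 * ‖iteratedFDeriv ℝ m.2 θ (y - x)‖
      ≤ ((1 + ‖x‖) * (1 + ‖y - x‖)) ^ m.1 * ‖iteratedFDeriv ℝ m.2 θ (y - x)‖ := by gcongr
    _ = (1 + ‖x‖) ^ m.1 * ((1 + ‖y - x‖) ^ m.1 * ‖iteratedFDeriv ℝ m.2 θ (y - x)‖) := by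
        rw [mul_pow]; ring
    _ ≤ (1 + ‖x‖) ^ N * B m := by gcongr
    _ ≤ (1 + ‖x‖) ^ N * ∑ m ∈ s, B m := by
        gcongr
        exact Finset.single_le_sum (f := B) (fun m _ => hB m) hm
    _ = _ := mul_comm _ _

theorem IsRepresentedBy.integral_kernel_eq (hg : IsRepresentedBy u g)
    (θ : 𝓢(EuclideanSpace ℝ (Fin d), ℂ)) (x : EuclideanSpace ℝ (Fin d)) :
    ∫ y, θ (x - y) • g y = u (compSubConstCLM ℂ x (reflect θ)) := by
  rw [(hg.2 _).2]
  refine integral_congr_ae (Filter.Eventually.of_forall fun y => ?_)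
  simp [reflect_apply]

theorem IsRepresentedBy.aestronglyMeasurable_kernel (hg : IsRepresentedBy u g)
    (θ : 𝓢(EuclideanSpace ℝ (Fin d), ℂ)) :
    AEStronglyMeasurable (fun z : EuclideanSpace ℝ (Fin d) × EuclideanSpace ℝ (Fin d) =>
      θ (z.1 - z.2) • g z.2) (volume.prod volume) :=
  ((θ.continuous.comp (continuous_fst.sub continuous_snd)).aestronglyMeasurable).smul
    hg.1.comp_snd

/-- The reproducing formula: if `u = θ * u`, then the function representing `u` agrees with its
convolution with `θ`. -/
theorem IsRepresentedBy.ae_eq_integral_kernel [CompleteSpace F] (hg : IsRepresentedBy u g)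
    (hθ : ∀ ψ, u (convTest θ ψ) = u ψ) {Θ : 𝓢(EuclideanSpace ℝ (Fin d), ℂ)}
    (hΘ : ∀ x, Θ x = ((‖Θ x‖ : ℝ) : ℂ) ∧ ‖θ x‖ ≤ ‖Θ x‖) :
    g =ᵐ[volume] fun x => ∫ y, θ (x - y) • g y := by
  have hloc : LocallyIntegrable (fun x => ∫ y, θ (x - y) • g y) volume := by
    obtain ⟨N, A, hA, hb⟩ := exists_norm_compSubConst_le u (reflect θ)
    have hc : Continuous fun x : EuclideanSpace ℝ (Fin d) => A * (1 + ‖x‖) ^ N := by fun_prop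
    refine hc.locallyIntegrable.mono (hg.aestronglyMeasurable_kernel θ).integral_prod_right'
      (Filter.Eventually.of_forall fun x => ?_)
    rw [hg.integral_kernel_eq, Real.norm_of_nonneg (by positivity)]
    exact hb x
  refine ae_eq_of_integral_contDiff_smul_eq hg.locallyIntegrable hloc fun f hf hf' => ?_
  have hc : HasCompactSupport (Complex.ofRealCLM ∘ f) := hf'.comp_left rfl
  have hs : ContDiff ℝ ((⊤ : ℕ∞) : WithTop ℕ∞) (Complex.ofRealCLM ∘ f) := by fun_prop
  set ψ := hc.toSchwartzMap hs with hψ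
  have hψf : ∀ x, ψ x = (f x : ℂ) := fun x => rfl
  obtain ⟨Ψ, hΨ⟩ := exists_norm_le_of_hasCompactSupport ψ hc
  have hint : Integrable (fun z : EuclideanSpace ℝ (Fin d) × EuclideanSpace ℝ (Fin d) =>
      ψ z.1 • θ (z.1 - z.2) • g z.2) (volume.prod volume) := by
    have hmeas : AEStronglyMeasurable
        (fun z : EuclideanSpace ℝ (Fin d) × EuclideanSpace ℝ (Fin d) =>
          ψ z.1 • θ (z.1 - z.2) • g z.2) (volume.prod volume) := ((ψ.continuous.comp continuous_fst).aestronglyMeasurable).smul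
      (hg.aestronglyMeasurable_kernel θ)
    refine (integrable_prod_iff' hmeas).2 ⟨Filter.Eventually.of_forall fun y => ?_, ?_⟩
    · have h1 := (pairing (ContinuousLinearMap.mul ℂ ℂ) ψ
        (compSubConstCLM ℂ y θ)).integrable (μ := volume)
      refine (h1.smul_const (g y)).congr (Filter.Eventually.of_forall fun x => ?_)
      simp [mul_smul]
    -- The function `g` is only known to be integrable against Schwartz functions, and the
    -- convolution of `‖θ‖` with `‖ψ‖` need not be one. The majorants `Θ` and `Ψ` are nonnegative
    -- Schwartz functions, so `convTest Θ Ψ` is an admissible test function that dominates it.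
    · refine (hg.2 (convTest Θ Ψ)).1.mono hmeas.norm.prod_swap.integral_prod_right'
        (Filter.Eventually.of_forall fun y => ?_)
      have h1 : convTest Θ Ψ y = ((∫ x, ‖Θ (x - y)‖ * ‖Ψ x‖ : ℝ) : ℂ) := by
        rw [convTest_apply, ← integral_complex_ofReal]
        refine integral_congr_ae (Filter.Eventually.of_forall fun x => ?_)
        dsimp only
        rw [(hΘ (x - y)).1, (hΨ x).1]
        simp
      have h2 : ∫ x, ‖ψ x • θ (x - y) • g y‖ = (∫ x, ‖θ (x - y)‖ * ‖ψ x‖) * ‖g y‖ := by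
        rw [← integral_mul_const]
        refine integral_congr_ae (Filter.Eventually.of_forall fun x => ?_)
        simp only [norm_smul]
        ring
      have hI : ∀ a b : 𝓢(EuclideanSpace ℝ (Fin d), ℂ),
          Integrable (fun x => ‖a (x - y)‖ * ‖b x‖) := fun a b => by
        refine (pairing (ContinuousLinearMap.mul ℂ ℂ) (compSubConstCLM ℂ y a) b).integrable
          (μ := volume).norm.congr (Filter.Eventually.of_forall fun x => ?_)
        simp
      rw [h2, Real.norm_of_nonneg (mul_nonneg (integral_nonneg fun _ => by positivity)
        (norm_nonneg _)), norm_smul, h1, Complex.norm_of_nonneg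
        (integral_nonneg fun _ => by positivity)]
      refine mul_le_mul_of_nonneg_right ?_ (norm_nonneg _)
      refine integral_mono (hI θ ψ) (hI Θ Ψ) fun x => ?_
      exact mul_le_mul (hΘ _).2 (hΨ x).2 (norm_nonneg _) (norm_nonneg _)
  calc ∫ x, f x • g x = ∫ x, ψ x • g x := by
        refine integral_congr_ae (Filter.Eventually.of_forall fun x => ?_)
        simp [hψf]
    _ = u (convTest θ ψ) := by rw [hθ, (hg.2 ψ).2]
    _ = ∫ y, ∫ x, ψ x • θ (x - y) • g y := by
        rw [(hg.2 _).2]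
        refine integral_congr_ae (Filter.Eventually.of_forall fun y => ?_)
        dsimp only
        rw [convTest_apply, ← integral_smul_const]
        refine integral_congr_ae (Filter.Eventually.of_forall fun x => ?_)
        dsimp only
        rw [smul_smul, mul_comm]
    _ = ∫ x, ∫ y, ψ x • θ (x - y) • g y := (integral_integral_swap hint).symm
    _ = ∫ x, f x • ∫ y, θ (x - y) • g y := by
        refine integral_congr_ae (Filter.Eventually.of_forall fun x => ?_)
        dsimp only
        rw [integral_smul, hψf, Complex.coe_smul]

end Reproducing

/-! ### Nikolskii's inequality -/

section Nikolskii

variable {d : ℕ}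

/-- With `M = sup h w`, splitting `w γ` into powers `1 - p` and `p` gives `M ≤ C M ^ (1 - p) ∫ γ ^
p`; dividing by `M ^ (1 - p)` is legitimate because the a priori bound `M₀` makes `M` finite. The
function `h` is a representative of `γ` defined everywhere, so that a genuine supremum can be used.
-/
theorem mul_weight_le_of_reproducing {p : ℝ} (hp : 0 < p) (hp1 : p ≤ 1)
    {h γ ϑ w : EuclideanSpace ℝ (Fin d) → ℝ≥0∞} {C M₀ : ℝ≥0∞} (hC : C ≠ ⊤) (hM₀ : M₀ ≠ ⊤)
    (hγ : γ =ᵐ[volume] h) (hle : ∀ x, h x ≤ ∫⁻ y, ϑ (x - y) * γ y) (hw : ∀ x, w x ≤ 1)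
    (hϑ : ∀ x y, ϑ (x - y) * w x ≤ C * w y) (hM : ∀ x, h x * w x ≤ M₀)
    (x : EuclideanSpace ℝ (Fin d)) : h x * w x ≤ (C * ∫⁻ y, γ y ^ p) ^ (1 / p) := by
  set M := ⨆ x, h x * w x with hMdef
  have hMtop : M ≠ ⊤ := ne_top_of_le_ne_top hM₀ (iSup_le hM)
  have hMp : M ^ (1 - p) ≠ ⊤ := ENNReal.rpow_ne_top_of_nonneg (by linarith) hMtop
  have hbound : ∀ x, h x * w x ≤ C * (M ^ (1 - p) * ∫⁻ y, γ y ^ p) := by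
    intro x
    calc h x * w x ≤ (∫⁻ y, ϑ (x - y) * γ y) * w x := by gcongr; exact hle x
      _ = ∫⁻ y, ϑ (x - y) * γ y * w x :=
          (lintegral_mul_const' _ _ (ne_top_of_le_ne_top ENNReal.one_ne_top (hw x))).symm
      _ ≤ ∫⁻ y, C * (M ^ (1 - p) * γ y ^ p) := by
          refine lintegral_mono_ae ?_
          filter_upwards [hγ] with y hy
          have h1 : w y * γ y ≤ M ^ (1 - p) * γ y ^ p := by
            calc w y * γ y = (w y * γ y) ^ ((1 - p) + p) := by
                  rw [sub_add_cancel, ENNReal.rpow_one]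
              _ = (w y * γ y) ^ (1 - p) * (w y * γ y) ^ p :=
                  ENNReal.rpow_add_of_nonneg _ _ (by linarith) hp.le
              _ ≤ M ^ (1 - p) * γ y ^ p := by
                  refine mul_le_mul' (ENNReal.rpow_le_rpow ?_ (by linarith))
                    (ENNReal.rpow_le_rpow ?_ hp.le)
                  · rw [hy, mul_comm]
                    exact le_iSup (fun x => h x * w x) y
                  · exact mul_le_of_le_one_left zero_le (hw y)
          calc ϑ (x - y) * γ y * w x = ϑ (x - y) * w x * γ y := by ring
            _ ≤ C * w y * γ y := mul_le_mul' (hϑ x y) le_rfl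
            _ ≤ _ := by rw [mul_assoc]; gcongr
      _ = C * (M ^ (1 - p) * ∫⁻ y, γ y ^ p) := by
          rw [lintegral_const_mul' _ _ hC, lintegral_const_mul' _ _ hMp]
  refine (le_iSup (fun x => h x * w x) x).trans ?_
  change M ≤ _
  rcases eq_or_ne M 0 with h0 | h0
  · rw [h0]; exact zero_le
  have h1 : M ^ p * M ^ (1 - p) ≤ C * (∫⁻ y, γ y ^ p) * M ^ (1 - p) := by
    rw [← ENNReal.rpow_add _ _ h0 hMtop, add_sub_cancel, ENNReal.rpow_one]
    refine (iSup_le hbound).trans (le_of_eq ?_)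
    ring
  have h2 : M ^ p ≤ C * ∫⁻ y, γ y ^ p :=
    (ENNReal.mul_le_mul_iff_left (by simp [ENNReal.rpow_eq_zero_iff, h0, hMtop]) hMp).1 h1
  calc M = (M ^ p) ^ (1 / p) := by
        rw [← ENNReal.rpow_mul, mul_one_div_cancel hp.ne', ENNReal.rpow_one]
    _ ≤ _ := ENNReal.rpow_le_rpow h2 (by positivity)

variable {F : Type*} [NormedAddCommGroup F] [NormedSpace ℂ F]
  {u : 𝓢'(EuclideanSpace ℝ (Fin d), F)} {g : EuclideanSpace ℝ (Fin d) → F}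
  {θ : 𝓢(EuclideanSpace ℝ (Fin d), ℂ)}

theorem enorm_integral_kernel_le (θ : 𝓢(EuclideanSpace ℝ (Fin d), ℂ))
    (g : EuclideanSpace ℝ (Fin d) → F) (x : EuclideanSpace ℝ (Fin d)) :
    ‖∫ y, θ (x - y) • g y‖ₑ ≤ ∫⁻ y, ‖θ (x - y)‖ₑ * ‖g y‖ₑ := by
  refine (enorm_integral_le_lintegral_enorm _).trans (le_of_eq ?_)
  simp_rw [enorm_smul]

/-- The argument of `mul_weight_le_of_reproducing` needs a finite supremum, but a priori `g` is only
known to grow polynomially. A first pass with decaying weights proves boundedness; a second pass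
with weight 1 yields the constant in terms of `S` alone. -/
theorem IsRepresentedBy.ae_enorm_le_of_le_one [CompleteSpace F] (hg : IsRepresentedBy u g)
    (hθ : ∀ ψ, u (convTest θ ψ) = u ψ) {Θ : 𝓢(EuclideanSpace ℝ (Fin d), ℂ)}
    (hΘ : ∀ x, Θ x = ((‖Θ x‖ : ℝ) : ℂ) ∧ ‖θ x‖ ≤ ‖Θ x‖) {p : ℝ} (hp : 0 < p) (hp1 : p ≤ 1)
    (hfin : lpnn p volume (fun x => ‖g x‖ₑ) ≠ ⊤) {S : ℝ} (hS : ∀ x, ‖θ x‖ ≤ S) :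
    ∀ᵐ x, ‖g x‖ₑ ≤ ENNReal.ofReal S ^ (1 / p) * lpnn p volume fun x => ‖g x‖ₑ := by
  have hrep := hg.ae_eq_integral_kernel hθ hΘ
  set gt : EuclideanSpace ℝ (Fin d) → F := fun x => ∫ y, θ (x - y) • g y with hgt
  have hγ : (fun x => ‖g x‖ₑ) =ᵐ[volume] fun x => ‖gt x‖ₑ := by
    filter_upwards [hrep] with x hx
    rw [hx]
  have hle := enorm_integral_kernel_le θ g
  set I := ∫⁻ y, ‖g y‖ₑ ^ p with hI
  have hItop : I ≠ ⊤ := by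
    rw [hI, ← lpnn_rpow hp]
    exact ENNReal.rpow_ne_top_of_nonneg hp.le hfin
  obtain ⟨N, A, hA, hgrowth⟩ := exists_norm_compSubConst_le u (reflect θ)
  have hgrowth' : ∀ x, ‖gt x‖ ≤ A * (1 + ‖x‖) ^ N := fun x => by
    rw [hgt]
    dsimp only
    rw [hg.integral_kernel_eq]
    exact hgrowth x
  set CN : ℝ := 2 ^ N * (Finset.Iic (N, 0)).sup (fun m => SchwartzMap.seminorm ℂ m.1 m.2) θ
  have hCN : ∀ z, (1 + ‖z‖) ^ N * ‖θ z‖ ≤ CN := fun z => by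
    have := SchwartzMap.one_add_le_sup_seminorm_apply (𝕜 := ℂ) (m := (N, 0)) (k := N) (n := 0)
      le_rfl le_rfl θ z
    rwa [norm_iteratedFDeriv_zero] at this
  have hCN0 : 0 ≤ CN := (by positivity : 0 ≤ (1 + ‖(0 : EuclideanSpace ℝ (Fin d))‖) ^ N *
    ‖θ 0‖).trans (hCN 0)
  set B := (ENNReal.ofReal CN * I) ^ (1 / p)
  have hBtop : B ≠ ⊤ :=
    ENNReal.rpow_ne_top_of_nonneg (by positivity) (ENNReal.mul_ne_top ENNReal.ofReal_ne_top hItop)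
  -- The power `N` matches the growth of `gt`, so the weighted supremum is finite for every `ε`. The
  -- bound `B` does not depend on `ε`, and `ε → 0` removes the weight.
  have hweight : ∀ ε : ℝ, 0 < ε → ε ≤ 1 → ∀ x,
      ‖gt x‖ₑ * ENNReal.ofReal (((1 + ε * ‖x‖) ^ N)⁻¹) ≤ B := by
    intro ε hε hε1
    refine mul_weight_le_of_reproducing hp hp1 (ϑ := fun z => ‖θ z‖ₑ)
      (w := fun x => ENNReal.ofReal (((1 + ε * ‖x‖) ^ N)⁻¹)) (C := ENNReal.ofReal CN)
      ENNReal.ofReal_ne_top (M₀ := ENNReal.ofReal (A * (ε⁻¹) ^ N)) ENNReal.ofReal_ne_top hγ hle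
      (fun x => ?_) (fun x y => ?_) (fun x => ?_)
    · rw [← ENNReal.ofReal_one]
      refine ENNReal.ofReal_le_ofReal (inv_le_one_of_one_le₀ (one_le_pow₀ ?_))
      nlinarith [norm_nonneg x]
    · rw [← ofReal_norm, ← ENNReal.ofReal_mul (norm_nonneg _), ← ENNReal.ofReal_mul hCN0]
      refine ENNReal.ofReal_le_ofReal ?_
      rw [← div_eq_mul_inv, ← div_eq_mul_inv, div_le_div_iff₀ (by positivity) (by positivity)]
      have h1 : 1 + ε * ‖y‖ ≤ (1 + ε * ‖x‖) * (1 + ‖x - y‖) := by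
        have h2 : ‖y‖ ≤ ‖x‖ + ‖x - y‖ := by
          have := norm_sub_le x (x - y)
          simpa using this
        have h3 : ε * ‖y‖ ≤ ε * (‖x‖ + ‖x - y‖) := by gcongr
        have h4 : ε * ‖x - y‖ ≤ ‖x - y‖ := mul_le_of_le_one_left (norm_nonneg _) hε1
        have h5 : 0 ≤ ε * ‖x‖ * ‖x - y‖ := by positivity
        nlinarith
      calc ‖θ (x - y)‖ * (1 + ε * ‖y‖) ^ N
          ≤ ‖θ (x - y)‖ * ((1 + ε * ‖x‖) * (1 + ‖x - y‖)) ^ N := by gcongr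
        _ = ((1 + ‖x - y‖) ^ N * ‖θ (x - y)‖) * (1 + ε * ‖x‖) ^ N := by rw [mul_pow]; ring
        _ ≤ CN * (1 + ε * ‖x‖) ^ N := by gcongr; exact hCN _
    · rw [← ofReal_norm, ← ENNReal.ofReal_mul (norm_nonneg _)]
      refine ENNReal.ofReal_le_ofReal ?_
      rw [← div_eq_mul_inv, div_le_iff₀ (by positivity)]
      refine (hgrowth' x).trans ?_
      rw [mul_assoc, ← mul_pow]
      gcongr
      rw [mul_add, mul_one, ← mul_assoc, inv_mul_cancel₀ hε.ne', one_mul]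
      have : 1 ≤ ε⁻¹ := (one_le_inv₀ hε).2 hε1
      linarith
  have hbdd : ∀ x, ‖gt x‖ₑ ≤ B := by
    intro x
    have hlim : Filter.Tendsto (fun n : ℕ => ‖gt x‖ₑ *
        ENNReal.ofReal (((1 + (1 / ((n : ℝ) + 1)) * ‖x‖) ^ N)⁻¹)) Filter.atTop
        (nhds (‖gt x‖ₑ * ENNReal.ofReal (((1 + 0 * ‖x‖) ^ N)⁻¹))) := by
      refine ENNReal.Tendsto.const_mul ((ENNReal.continuous_ofReal.tendsto _).comp ?_)
        (.inr enorm_ne_top)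
      refine Filter.Tendsto.inv₀ ?_ (by simp)
      exact ((tendsto_one_div_add_atTop_nhds_zero_nat.mul_const _).const_add 1).pow N
    have h1 := le_of_tendsto' hlim fun n => hweight (1 / ((n : ℝ) + 1)) (by positivity)
      (by rw [div_le_one (by positivity)]; linarith [(Nat.cast_nonneg n : (0 : ℝ) ≤ n)]) x
    simpa using h1
  -- The second pass: `B` depends on `u` through `N` and serves only as the finite a priori bound.
  have hfinal := mul_weight_le_of_reproducing hp hp1 (ϑ := fun z => ‖θ z‖ₑ) (w := fun _ => 1)
    (C := ENNReal.ofReal S) ENNReal.ofReal_ne_top hBtop hγ hle (fun _ => le_rfl)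
    (fun x y => by
      rw [← ofReal_norm]
      simpa using ENNReal.ofReal_le_ofReal (hS (x - y)))
    (fun x => by simpa using hbdd x)
  filter_upwards [hγ] with x hx
  rw [hx]
  have := hfinal x
  rwa [mul_one, ENNReal.mul_rpow_of_nonneg _ _ (by positivity)] at this

/-- Instead of Hölder with the conjugate exponent, values of `‖g‖ₑ` below and above its norm `l` are
treated separately: the first meet the `L¹`-bound of the kernel, the second its supremum bound. -/
theorem IsRepresentedBy.ae_enorm_le_of_one_le [CompleteSpace F] (hg : IsRepresentedBy u g)
    (hθ : ∀ ψ, u (convTest θ ψ) = u ψ) {Θ : 𝓢(EuclideanSpace ℝ (Fin d), ℂ)}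
    (hΘ : ∀ x, Θ x = ((‖Θ x‖ : ℝ) : ℂ) ∧ ‖θ x‖ ≤ ‖Θ x‖) {p : ℝ} (hp1 : 1 ≤ p)
    (hfin : lpnn p volume (fun x => ‖g x‖ₑ) ≠ ⊤) {S : ℝ} (hS : ∀ x, ‖θ x‖ ≤ S)
    (hS1 : ∫ x, ‖θ x‖ ≤ S) :
    ∀ᵐ x, ‖g x‖ₑ ≤ 2 * ENNReal.ofReal S * lpnn p volume fun x => ‖g x‖ₑ := by
  have hp : 0 < p := by linarith
  set l := lpnn p volume fun x => ‖g x‖ₑ with hl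
  have hmeas : AEMeasurable fun x => ‖g x‖ₑ := hg.1.enorm
  rcases eq_or_ne l 0 with h0 | h0
  · have h1 : ∫⁻ x, ‖g x‖ₑ ^ p = 0 := by
      rw [← lpnn_rpow hp, ← hl, h0, ENNReal.zero_rpow_of_pos hp]
    rw [lintegral_eq_zero_iff' (hmeas.pow_const p)] at h1
    filter_upwards [h1] with x hx
    have : ‖g x‖ₑ = 0 := by simpa [ENNReal.rpow_eq_zero_iff, hp, hp.le] using hx
    rw [this]
    exact zero_le
  -- For `t ≥ l` one has `t = t ^ (1 - p) * t ^ p ≤ l ^ (1 - p) * t ^ p`, since `1 - p ≤ 0`.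
  have hpt : ∀ t : ℝ≥0∞, t ≤ l + l ^ (1 - p) * t ^ p := by
    intro t
    rcases le_total t l with h | h
    · exact h.trans le_self_add
    · refine le_trans ?_ le_add_self
      rcases eq_or_ne t ⊤ with rfl | ht
      · rw [ENNReal.top_rpow_of_pos hp, ENNReal.mul_top]
        simp [ENNReal.rpow_eq_zero_iff, h0, hfin]
      · have ht0 : t ≠ 0 := fun h' => h0 (le_zero_iff.1 (h.trans h'.le))
        calc t = t ^ (1 - p) * t ^ p := by
              rw [← ENNReal.rpow_add _ _ ht0 ht, sub_add_cancel, ENNReal.rpow_one]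
          _ ≤ _ := by
              gcongr ?_ * _
              rw [← neg_sub, ENNReal.rpow_neg, ENNReal.rpow_neg, ENNReal.inv_le_inv]
              exact ENNReal.rpow_le_rpow h (by linarith)
  have hlp : l ^ (1 - p) ≠ ⊤ := by simp [ENNReal.rpow_eq_top_iff, h0, hfin]
  filter_upwards [hg.ae_eq_integral_kernel hθ hΘ] with x hx
  rw [hx]
  refine (enorm_integral_kernel_le θ g x).trans ?_
  have hθm : Measurable fun y => ‖θ (x - y)‖ₑ :=
    ((θ.continuous.comp (continuous_const.sub continuous_id)).measurable).enorm
  have hθ1 : ∫⁻ y, ‖θ (x - y)‖ₑ ≤ ENNReal.ofReal S := by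
    rw [lintegral_sub_left_eq_self (fun z => ‖θ z‖ₑ) x]
    rw [← ofReal_integral_norm_eq_lintegral_enorm θ.integrable]
    exact ENNReal.ofReal_le_ofReal hS1
  have hθS : ∀ z, ‖θ z‖ₑ ≤ ENNReal.ofReal S := fun z => by
    rw [← ofReal_norm]
    exact ENNReal.ofReal_le_ofReal (hS z)
  calc ∫⁻ y, ‖θ (x - y)‖ₑ * ‖g y‖ₑ
      ≤ ∫⁻ y, (‖θ (x - y)‖ₑ * l + ENNReal.ofReal S * (l ^ (1 - p) * ‖g y‖ₑ ^ p)) := by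
        refine lintegral_mono fun y => ?_
        refine (mul_le_mul_right (hpt _) _).trans ?_
        rw [mul_add]
        gcongr
        exact hθS _
    _ = (∫⁻ y, ‖θ (x - y)‖ₑ) * l + ENNReal.ofReal S * (l ^ (1 - p) * l ^ p) := by
        rw [lintegral_add_left (hθm.mul_const l), lintegral_mul_const _ hθm,
          lintegral_const_mul' _ _ ENNReal.ofReal_ne_top, lintegral_const_mul' _ _ hlp,
          hl, lpnn_rpow hp]
    _ ≤ ENNReal.ofReal S * l + ENNReal.ofReal S * l := by
        gcongr
        rw [← ENNReal.rpow_add _ _ h0 hfin, sub_add_cancel, ENNReal.rpow_one]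
    _ = _ := by ring

variable {φ : 𝓢(EuclideanSpace ℝ (Fin d), ℂ)}

variable (F) in
/-- Nikolskii's inequality for the Littlewood-Paley blocks, with constants that grow at most
exponentially. -/
theorem IsGenerator.exists_ae_enorm_block_le [CompleteSpace F] (hφ : IsGenerator φ) {p : ℝ}
    (hp : 0 < p) :
    ∃ (A : ℝ≥0) (M : ℕ), ∀ (f : 𝓢'(EuclideanSpace ℝ (Fin d), F)) (k : ℕ)
      (g : EuclideanSpace ℝ (Fin d) → F), IsRepresentedBy (conv (block φ k) f) g →
      lpnn p volume (fun x => ‖g x‖ₑ) ≠ ⊤ →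
      ∀ᵐ x, ‖g x‖ₑ ≤ A * 2 ^ (k * M) * lpnn p volume fun x => ‖g x‖ₑ := by
  obtain ⟨S, hS0, hS⟩ := exists_kernel_bound φ
  obtain ⟨m, hm⟩ := exists_nat_ge (1 / p)
  have hconst : ∀ k, (ENNReal.ofReal (S * (2 ^ d) ^ k)) =
      ENNReal.ofReal S * 2 ^ (d * k) := fun k => by
    rw [ENNReal.ofReal_mul hS0, ← pow_mul, ENNReal.ofReal_pow two_pos.le]
    simp
  have hA : ENNReal.ofReal S ^ (1 / p) + 2 * ENNReal.ofReal S ≠ ⊤ :=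
    ENNReal.add_ne_top.2 ⟨ENNReal.rpow_ne_top_of_nonneg (by positivity) ENNReal.ofReal_ne_top,
      ENNReal.mul_ne_top (by simp) ENNReal.ofReal_ne_top⟩
  -- The growth in `k` is `2 ^ (d * k / p)` for `p ≤ 1` and `2 ^ (d * k)` for `p ≥ 1`. With `1 / p ≤
  -- m`, the exponent `d * (m + 1)` covers both, as the sum of the two constants does for the
  -- prefactors.
  refine ⟨(ENNReal.ofReal S ^ (1 / p) + 2 * ENNReal.ofReal S).toNNReal, d * (m + 1),
    fun f k g hg hfin => ?_⟩
  rw [ENNReal.coe_toNNReal hA]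
  have hθ : ∀ ψ, conv (block φ k) f (convTest (kernel φ k) ψ) = conv (block φ k) f ψ := fun ψ => by
    rw [conv_apply_eq, conv_apply_eq,
      convTest_convTest_of_eq_one fun ξ h => hφ.fourier_kernel_eq_one h]
  obtain ⟨Θ, hΘ⟩ := exists_norm_mul_norm_le ((φ 0)⁻¹ • φ) (lowPass φ (k + 2))
  have hΘ' : ∀ x, Θ x = ((‖Θ x‖ : ℝ) : ℂ) ∧ ‖kernel φ k x‖ ≤ ‖Θ x‖ := fun x =>
    ⟨(hΘ x).1, by rw [kernel_apply, norm_mul]; exact (hΘ x).2⟩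
  rcases le_total p 1 with hp1 | hp1
  · filter_upwards [hg.ae_enorm_le_of_le_one hθ hΘ' hp hp1 hfin (hS k).1] with x hx
    refine hx.trans ?_
    gcongr ?_ * _
    rw [hconst, ENNReal.mul_rpow_of_nonneg _ _ (by positivity)]
    refine mul_le_mul' le_self_add ?_
    rw [← ENNReal.rpow_natCast, ← ENNReal.rpow_mul, ← ENNReal.rpow_natCast]
    refine ENNReal.rpow_le_rpow_of_exponent_le one_le_two ?_
    push_cast
    calc (d : ℝ) * k * (1 / p) ≤ d * k * m := by gcongr
      _ ≤ k * (d * (m + 1)) := by nlinarith [(by positivity : (0 : ℝ) ≤ d * k)]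
  · filter_upwards [hg.ae_enorm_le_of_one_le hθ hΘ' hp1 hfin (hS k).1 (hS k).2] with x hx
    refine hx.trans ?_
    gcongr ?_ * _
    rw [hconst, ← mul_assoc]
    refine mul_le_mul' le_add_self ?_
    refine pow_le_pow_right₀ one_le_two ?_
    calc d * k ≤ d * k * (m + 1) := Nat.le_mul_of_pos_right _ (by omega)
      _ = _ := by ring

end Nikolskii

/-! ### The Besov space embeds into the tempered distributions -/

section Embedding

variable {d : ℕ} {φ : 𝓢(EuclideanSpace ℝ (Fin d), ℂ)}

/-- The `L¹`-norm as a seminorm on Schwartz functions. -/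
noncomputable def seminormL1 (d : ℕ) : Seminorm ℂ 𝓢(EuclideanSpace ℝ (Fin d), ℂ) :=
  (normSeminorm ℂ (Lp ℂ 1 (volume : Measure (EuclideanSpace ℝ (Fin d))))).comp
    (toLpCLM ℂ ℂ 1 volume).toLinearMap

theorem seminormL1_apply (ψ : 𝓢(EuclideanSpace ℝ (Fin d), ℂ)) :
    seminormL1 d ψ = ∫ x, ‖ψ x‖ :=
  norm_toLp_one

theorem continuous_seminormL1 : Continuous (seminormL1 d) :=
  continuous_norm.comp (toLpCLM ℂ ℂ 1 volume).continuous

theorem lintegral_enorm_eq_seminormL1 (ψ : 𝓢(EuclideanSpace ℝ (Fin d), ℂ)) :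
    ∫⁻ x, ‖ψ x‖ₑ = ENNReal.ofReal (seminormL1 d ψ) := by
  rw [seminormL1_apply, ofReal_integral_norm_eq_lintegral_enorm ψ.integrable]

variable {F : Type*} [NormedAddCommGroup F] [NormedSpace ℂ F]

theorem IsRepresentedBy.enorm_apply_le {u : 𝓢'(EuclideanSpace ℝ (Fin d), F)}
    {g : EuclideanSpace ℝ (Fin d) → F} (hg : IsRepresentedBy u g) {c : ℝ≥0∞}
    (hc : ∀ᵐ x, ‖g x‖ₑ ≤ c) (ψ : 𝓢(EuclideanSpace ℝ (Fin d), ℂ)) :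
    ‖u ψ‖ₑ ≤ ENNReal.ofReal (seminormL1 d ψ) * c := by
  rw [(hg.2 ψ).2, ← lintegral_enorm_eq_seminormL1,
    ← lintegral_mul_const _ ψ.continuous.measurable.enorm]
  refine (enorm_integral_le_lintegral_enorm _).trans (lintegral_mono_ae ?_)
  filter_upwards [hc] with x hx
  rw [enorm_smul]
  gcongr

theorem IsGenerator.tendsto_convTest_lowPass (hφ : IsGenerator φ)
    (f : 𝓢'(EuclideanSpace ℝ (Fin d), F)) (ψ : 𝓢(EuclideanSpace ℝ (Fin d), ℂ)) :
    Filter.Tendsto (fun m => f (convTest (lowPass φ m) ψ)) Filter.atTop (nhds (f ψ)) := by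
  have hP : Continuous ((normSeminorm ℂ F).comp
      (f : 𝓢(EuclideanSpace ℝ (Fin d), ℂ) →L[ℂ] F).toLinearMap) :=
    continuous_norm.comp (f : 𝓢(EuclideanSpace ℝ (Fin d), ℂ) →L[ℂ] F).continuous
  obtain ⟨Q, -, -, -, hQ⟩ := hφ.exists_seminorm_sub_convTest_le _ hP 1
  rw [tendsto_iff_norm_sub_tendsto_zero]
  refine squeeze_zero (fun _ => norm_nonneg _) (g := fun m : ℕ => Q ψ * (1 / 2) ^ m)
    (fun m => ?_) ?_
  · have h := hQ m ψ
    rw [mul_one] at h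
    rw [norm_sub_rev, one_div, inv_pow, ← div_eq_mul_inv, le_div_iff₀' (by positivity), ← map_sub]
    exact h
  · simpa using (tendsto_pow_atTop_nhds_zero_of_lt_one (r := (1 / 2 : ℝ)) (by norm_num)
      (by norm_num)).const_mul (Q ψ)

theorem IsGenerator.enorm_apply_le_tsum (hφ : IsGenerator φ)
    (f : 𝓢'(EuclideanSpace ℝ (Fin d), F)) (ψ : 𝓢(EuclideanSpace ℝ (Fin d), ℂ)) :
    ‖f ψ‖ₑ ≤ ∑' k, ‖conv (block φ k) f ψ‖ₑ := by
  refine le_of_tendsto' (hφ.tendsto_convTest_lowPass f ψ).enorm fun m => ?_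
  rw [← sum_convTest_block, map_sum]
  exact (enorm_sum_le _ _).trans (ENNReal.sum_le_tsum _)

theorem ennreal_ofReal_le_mul_inv_two_pow {a b : ℝ} {n : ℕ} (h : 2 ^ n * a ≤ b) :
    ENNReal.ofReal a ≤ ENNReal.ofReal b * (2 ^ n)⁻¹ := by
  rw [← div_eq_mul_inv, ENNReal.le_div_iff_mul_le (by simp) (by simp)]
  have e : (2 : ℝ≥0∞) ^ n = ENNReal.ofReal (2 ^ n) := by
    rw [ENNReal.ofReal_pow two_pos.le]; simp
  rw [e, mul_comm, ← ENNReal.ofReal_mul (by positivity)]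
  exact ENNReal.ofReal_le_ofReal h

/-- The action of the blocks only involves the high-frequency parts of the test functions. -/
theorem IsGenerator.exists_block_apply_eq (hφ : IsGenerator φ) (N : ℕ) :
    ∃ Q : 𝓢(EuclideanSpace ℝ (Fin d), ℂ) → ℝ, Continuous Q ∧ Q 0 = 0 ∧ (∀ ψ, 0 ≤ Q ψ) ∧
      ∀ (k : ℕ) (ψ : 𝓢(EuclideanSpace ℝ (Fin d), ℂ)), ∃ η, 2 ^ (k * N) * seminormL1 d η ≤ Q ψ ∧
        convTest (block φ k) η = convTest (block φ k) ψ := by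
  obtain ⟨Q, hQc, hQ0, hQn, hQ⟩ := hφ.exists_seminorm_sub_convTest_le _ continuous_seminormL1 N
  -- For `k ≥ 2` the frequencies passed by `lowPass φ (k - 2)` can be removed from `ψ` unnoticed by
  -- the block. The factor `2 ^ (2 * N)` pays for this shift by 2, and for taking `η = ψ` when `k <
  -- 2`.
  refine ⟨fun ψ => 2 ^ (2 * N) * (Q ψ + seminormL1 d ψ), ?_, ?_, fun ψ => ?_, fun k ψ => ?_⟩
  · exact continuous_const.mul (hQc.add continuous_seminormL1)
  · simp [hQ0]
  · exact mul_nonneg (by positivity) (add_nonneg (hQn ψ) (apply_nonneg _ _))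
  · have hψ : 0 ≤ seminormL1 d ψ := apply_nonneg _ _
    rcases lt_or_ge k 2 with hk | hk
    · refine ⟨ψ, ?_, rfl⟩
      refine mul_le_mul (pow_le_pow_right₀ one_le_two ?_) (by linarith [hQn ψ]) hψ (by positivity)
      exact Nat.mul_le_mul_right N hk.le
    · obtain ⟨j, rfl⟩ := Nat.exists_eq_add_of_le' hk
      refine ⟨ψ - convTest (lowPass φ j) ψ, ?_, ?_⟩
      · rw [add_mul, pow_add, mul_comm (2 ^ (j * N)), mul_assoc]
        refine mul_le_mul_of_nonneg_left ((hQ j ψ).trans (by linarith)) (by positivity)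
      · rw [map_sub, convTest_convTest_of_mul_eq_zero (hφ.fourier_block_mul_lowPass j), sub_zero]

variable (F) in
/-- The Besov space is continuously embedded into the tempered distributions. -/
theorem IsGenerator.exists_enorm_apply_le [CompleteSpace F] (hφ : IsGenerator φ) (σ : ℝ)
    {p q : ℝ} (hp : 0 < p) (hq : 0 < q) :
    ∃ Q : 𝓢(EuclideanSpace ℝ (Fin d), ℂ) → ℝ, Continuous Q ∧ Q 0 = 0 ∧ (∀ ψ, 0 ≤ Q ψ) ∧
      ∀ f ∈ besovSpace F φ σ p hq, ∀ ψ, ‖f ψ‖ₑ ≤ ENNReal.ofReal (Q ψ) * besovNorm φ σ p q f := by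
  obtain ⟨A, M, hAM⟩ := hφ.exists_ae_enorm_block_le F hp
  obtain ⟨s, hs⟩ := exists_nat_ge (-σ)
  -- The required decay: `M` compensates Nikolskii's factor, `s` the weight `2 ^ (k * σ)` when `σ`
  -- is negative, and 1 leaves a convergent geometric series.
  obtain ⟨Q, hQc, hQ0, hQn, hQ⟩ := hφ.exists_block_apply_eq (M + s + 1)
  refine ⟨fun ψ => 2 * A * Q ψ, by fun_prop, by simp [hQ0],
    fun ψ => mul_nonneg (by positivity) (hQn ψ), fun f hf ψ => ?_⟩
  obtain ⟨g, hg⟩ := exists_blocksRepresentedBy hq hf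
  set B := besovNorm φ σ p q f
  have hterm : ∀ k, ‖conv (block φ k) f ψ‖ₑ ≤ A * ENNReal.ofReal (Q ψ) * B * 2⁻¹ ^ k := by
    intro k
    obtain ⟨η, hη, hηψ⟩ := hQ k ψ
    set l := lpnn p volume fun x => ‖g k x‖ₑ with hl
    have hlB : weight σ k * l ≤ B := by
      have := weight_mul_distLpNorm_le (φ := φ) (σ := σ) (p := p) hq f k
      rwa [(hg.isRepresentedBy k).distLpNorm_eq hp] at this
    have hl1 : l ≤ 2 ^ (k * s) * B := by
      calc l ≤ 2 ^ (k * s) * (weight σ k * l) := by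
            rw [← mul_assoc]
            refine le_mul_of_one_le_left zero_le ?_
            rw [weight, show (2 : ℝ≥0∞) ^ (k * s) = ENNReal.ofReal ((2 : ℝ) ^ ((k : ℝ) * s)) by
              rw [← Nat.cast_mul, Real.rpow_natCast, ENNReal.ofReal_pow two_pos.le]; simp,
              ← ENNReal.ofReal_mul (by positivity), ← Real.rpow_add two_pos, ← mul_add]
            rw [← ENNReal.ofReal_one]
            refine ENNReal.ofReal_le_ofReal (Real.one_le_rpow one_le_two ?_)
            exact mul_nonneg (by positivity) (by linarith)
        _ ≤ _ := by gcongr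
    have hltop : l ≠ ⊤ := ne_top_of_le_ne_top
      (ENNReal.mul_ne_top (by simp) (ne_of_lt hf)) hl1
    have h1 := (hg.isRepresentedBy k).enorm_apply_le
      (hAM f k (g k) (hg.isRepresentedBy k) hltop) η
    rw [conv_apply_eq, hηψ, ← conv_apply_eq] at h1
    calc ‖conv (block φ k) f ψ‖ₑ
        ≤ (ENNReal.ofReal (Q ψ) * (2 ^ (k * (M + s + 1)))⁻¹) *
          (A * 2 ^ (k * M) * (2 ^ (k * s) * B)) := by
          refine h1.trans (mul_le_mul' (ennreal_ofReal_le_mul_inv_two_pow hη) ?_)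
          gcongr
      _ = A * ENNReal.ofReal (Q ψ) * B * ((2 ^ (k * (M + s + 1)))⁻¹ * 2 ^ (k * (M + s))) := by
          rw [mul_add k M s, pow_add]; ring
      _ = A * ENNReal.ofReal (Q ψ) * B * 2⁻¹ ^ k := by
          congr 1
          rw [mul_add, mul_one, pow_add, ENNReal.mul_inv (by simp) (by simp), mul_right_comm,
            ENNReal.inv_mul_cancel (by simp) (by simp), one_mul, ENNReal.inv_pow]
  calc ‖f ψ‖ₑ ≤ ∑' k, ‖conv (block φ k) f ψ‖ₑ := hφ.enorm_apply_le_tsum f ψ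
    _ ≤ ∑' k, A * ENNReal.ofReal (Q ψ) * B * 2⁻¹ ^ k := ENNReal.tsum_le_tsum hterm
    _ = A * ENNReal.ofReal (Q ψ) * B * 2 := by
        rw [ENNReal.tsum_mul_left, ENNReal.tsum_geometric, ENNReal.one_sub_inv_two, inv_inv]
    _ = _ := by
        rw [ENNReal.ofReal_mul (by positivity), ENNReal.ofReal_mul two_pos.le]
        simp only [ENNReal.ofReal_ofNat, ENNReal.ofReal_coe_nnreal]
        ring

end Embedding

/-! ### Completeness -/

section Completeness

variable {d : ℕ} {φ : 𝓢(EuclideanSpace ℝ (Fin d), ℂ)} {σ p q : ℝ}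
  {F : Type*} [NormedAddCommGroup F] [NormedSpace ℂ F] [CompleteSpace F]

theorem cauchySeq_of_edist_le {α : Type*} [PseudoEMetricSpace α] {x : ℕ → α} {c : ℝ≥0∞}
    (hc : c ≠ ⊤) {δ : ℕ → ℝ≥0∞} (hδ : Filter.Tendsto δ Filter.atTop (nhds 0))
    (h : ∀ m n, m ≤ n → edist (x n) (x m) ≤ c * δ m) : CauchySeq x := by
  refine EMetric.cauchySeq_iff'.2 fun ε hε => ?_
  have h1 : Filter.Tendsto (fun m => c * δ m) Filter.atTop (nhds 0) := by
    simpa using ENNReal.Tendsto.const_mul hδ (.inr hc)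
  obtain ⟨m, hm⟩ := (h1.eventually (gt_mem_nhds hε)).exists
  exact ⟨m, fun n hn => (h m n hn).trans_lt hm⟩

/-- The Besov spaces are complete. -/
theorem IsGenerator.exists_tendsto_of_cauchy (hφ : IsGenerator φ) (hp : 0 < p) (hq : 0 < q)
    {G : ℕ → 𝓢'(EuclideanSpace ℝ (Fin d), F)} (hG : ∀ n, G n ∈ besovSpace F φ σ p hq)
    {δ : ℕ → ℝ≥0∞} (hδ : Filter.Tendsto δ Filter.atTop (nhds 0)) (hδtop : ∀ m, δ m ≠ ⊤)
    (hGδ : ∀ m n, m ≤ n → besovNorm φ σ p q (G n - G m) ≤ δ m) :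
    ∃ Glim ∈ besovSpace F φ σ p hq, ∀ m, besovNorm φ σ p q (Glim - G m) ≤ δ m := by
  obtain ⟨Q, hQc, hQ0, hQn, hQ⟩ := hφ.exists_enorm_apply_le F σ hp hq
  have hsub : ∀ m n, G n - G m ∈ besovSpace F φ σ p hq := fun m n =>
    Submodule.sub_mem _ (hG n) (hG m)
  have hcauchy : ∀ ψ, CauchySeq fun n => G n ψ := fun ψ =>
    cauchySeq_of_edist_le ENNReal.ofReal_ne_top hδ fun m n hmn => by
      rw [edist_eq_enorm_sub]
      exact (hQ _ (hsub m n) ψ).trans (by gcongr; exact hGδ m n hmn)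
  choose L hL using fun ψ => cauchySeq_tendsto_of_complete (hcauchy ψ)
  have hLadd : ∀ ψ η, L (ψ + η) = L ψ + L η := fun ψ η =>
    tendsto_nhds_unique (hL (ψ + η)) (by simpa using (hL ψ).add (hL η))
  have hLsmul : ∀ (c : ℂ) ψ, L (c • ψ) = c • L ψ := fun c ψ =>
    tendsto_nhds_unique (hL (c • ψ)) (by simpa using (hL ψ).const_smul c)
  let Ll : 𝓢(EuclideanSpace ℝ (Fin d), ℂ) →ₗ[ℂ] F :=
    { toFun := L, map_add' := hLadd, map_smul' := hLsmul }
  have hLbound : ∀ ψ, ‖L ψ - G 0 ψ‖ₑ ≤ ENNReal.ofReal (Q ψ) * δ 0 := fun ψ => by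
    refine le_of_tendsto' ((hL ψ).sub_const (G 0 ψ)).enorm fun n => ?_
    exact (hQ _ (hsub 0 n) ψ).trans (by gcongr; exact hGδ 0 n (Nat.zero_le n))
  -- The pointwise limit differs from the continuous `G 0` by a linear map bounded by `Q ψ * δ 0`,
  -- hence continuous at 0.
  have hcont : Continuous Ll := by
    have hc0 : ContinuousAt (Ll - (G 0 : 𝓢(EuclideanSpace ℝ (Fin d), ℂ) →L[ℂ] F).toLinearMap) 0 := by
      rw [ContinuousAt, map_zero, tendsto_zero_iff_enorm_tendsto_zero]
      have h1 : Filter.Tendsto (fun ψ => ENNReal.ofReal (Q ψ) * δ 0) (nhds 0) (nhds 0) := by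
        have h2 := (ENNReal.continuous_ofReal.comp hQc).tendsto 0
        simp only [Function.comp_apply, hQ0, ENNReal.ofReal_zero] at h2
        simpa using ENNReal.Tendsto.mul_const h2 (.inr (hδtop 0))
      exact tendsto_of_tendsto_of_tendsto_of_le_of_le tendsto_const_nhds h1
        (fun _ => zero_le) hLbound
    have h2 := continuous_of_continuousAt_zero _ hc0
    have h3 := h2.add (G 0 : 𝓢(EuclideanSpace ℝ (Fin d), ℂ) →L[ℂ] F).continuous
    exact h3.congr fun ψ => sub_add_cancel _ _
  let Glim : 𝓢'(EuclideanSpace ℝ (Fin d), F) := (⟨Ll, hcont⟩ : 𝓢(EuclideanSpace ℝ (Fin d), ℂ) →L[ℂ] F)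
  have hGlim : ∀ ψ, Filter.Tendsto (fun n => G n ψ) Filter.atTop (nhds (Glim ψ)) := hL
  choose g hg using fun n => exists_blocksRepresentedBy hq (hG n)
  obtain ⟨A, M, hAM⟩ := hφ.exists_ae_enorm_block_le F hp
  -- By Nikolskii's inequality each block is Cauchy uniformly off a null set. This gives almost
  -- everywhere limits without passing to subsequences, and a bounded difference from the first term
  -- for dominated convergence.
  have hsup : ∀ k m n, m ≤ n → ∀ᵐ x, ‖g n k x - g m k x‖ₑ ≤
      A * 2 ^ (k * M) * ((weight σ k)⁻¹ * δ m) := by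
    intro k m n hmn
    have hr := (hg n).sub (hg m)
    have h1 : lpnn p volume (fun x => ‖(g n - g m) k x‖ₑ) ≤ (weight σ k)⁻¹ * δ m := by
      rw [mul_comm, ← div_eq_mul_inv, ENNReal.le_div_iff_mul_le (.inl (weight_ne_zero σ k))
        (.inl (weight_ne_top σ k)), mul_comm, ← (hr.isRepresentedBy k).distLpNorm_eq hp]
      exact (weight_mul_distLpNorm_le hq _ k).trans (hGδ m n hmn)
    have htop : (weight σ k)⁻¹ * δ m ≠ ⊤ :=
      ENNReal.mul_ne_top (ENNReal.inv_ne_top.2 (weight_ne_zero σ k)) (hδtop m)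
    filter_upwards [hAM _ k _ (hr.isRepresentedBy k) (ne_top_of_le_ne_top htop h1)] with x hx
    exact hx.trans (by gcongr)
  have hlim : ∀ k, ∃ gk : EuclideanSpace ℝ (Fin d) → F, StronglyMeasurable gk ∧
      ∀ᵐ x, Filter.Tendsto (fun n => g n k x) Filter.atTop (nhds (gk x)) := by
    intro k
    have h1 : ∀ᵐ x, ∀ m n, m ≤ n → ‖g n k x - g m k x‖ₑ ≤
        A * 2 ^ (k * M) * ((weight σ k)⁻¹ * δ m) := by
      refine ae_all_iff.2 fun m => ae_all_iff.2 fun n => ?_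
      by_cases hmn : m ≤ n
      · filter_upwards [hsup k m n hmn] with x hx _ using hx
      · exact Filter.Eventually.of_forall fun x h => absurd h hmn
    have h2 : ∀ᵐ x, ∃ l, Filter.Tendsto (fun n => g n k x) Filter.atTop (nhds l) := by
      filter_upwards [h1] with x hx
      refine cauchySeq_tendsto_of_complete (cauchySeq_of_edist_le
        (c := A * 2 ^ (k * M) * (weight σ k)⁻¹) ?_ hδ fun m n hmn => ?_)
      · exact ENNReal.mul_ne_top (ENNReal.mul_ne_top (by simp) (by simp))
          (ENNReal.inv_ne_top.2 (weight_ne_zero σ k))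
      · rw [edist_eq_enorm_sub, mul_assoc]
        exact hx m n hmn
    obtain ⟨gk, hgk, hgk'⟩ := exists_stronglyMeasurable_limit_of_tendsto_ae
      (fun n => ((hg n).stronglyMeasurable k).aestronglyMeasurable) h2
    exact ⟨gk, hgk, hgk'⟩
  choose gl hglm hgl using hlim
  have hrep : BlocksRepresentedBy φ Glim gl := by
    refine ⟨hglm, fun k => ⟨(hglm k).aestronglyMeasurable, fun ψ => ?_⟩⟩
    set c := A * 2 ^ (k * M) * ((weight σ k)⁻¹ * δ 0) with hc
    have hctop : c ≠ ⊤ := ENNReal.mul_ne_top (ENNReal.mul_ne_top (by simp) (by simp))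
      (ENNReal.mul_ne_top (ENNReal.inv_ne_top.2 (weight_ne_zero σ k)) (hδtop 0))
    have hb : ∀ n, ∀ᵐ x, ‖ψ x • g n k x‖ ≤ ‖ψ x • g 0 k x‖ + ‖ψ x‖ * c.toReal := by
      intro n
      filter_upwards [hsup k 0 n (Nat.zero_le n)] with x hx
      have h1 : ‖g n k x - g 0 k x‖ ≤ c.toReal := by
        rw [← toReal_enorm]
        exact ENNReal.toReal_mono hctop hx
      have h2 : ‖g n k x‖ ≤ ‖g 0 k x‖ + c.toReal := by
        have := norm_le_norm_add_norm_sub (g 0 k x) (g n k x)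
        rw [norm_sub_rev] at this
        linarith
      rw [norm_smul, norm_smul, ← mul_add]
      gcongr
    have hbi : Integrable fun x => ‖ψ x • g 0 k x‖ + ‖ψ x‖ * c.toReal :=
      (((hg 0).isRepresentedBy k).2 ψ).1.norm.add (ψ.integrable.norm.mul_const _)
    have hmeas : ∀ n, AEStronglyMeasurable (fun x => ψ x • g n k x) volume := fun n =>
      (((hg n).isRepresentedBy k).2 ψ).1.aestronglyMeasurable
    have hptw : ∀ᵐ x, Filter.Tendsto (fun n => ψ x • g n k x) Filter.atTop
        (nhds (ψ x • gl k x)) := by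
      filter_upwards [hgl k] with x hx using hx.const_smul _
    refine ⟨?_, ?_⟩
    · refine hbi.mono' (ψ.continuous.aestronglyMeasurable.smul
        (hglm k).aestronglyMeasurable) ?_
      filter_upwards [hptw, ae_all_iff.2 hb] with x hx hx'
      exact le_of_tendsto' hx.norm hx'
    · have h1 := tendsto_integral_of_dominated_convergence _ hmeas hbi hb hptw
      have h2 : Filter.Tendsto (fun n => conv (block φ k) (G n) ψ) Filter.atTop
          (nhds (conv (block φ k) Glim ψ)) := hGlim _
      refine tendsto_nhds_unique h2 (h1.congr fun n => ?_)
      exact ((((hg n).isRepresentedBy k).2 ψ).2).symm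
  have hle : ∀ m, besovNorm φ σ p q (Glim - G m) ≤ δ m := by
    intro m
    rw [(hrep.sub (hg m)).besovNorm_eq hp]
    refine mixedNorm_le_of_tendsto (v := fun n k x => ‖(g n - g m) k x‖ₑ) (weight σ)
      (weight_ne_top σ) hp hq (fun n k => ((hg n).sub (hg m)).measurable_enorm k)
      (fun k => ?_) ?_
    · filter_upwards [hgl k] with x hx
      exact (hx.sub_const _).enorm
    · filter_upwards [Filter.eventually_ge_atTop m] with n hn
      rw [← ((hg n).sub (hg m)).besovNorm_eq hp]
      exact hGδ m n hn
  refine ⟨Glim, ?_, hle⟩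
  have h1 : Glim - G 0 ∈ besovSpace F φ σ p hq :=
    (hle 0).trans_lt (lt_top_iff_ne_top.2 (hδtop 0))
  simpa using Submodule.add_mem _ h1 (hG 0)

end Completeness

/-! ### Orthonormal bases of separable spaces -/

section Bases

/-- Distinct members are at distance `√2`, so the balls of radius `1 / 2` around them are disjoint.
-/
theorem countable_of_orthonormal {𝕜 H ι : Type*} [RCLike 𝕜] [NormedAddCommGroup H]
    [InnerProductSpace 𝕜 H] [TopologicalSpace.SeparableSpace H] {v : ι → H}
    (hv : Orthonormal 𝕜 v) : Countable ι := by
  refine Pairwise.countable_of_isOpen_disjoint (s := fun i => Metric.ball (v i) (1 / 2))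
    (fun i k hik => Metric.ball_disjoint_ball ?_) (fun _ => Metric.isOpen_ball)
    (fun i => ⟨v i, Metric.mem_ball_self (by norm_num)⟩)
  have h : dist (v i) (v k) ^ 2 = 2 := by
    rw [dist_eq_norm, sq, norm_sub_mul_self (𝕜 := 𝕜), hv.2 hik, hv.1 i, hv.1 k]
    norm_num
  nlinarith [dist_nonneg (x := v i) (y := v k)]

namespace Complexification

variable {H : Type*} [NormedAddCommGroup H] [InnerProductSpace ℝ H]

theorem inner_ofReal_left (h : H) (z : Complexification H) :
    inner ℂ (ofReal h) z = ⟨inner ℝ h z.re, inner ℝ h z.im⟩ := by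
  simp [inner_def, ofReal]

/-- Pairing with a real basis vector reads off the coefficients of the real and of the imaginary
part separately, so a vector orthogonal to all of them is zero. -/
theorem exists_hilbertBasis_ofReal [CompleteSpace H] {ι : Type*} (b : HilbertBasis ι ℝ H) :
    ∃ c : HilbertBasis ι ℂ (Complexification H), ∀ i, c i = ofReal (b i) := by
  classical
  have hv : Orthonormal ℂ fun i => ofReal (b i) := by
    refine orthonormal_iff_ite.2 fun i k => ?_
    rw [inner_ofReal, orthonormal_iff_ite.1 b.orthonormal i k]
    split_ifs <;> simp
  refine ⟨HilbertBasis.mkOfOrthogonalEqBot hv ?_,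
    fun i => congrFun (HilbertBasis.coe_mkOfOrthogonalEqBot hv _) i⟩
  refine (Submodule.eq_bot_iff _).2 fun z hz => ?_
  have h0 : ∀ i, inner ℂ (ofReal (b i)) z = 0 := fun i =>
    (Submodule.mem_orthogonal _ _).1 hz _ (Submodule.subset_span ⟨i, rfl⟩)
  simp only [inner_ofReal_left, Complex.ext_iff, Complex.zero_re, Complex.zero_im] at h0
  have hzero : ∀ x : H, (∀ i, inner ℝ (b i) x = 0) → x = 0 := fun x hx => by
    apply b.repr.injective
    ext i
    rw [b.repr_apply_apply, hx]
    simp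
  exact eq_of_re_im (hzero _ fun i => (h0 i).1) (hzero _ fun i => (h0 i).2)

end Complexification

end Bases

/-! ### The `γ`-norm of operators with values in a Besov space -/

section GammaNorm

variable {d : ℕ} {φ : 𝓢(EuclideanSpace ℝ (Fin d), ℂ)} {σ p q : ℝ} {hq : 0 < q}

theorem besovNorm_neg {F : Type*} [NormedAddCommGroup F] [NormedSpace ℂ F] [CompleteSpace F]
    (hp : 0 < p) (hq : 0 < q) {f : 𝓢'(EuclideanSpace ℝ (Fin d), F)}
    (hf : f ∈ besovSpace F φ σ p hq) : besovNorm φ σ p q (-f) = besovNorm φ σ p q f := by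
  obtain ⟨g, hg⟩ := exists_blocksRepresentedBy hq hf
  have h := hg.smul (-1)
  rw [neg_one_smul] at h
  rw [h.besovNorm_eq hp, hg.besovNorm_eq hp]
  simp

/-- The Besov quasi-norm as a function on the Besov space. -/
noncomputable abbrev besovSize (φ : 𝓢(EuclideanSpace ℝ (Fin d), ℂ)) (σ p : ℝ) {q : ℝ}
    (hq : 0 < q) (f : besovSpace ℂ φ σ p hq) : ℝ≥0∞ :=
  besovNorm φ σ p q f.1

variable {𝕜 𝕂 H : Type*} [RCLike 𝕜] [RCLike 𝕂] {τ : 𝕜 →+* 𝕂}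
  [NormedAddCommGroup H] [InnerProductSpace 𝕜 H] [Module 𝕂 (besovSpace ℂ φ σ p hq)]

/-- The Gaussian coefficients act through `𝕂`; `hsmul` identifies this with the complex scalar
action and so makes the formula common to real and complex `H`. -/
theorem gammaNorm_besovSize
    (hsmul : ∀ (t : ℝ) (x : besovSpace ℂ φ σ p hq), (t : 𝕂) • x = (t : ℂ) • x)
    (R : H →ₛₗ[τ] besovSpace ℂ φ σ p hq) :
    gammaNorm (besovSize φ σ p hq) R =
      ⨆ (n : ℕ) (h : Fin n → H) (_ : Orthonormal 𝕜 h), lpnn 2 (gaussianPi n)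
        fun ω => besovNorm φ σ p q (∑ i, (ω i : ℂ) • (R (h i)).1) := by
  simp only [gammaNorm, lpnn, besovSize, hsmul, ENNReal.rpow_two]
  simp

theorem gammaNorm_sub_le (hp : 0 < p)
    (hsmul : ∀ (t : ℝ) (x : besovSpace ℂ φ σ p hq), (t : 𝕂) • x = (t : ℂ) • x)
    (R S : H →ₛₗ[τ] besovSpace ℂ φ σ p hq) :
    gammaNorm (besovSize φ σ p hq) (R - S) ≤
      2 ^ (1 + 1 / 2 : ℝ) * (2 ^ (1 + 1 / p) * 2 ^ (1 + 1 / q)) *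
        (gammaNorm (besovSize φ σ p hq) R + gammaNorm (besovSize φ σ p hq) S) := by
  simp only [gammaNorm_besovSize hsmul]
  refine iSup_le fun n => iSup₂_le fun h hh => ?_
  have hmR := measurable_besovNorm_gaussian_sum (φ := φ) (σ := σ) hp hq fun i => (R (h i)).2
  have hmS := measurable_besovNorm_gaussian_sum (φ := φ) (σ := σ) hp hq fun i => (S (h i)).2
  set u := fun ω : Fin n → ℝ => besovNorm φ σ p q (∑ i, (ω i : ℂ) • (R (h i)).1)
  set v := fun ω : Fin n → ℝ => besovNorm φ σ p q (∑ i, (ω i : ℂ) • (S (h i)).1)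
  have hmem : ∀ (T : H →ₛₗ[τ] besovSpace ℂ φ σ p hq) (ω : Fin n → ℝ),
      ∑ i, (ω i : ℂ) • (T (h i)).1 ∈ besovSpace ℂ φ σ p hq := fun T ω =>
    Submodule.sum_mem _ fun i _ => Submodule.smul_mem _ _ (T (h i)).2
  have h1 : ∀ ω : Fin n → ℝ, besovNorm φ σ p q (∑ i, (ω i : ℂ) • ((R - S) (h i)).1) ≤
      2 ^ (1 + 1 / p) * 2 ^ (1 + 1 / q) * (u ω + v ω) := by
    intro ω
    have e : ∑ i, (ω i : ℂ) • ((R - S) (h i)).1 =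
        ∑ i, (ω i : ℂ) • (R (h i)).1 + -∑ i, (ω i : ℂ) • (S (h i)).1 := by
      simp [sub_eq_add_neg, Finset.sum_add_distrib]
    rw [e]
    refine (besovNorm_add_le hp hq (hmem R ω) (Submodule.neg_mem _ (hmem S ω))).trans ?_
    rw [besovNorm_neg hp hq (hmem S ω)]
  calc lpnn 2 (gaussianPi n) (fun ω => besovNorm φ σ p q (∑ i, (ω i : ℂ) • ((R - S) (h i)).1))
      ≤ lpnn 2 (gaussianPi n) fun ω => 2 ^ (1 + 1 / p) * 2 ^ (1 + 1 / q) * (u ω + v ω) :=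
        lpnn_mono two_pos (Filter.Eventually.of_forall h1)
    _ = 2 ^ (1 + 1 / p) * 2 ^ (1 + 1 / q) * lpnn 2 (gaussianPi n) fun ω => u ω + v ω :=
        lpnn_const_mul two_pos _ (hmR.add hmS)
    _ ≤ 2 ^ (1 + 1 / p) * 2 ^ (1 + 1 / q) *
          (2 ^ (1 + 1 / 2 : ℝ) * (lpnn 2 (gaussianPi n) u + lpnn 2 (gaussianPi n) v)) := by
        gcongr
        exact lpnn_add_le two_pos hmR
    _ = 2 ^ (1 + 1 / 2 : ℝ) * (2 ^ (1 + 1 / p) * 2 ^ (1 + 1 / q)) *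
          (lpnn 2 (gaussianPi n) u + lpnn 2 (gaussianPi n) v) := by ring
    _ ≤ _ := by
        gcongr
        · exact le_iSup_of_le n (le_iSup₂_of_le h hh le_rfl)
        · exact le_iSup_of_le n (le_iSup₂_of_le h hh le_rfl)

/-- For a unit vector `h` the one-element system has Gaussian norm zero. The embedding into
distributions transfers this to the scalars `(R h) ψ`, which vanish by the scalar Gaussian lower
bound; scaling treats general `h`. -/
theorem IsGenerator.eq_zero_of_gammaNorm_eq_zero (hφ : IsGenerator φ) (hp : 0 < p)
    (hsmul : ∀ (t : ℝ) (x : besovSpace ℂ φ σ p hq), (t : 𝕂) • x = (t : ℂ) • x)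
    {R : H →ₛₗ[τ] besovSpace ℂ φ σ p hq} (hR : gammaNorm (besovSize φ σ p hq) R = 0) : R = 0 := by
  obtain ⟨Q, -, -, -, hQ⟩ := hφ.exists_enorm_apply_le ℂ σ hp hq
  obtain ⟨C, hC⟩ := exists_le_gaussian_sum two_pos
  have hunit : ∀ h : H, ‖h‖ = 1 → R h = 0 := by
    intro h hh
    apply Subtype.ext
    ext ψ
    have hon : Orthonormal 𝕜 fun _ : Fin 1 => h :=
      ⟨fun _ => hh, fun i k hik => absurd (Subsingleton.elim i k) hik⟩
    have hm := measurable_besovNorm_gaussian_sum (φ := φ) (σ := σ) hp hq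
      fun _ : Fin 1 => (R h).2
    have h0 : lpnn 2 (gaussianPi 1)
        (fun ω => besovNorm φ σ p q (∑ i, (ω i : ℂ) • (R h).1)) = 0 := by
      rw [gammaNorm_besovSize hsmul] at hR
      refine le_antisymm (le_trans ?_ hR.le) zero_le
      exact le_iSup_of_le 1 (le_iSup₂_of_le (fun _ => h) hon le_rfl)
    have h1 := hC 1 fun _ => (R h).1 ψ
    have h2 : lpnn 2 (gaussianPi 1) (fun ω => ‖∑ i, (ω i : ℂ) * (R h).1 ψ‖ₑ) ≤
        ENNReal.ofReal (Q ψ) * 0 := by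
      rw [← h0, ← lpnn_const_mul two_pos _ hm]
      refine lpnn_mono two_pos (Filter.Eventually.of_forall fun ω => ?_)
      have := hQ (∑ i, (ω i : ℂ) • (R h).1)
        (Submodule.sum_mem _ fun i _ => Submodule.smul_mem _ _ (R h).2) ψ
      simpa [-Complex.coe_smul] using this
    have h3 : ‖WithLp.toLp 2 fun _ : Fin 1 => (R h).1 ψ‖ₑ = 0 := by
      refine le_antisymm (h1.trans ?_) zero_le
      calc _ ≤ (C : ℝ≥0∞) * (ENNReal.ofReal (Q ψ) * 0) := by gcongr
        _ = 0 := by simp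
    rw [enorm_eq_zero] at h3
    exact congrFun (congrArg WithLp.ofLp h3) 0
  ext1 h
  by_cases hh : h = 0
  · simp [hh]
  · have h1 := hunit (((‖h‖⁻¹ : ℝ) : 𝕜) • h) (by
      rw [norm_smul, RCLike.norm_ofReal, abs_of_nonneg (by positivity),
        inv_mul_cancel₀ (norm_ne_zero_iff.2 hh)])
    have h2 : h = ((‖h‖ : ℝ) : 𝕜) • (((‖h‖⁻¹ : ℝ) : 𝕜) • h) := by
      rw [smul_smul, ← RCLike.ofReal_mul, mul_inv_cancel₀ (norm_ne_zero_iff.2 hh),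
        RCLike.ofReal_one, one_smul]
    rw [h2, map_smulₛₗ, h1, smul_zero]
    rfl

end GammaNorm

/-! ### The isomorphism -/

section Isomorphism

variable {d : ℕ} {φ : 𝓢(EuclideanSpace ℝ (Fin d), ℂ)} {σ p q : ℝ} {hq : 0 < q}
  {𝕜 𝕂 H K : Type*} [RCLike 𝕜] [RCLike 𝕂] {τ : 𝕜 →+* 𝕂}
  [NormedAddCommGroup H] [InnerProductSpace 𝕜 H]
  [NormedAddCommGroup K] [InnerProductSpace ℂ K]
  [Module 𝕂 (besovSpace ℂ φ σ p hq)]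

/-- The common features of the pairings for real and for complex Hilbert spaces: `H` is embedded
into the complex Hilbert space `K` by `j`, an orthonormal basis of `H` remains one in `K`, the
scalars `𝕂` act on the Besov space through `κ`, and `J G h = ⟨G, j h⟩`. -/
structure IsPairing (κ : 𝕂 → ℂ) (j : H → K)
    (J : besovSpace K φ σ p hq → (H →ₛₗ[τ] besovSpace ℂ φ σ p hq)) : Prop where
  smul_eq : ∀ (c : 𝕂) (x : besovSpace ℂ φ σ p hq), c • x = κ c • x
  map_ofReal : ∀ t : ℝ, κ t = t
  inner_eq : ∀ h g, inner ℂ (j g) (j h) = κ (τ (inner 𝕜 h g))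
  exists_basis : ∃ (s : Set H) (b : HilbertBasis s ℂ K), Countable s ∧
    Orthonormal 𝕜 (Subtype.val : s → H) ∧ ∀ i, b i = j i
  apply_eq : ∀ G h, (J G h).1 = pair (j h) G.1

namespace IsPairing

variable {κ : 𝕂 → ℂ} {j : H → K}
  {J : besovSpace K φ σ p hq → (H →ₛₗ[τ] besovSpace ℂ φ σ p hq)}

theorem ofReal_smul (hJ : IsPairing κ j J) (t : ℝ) (x : besovSpace ℂ φ σ p hq) : (t : 𝕂) • x = (t : ℂ) • x := by
  rw [hJ.smul_eq, hJ.map_ofReal]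

theorem orthonormal (hJ : IsPairing κ j J) {ι : Type*} {h : ι → H} (hh : Orthonormal 𝕜 h) :
    Orthonormal ℂ fun i => j (h i) := by
  classical
  have h0 : κ 0 = 0 := by simpa using hJ.map_ofReal 0
  have h1 : κ 1 = 1 := by simpa using hJ.map_ofReal 1
  refine orthonormal_iff_ite.2 fun i k => ?_
  rw [hJ.inner_eq, orthonormal_iff_ite.1 hh k i]
  simp only [eq_comm (a := k)]
  split_ifs <;> simp [h0, h1]

theorem map_sub (hJ : IsPairing κ j J) (G₁ G₂ : besovSpace K φ σ p hq) : J (G₁ - G₂) = J G₁ - J G₂ := by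
  ext h : 1
  apply Subtype.ext
  rw [LinearMap.sub_apply, Submodule.coe_sub]
  simp only [hJ.apply_eq]
  exact ContinuousLinearMap.map_sub _ _ _

theorem map_add (hJ : IsPairing κ j J) (G₁ G₂ : besovSpace K φ σ p hq) : J (G₁ + G₂) = J G₁ + J G₂ := by
  ext h : 1
  apply Subtype.ext
  rw [LinearMap.add_apply, Submodule.coe_add]
  simp only [hJ.apply_eq]
  exact ContinuousLinearMap.map_add _ _ _

theorem map_zero (hJ : IsPairing κ j J) : J 0 = 0 := by
  simpa using hJ.map_sub 0 0

theorem map_smul (hJ : IsPairing κ j J) (c : 𝕂) (G : besovSpace K φ σ p hq) : J (κ c • G) = c • J G := by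
  ext h : 1
  apply Subtype.ext
  rw [LinearMap.smul_apply, hJ.smul_eq, Submodule.coe_smul]
  simp only [hJ.apply_eq]
  exact ContinuousLinearMap.map_smul _ _ _

theorem map_sum (hJ : IsPairing κ j J) {ι : Type*} (s : Finset ι) (G : ι → besovSpace K φ σ p hq) :
    J (∑ i ∈ s, G i) = ∑ i ∈ s, J (G i) :=
  _root_.map_sum (AddMonoidHom.mk' J hJ.map_add) G s

theorem injective (hJ : IsPairing κ j J) : Function.Injective J := by
  obtain ⟨s, b, -, -, hb⟩ := hJ.exists_basis
  intro G₁ G₂ h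
  apply Subtype.ext
  ext ψ
  apply b.repr.injective
  ext i
  rw [b.repr_apply_apply, b.repr_apply_apply, hb]
  have h1 : pair (j i) G₁.1 = pair (j i) G₂.1 := by
    rw [← hJ.apply_eq, ← hJ.apply_eq, h]
  exact DFunLike.congr_fun h1 ψ

theorem gammaNorm_sub_le (hJ : IsPairing κ j J) (hp : 0 < p) : ∃ c : ℝ≥0∞, c ≠ ⊤ ∧
    ∀ R S : H →ₛₗ[τ] besovSpace ℂ φ σ p hq, gammaNorm (besovSize φ σ p hq) (R - S) ≤
      c * (gammaNorm (besovSize φ σ p hq) R + gammaNorm (besovSize φ σ p hq) S) := by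
  have h2 : ∀ t : ℝ, (2 : ℝ≥0∞) ^ t ≠ ⊤ := fun t =>
    ENNReal.rpow_ne_top_of_ne_zero (by simp) (by simp)
  exact ⟨_, ENNReal.mul_ne_top (h2 _) (ENNReal.mul_ne_top (h2 _) (h2 _)),
    BesovGamma.gammaNorm_sub_le hp hJ.ofReal_smul⟩

variable [CompleteSpace K]

theorem map_tensor (hJ : IsPairing κ j J) (h : H) (x : besovSpace ℂ φ σ p hq) :
    J ⟨tensor x.1 (j h), tensor_mem_besovSpace hq x.2 (j h)⟩ = rankOne τ h x := by
  ext g : 1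
  apply Subtype.ext
  rw [hJ.apply_eq]
  change _ = (τ (inner 𝕜 h g) • x : besovSpace ℂ φ σ p hq).1
  rw [hJ.smul_eq, Submodule.coe_smul, ← hJ.inner_eq]
  ext ψ
  change inner ℂ (j g) (x.1 ψ • j h) = inner ℂ (j g) (j h) * x.1 ψ
  rw [inner_smul_right, mul_comm]

theorem exists_eq_of_isFiniteRank (hJ : IsPairing κ j J) {S : H →ₛₗ[τ] besovSpace ℂ φ σ p hq} (hS : IsFiniteRank S) :
    ∃ G, J G = S := by
  induction hS using Submodule.span_induction with
  | mem S hS =>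
    obtain ⟨a, rfl⟩ := hS
    exact ⟨_, hJ.map_tensor a.1 a.2⟩
  | zero => exact ⟨0, hJ.map_zero⟩
  | add S T _ _ h₁ h₂ =>
    obtain ⟨G₁, rfl⟩ := h₁
    obtain ⟨G₂, rfl⟩ := h₂
    exact ⟨G₁ + G₂, hJ.map_add G₁ G₂⟩
  | smul c S _ h =>
    obtain ⟨G, rfl⟩ := h
    exact ⟨κ c • G, hJ.map_smul c G⟩

theorem gammaNorm_le (hJ : IsPairing κ j J) (hp : 0 < p) {r : ℝ} (hpr : p ≤ r) (hqr : q ≤ r) (h2r : 2 ≤ r) {C : ℝ≥0∞}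
    (hC : ∀ (n : ℕ) (c : Fin n → ℂ),
      lpnn r (gaussianPi n) (fun ω => ‖∑ i, (ω i : ℂ) * c i‖ₑ) ≤ C * ‖WithLp.toLp 2 c‖ₑ)
    (G : besovSpace K φ σ p hq) :
    gammaNorm (besovSize φ σ p hq) (J G) ≤ C * besovNorm φ σ p q G.1 := by
  rw [gammaNorm_besovSize hJ.ofReal_smul]
  refine iSup_le fun n => iSup₂_le fun h hh => ?_
  simp only [hJ.apply_eq]
  exact lpnn_besovNorm_pair_le hp hq hpr hqr h2r hC G.2 (hJ.orthonormal hh)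

/-- The basis of `K` consists of images of an orthonormal system of `H`, so each finite part of it
is admissible in the supremum defining the `γ`-norm. -/
theorem besovNorm_le (hJ : IsPairing κ j J) (hp : 0 < p) {s : ℝ} (hs : 0 < s) (hsp : s ≤ p) (hsq : s ≤ q) (hs2 : s ≤ 2)
    {C : ℝ≥0∞} (hC : ∀ (n : ℕ) (c : Fin n → ℂ),
      ‖WithLp.toLp 2 c‖ₑ ≤ C * lpnn s (gaussianPi n) (fun ω => ‖∑ i, (ω i : ℂ) * c i‖ₑ))
    (G : besovSpace K φ σ p hq) :
    besovNorm φ σ p q G.1 ≤ C * gammaNorm (besovSize φ σ p hq) (J G) := by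
  obtain ⟨t, b, ht, hto, hb⟩ := hJ.exists_basis
  refine besovNorm_le_lpnn_pair hp hq hs hsp hsq hs2 hC G.2 b fun n e he => ?_
  rw [gammaNorm_besovSize hJ.ofReal_smul]
  refine le_iSup_of_le n (le_iSup₂_of_le (fun i => (e i : H)) (hto.comp e he) ?_)
  simp only [hJ.apply_eq, hb]
  exact le_rfl

/-- Partial basis expansions of `G` correspond to finite rank operators, and the upper estimate
transports their Besov convergence to the `γ`-norm. -/
theorem mem_gammaSpace (hJ : IsPairing κ j J) (hp : 0 < p) {C : ℝ≥0}
    (hC : ∀ G, gammaNorm (besovSize φ σ p hq) (J G) ≤ C * besovNorm φ σ p q G.1)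
    (G : besovSpace K φ σ p hq) : J G ∈ gammaSpace H τ (besovSize φ σ p hq) := by
  refine ⟨(hC G).trans_lt (ENNReal.mul_lt_top ENNReal.coe_lt_top G.2), fun ε hε => ?_⟩
  obtain ⟨s, b, hs, -, hb⟩ := hJ.exists_basis
  obtain ⟨t, -, ht⟩ := Filter.exists_seq_monotone_tendsto_atTop_atTop (Finset s)
  have hlim := ENNReal.Tendsto.const_mul
    (tendsto_besovNorm_sub_sum_tensor hp hq G.2 b ht) (a := (C : ℝ≥0∞)) (.inr ENNReal.coe_ne_top)
  rw [mul_zero] at hlim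
  obtain ⟨m, hm⟩ := (hlim.eventually (gt_mem_nhds hε)).exists
  let T : besovSpace K φ σ p hq := ∑ i ∈ t m,
    ⟨tensor (J G (i : H)).1 (j i), tensor_mem_besovSpace hq (J G (i : H)).2 (j i)⟩
  refine ⟨J T, ?_, ?_⟩
  · rw [IsFiniteRank, hJ.map_sum]
    refine Submodule.sum_mem _ fun i _ => ?_
    rw [hJ.map_tensor]
    exact Submodule.subset_span ⟨((i : H), J G (i : H)), rfl⟩
  · rw [← hJ.map_sub]
    refine (hC _).trans_lt (lt_of_eq_of_lt ?_ hm)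
    simp only [T, Submodule.coe_sub, Submodule.coe_sum, hJ.apply_eq, hb]

/-- The finite rank approximations of `R` have preimages under `J`, which are Cauchy by the lower
estimate. Their limit is mapped to an operator at `γ`-distance zero from `R`. -/
theorem exists_eq_of_mem_gammaSpace (hJ : IsPairing κ j J) (hφ : IsGenerator φ) (hp : 0 < p)
    {C : ℝ≥0} (hC : ∀ G, gammaNorm (besovSize φ σ p hq) (J G) ≤ C * besovNorm φ σ p q G.1)
    (hC' : ∀ G, besovNorm φ σ p q G.1 ≤ C * gammaNorm (besovSize φ σ p hq) (J G))
    {R : H →ₛₗ[τ] besovSpace ℂ φ σ p hq} (hR : R ∈ gammaSpace H τ (besovSize φ σ p hq)) :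
    ∃ G, J G = R := by
  obtain ⟨c, hc, hsub⟩ := hJ.gammaNorm_sub_le hp
  set ε : ℕ → ℝ≥0 := fun n => (1 / 2) ^ n
  have hε : Filter.Tendsto (fun n => (ε n : ℝ≥0∞)) Filter.atTop (nhds 0) := by
    rw [← ENNReal.coe_zero, ENNReal.tendsto_coe]
    exact tendsto_pow_atTop_nhds_zero_of_lt_one zero_le (by norm_num [NNReal.div_lt_one_of_lt])
  have hεanti : Antitone ε := pow_right_anti₀ zero_le (by norm_num [div_le_one])
  choose S hS hSR using fun n => hR.2 (ε n) (by positivity)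
  choose G hG using fun n => hJ.exists_eq_of_isFiniteRank (hS n)
  set δ : ℕ → ℝ≥0∞ := fun m => C * (c * (ε m + ε m)) with hδdef
  have hδ : Filter.Tendsto δ Filter.atTop (nhds 0) := by
    have := ENNReal.Tendsto.const_mul (ENNReal.Tendsto.const_mul (hε.add hε) (.inr hc))
      (a := (C : ℝ≥0∞)) (.inr ENNReal.coe_ne_top)
    simpa using this
  have hδtop : ∀ m, δ m ≠ ⊤ := fun m =>
    ENNReal.mul_ne_top ENNReal.coe_ne_top (ENNReal.mul_ne_top hc (by simp))
  obtain ⟨Glim, hGlim, hlim⟩ := hφ.exists_tendsto_of_cauchy hp hq (fun n => (G n).2) hδ hδtop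
    fun m n hmn => by
      refine (hC' (G n - G m)).trans ?_
      -- Comparison through `R` keeps the quasi-triangle constant from accumulating: it is used once
      -- for each pair `m`, `n`.
      have e : J (G n - G m) = (R - S m) - (R - S n) := by
        rw [hJ.map_sub, hG, hG]; abel
      rw [e]
      refine mul_le_mul_right ((hsub _ _).trans (mul_le_mul_right (add_le_add (hSR m).le ?_) _)) _
      exact (hSR n).le.trans (ENNReal.coe_le_coe.2 (hεanti hmn))
  refine ⟨⟨Glim, hGlim⟩, (sub_eq_zero.1 (hφ.eq_zero_of_gammaNorm_eq_zero hp
    hJ.ofReal_smul ?_)).symm⟩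
  have h1 : Filter.Tendsto (fun n => c * (ε n + C * δ n)) Filter.atTop (nhds 0) := by
    have := ENNReal.Tendsto.const_mul (hε.add (ENNReal.Tendsto.const_mul hδ
      (a := (C : ℝ≥0∞)) (.inr ENNReal.coe_ne_top))) (.inr hc) (a := c)
    simpa using this
  refine le_antisymm (ge_of_tendsto' h1 fun n => ?_) zero_le
  have e : R - J ⟨Glim, hGlim⟩ = (R - S n) - J (⟨Glim, hGlim⟩ - G n) := by
    rw [hJ.map_sub, hG]; abel
  rw [e]
  refine (hsub _ _).trans (mul_le_mul_right (add_le_add (hSR n).le ?_) _)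
  exact (hC _).trans (mul_le_mul_right (hlim n) _)

/-- The isomorphism between the Besov space and the `γ`-space. -/
theorem isomorphism (hJ : IsPairing κ j J) (hφ : IsGenerator φ) (hp : 0 < p) {C : ℝ≥0}
    (hC : ∀ G, gammaNorm (besovSize φ σ p hq) (J G) ≤ C * besovNorm φ σ p q G.1 ∧
      besovNorm φ σ p q G.1 ≤ C * gammaNorm (besovSize φ σ p hq) (J G)) :
    (∀ (n : ℕ) (h : Fin n → H) (x : Fin n → besovSpace ℂ φ σ p hq),
      gammaNorm (besovSize φ σ p hq) (∑ i, rankOne τ (h i) (x i)) ≤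
        C * besovNorm φ σ p q (∑ i, tensor (x i).1 (j (h i))) ∧
      besovNorm φ σ p q (∑ i, tensor (x i).1 (j (h i))) ≤
        C * gammaNorm (besovSize φ σ p hq) (∑ i, rankOne τ (h i) (x i))) ∧
    Function.Injective J ∧ Set.range J = gammaSpace H τ (besovSize φ σ p hq) ∧
    ∀ G, gammaNorm (besovSize φ σ p hq) (J G) ≤ C * besovNorm φ σ p q G.1 ∧
      besovNorm φ σ p q G.1 ≤ C * gammaNorm (besovSize φ σ p hq) (J G) := by
  refine ⟨fun n h x => ?_, hJ.injective, ?_, hC⟩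
  · have h1 := hC (∑ i, ⟨tensor (x i).1 (j (h i)), tensor_mem_besovSpace hq (x i).2 (j (h i))⟩)
    simpa only [hJ.map_sum, hJ.map_tensor, Submodule.coe_sum] using h1
  · ext R
    constructor
    · rintro ⟨G, rfl⟩
      exact hJ.mem_gammaSpace hp (fun G => (hC G).1) G
    · exact hJ.exists_eq_of_mem_gammaSpace hφ hp (fun G => (hC G).1) fun G => (hC G).2

end IsPairing

/-! ### The complex and the real pairing -/

theorem isPairing_besovPairing (φ : 𝓢(EuclideanSpace ℝ (Fin d), ℂ)) (σ p : ℝ) {q : ℝ}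
    (hq : 0 < q) (H : Type*) [NormedAddCommGroup H] [InnerProductSpace ℂ H] [CompleteSpace H]
    [TopologicalSpace.SeparableSpace H] :
    IsPairing (𝕜 := ℂ) (𝕂 := ℂ) id id (besovPairing φ σ p hq H) where
  smul_eq _ _ := rfl
  map_ofReal _ := rfl
  inner_eq h g := (inner_conj_symm g h).symm
  exists_basis := by
    obtain ⟨s, b, hb⟩ := exists_hilbertBasis ℂ H
    exact ⟨s, b, countable_of_orthonormal b.orthonormal, hb ▸ b.orthonormal, fun i => by simp [hb]⟩
  apply_eq _ _ := rfl

theorem isPairing_besovPairingReal (φ : 𝓢(EuclideanSpace ℝ (Fin d), ℂ)) (σ p : ℝ) {q : ℝ}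
    (hq : 0 < q) (H : Type*) [NormedAddCommGroup H] [InnerProductSpace ℝ H] [CompleteSpace H]
    [TopologicalSpace.SeparableSpace H] :
    IsPairing (𝕜 := ℝ) (𝕂 := ℝ) Complex.ofReal Complexification.ofReal
      (besovPairingReal φ σ p hq H) where
  smul_eq _ _ := rfl
  map_ofReal _ := rfl
  inner_eq h g := by rw [Complexification.inner_ofReal, real_inner_comm]; rfl
  exists_basis := by
    obtain ⟨s, b, hb⟩ := exists_hilbertBasis ℝ H
    obtain ⟨c, hc⟩ := Complexification.exists_hilbertBasis_ofReal b
    exact ⟨s, c, countable_of_orthonormal b.orthonormal, hb ▸ b.orthonormal,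
      fun i => by rw [hc, hb]⟩
  apply_eq _ _ := rfl

end Isomorphism

end BesovGamma

/-! ### The proposition for real and complex Hilbert spaces -/

theorem propositionA1 (p q : ℝ) (hp : 0 < p) (hq : 0 < q) :
    ∃ C : ℝ≥0, ∀ (d : ℕ) (σ : ℝ) (φ : 𝓢(EuclideanSpace ℝ (Fin d), ℂ)),
      BesovGamma.IsGenerator φ →
      -- complex Hilbert spaces
      (∀ (H : Type*) [NormedAddCommGroup H] [InnerProductSpace ℂ H] [CompleteSpace H]
          [TopologicalSpace.SeparableSpace H],
        let B := BesovGamma.besovSpace ℂ φ σ p hq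
        let I := BesovGamma.besovPairing φ σ p hq H
        let N : B → ℝ≥0∞ := fun f => BesovGamma.besovNorm φ σ p q f.1
        -- finite rank operators
        (∀ (n : ℕ) (h : Fin n → H) (x : Fin n → B),
          BesovGamma.gammaNorm N
              (∑ i, BesovGamma.rankOne (starRingEnd ℂ) (h i) (x i)) ≤
            C * BesovGamma.besovNorm φ σ p q (∑ i, BesovGamma.tensor (x i).1 (h i)) ∧
          BesovGamma.besovNorm φ σ p q (∑ i, BesovGamma.tensor (x i).1 (h i)) ≤
            C * BesovGamma.gammaNorm N
              (∑ i, BesovGamma.rankOne (starRingEnd ℂ) (h i) (x i))) ∧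
        -- `I` is an isomorphism
        Function.Injective I ∧
        Set.range I = BesovGamma.gammaSpace H (starRingEnd ℂ) N ∧
        ∀ G, BesovGamma.gammaNorm N (I G) ≤ C * BesovGamma.besovNorm φ σ p q G.1 ∧
          BesovGamma.besovNorm φ σ p q G.1 ≤ C * BesovGamma.gammaNorm N (I G)) ∧
      -- real Hilbert spaces
      (∀ (H : Type*) [NormedAddCommGroup H] [InnerProductSpace ℝ H] [CompleteSpace H]
          [TopologicalSpace.SeparableSpace H],
        let B := BesovGamma.besovSpace ℂ φ σ p hq
        let I := BesovGamma.besovPairingReal φ σ p hq H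
        let N : B → ℝ≥0∞ := fun f => BesovGamma.besovNorm φ σ p q f.1
        -- finite rank operators
        (∀ (n : ℕ) (h : Fin n → H) (x : Fin n → B),
          BesovGamma.gammaNorm N
              (∑ i, BesovGamma.rankOne (RingHom.id ℝ) (h i) (x i)) ≤
            C * BesovGamma.besovNorm φ σ p q
              (∑ i, BesovGamma.tensor (x i).1 (BesovGamma.Complexification.ofReal (h i))) ∧
          BesovGamma.besovNorm φ σ p q
              (∑ i, BesovGamma.tensor (x i).1 (BesovGamma.Complexification.ofReal (h i))) ≤
            C * BesovGamma.gammaNorm N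
              (∑ i, BesovGamma.rankOne (RingHom.id ℝ) (h i) (x i))) ∧
        -- `I` is an isomorphism
        Function.Injective I ∧
        Set.range I = BesovGamma.gammaSpace H (RingHom.id ℝ) N ∧
        ∀ G, BesovGamma.gammaNorm N (I G) ≤ C * BesovGamma.besovNorm φ σ p q G.1 ∧
          BesovGamma.besovNorm φ σ p q G.1 ≤ C * BesovGamma.gammaNorm N (I G)) := by
  -- Minkowski's inequality requires an exponent above `p`, `q` and 2 for the upper estimate and one
  -- below them for the lower. Both constants are chosen before `d`, `σ`, `φ` and `H`.
  obtain ⟨C₁, hC₁⟩ := BesovGamma.exists_gaussian_sum_le (r := max 2 (max p q)) (by positivity)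
  obtain ⟨C₂, hC₂⟩ := BesovGamma.exists_le_gaussian_sum (r := min 2 (min p q)) (by positivity)
  refine ⟨max C₁ C₂, fun d σ φ hφ => ⟨fun H _ _ _ _ => ?_, fun H _ _ _ _ => ?_⟩⟩
  · have hJ := BesovGamma.isPairing_besovPairing φ σ p hq H
    refine hJ.isomorphism hφ hp fun G => ⟨?_, ?_⟩
    · refine (hJ.gammaNorm_le hp (by simp) (by simp) (by simp) hC₁ G).trans ?_
      gcongr
      exact le_max_left _ _
    · refine (hJ.besovNorm_le hp (by positivity) (by simp) (by simp) (by simp) hC₂ G).trans ?_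
      gcongr
      exact le_max_right _ _
  · have hJ := BesovGamma.isPairing_besovPairingReal φ σ p hq H
    refine hJ.isomorphism hφ hp fun G => ⟨?_, ?_⟩
    · refine (hJ.gammaNorm_le hp (by simp) (by simp) (by simp) hC₁ G).trans ?_
      gcongr
      exact le_max_left _ _
    · refine (hJ.besovNorm_le hp (by positivity) (by simp) (by simp) (by simp) hC₂ G).trans ?_
      gcongr
      exact le_max_right _ _
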